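/- All logarithms are in base $2$. A tournament is an orientation of a complete graph; the random tournament on $N$ vertices is obtained by orienting each edge of the complete graph on $N$ vertices uniformly at random, independently of the other edges. A $k$-edge-colouring assigns one of $k$ colours to each directed edge, and a monochromatic path of length $n$ is a directed path with $n$ edges (on $n+1$ distinct vertices), all of the same colour. Theorem. Let $k \ge 2$ be an integer. (a) There is a constant $C = C(k) > 0$ such that the following holds. Let $(N_n)$ be any sequence of positive integers with $N_n \ge C\, n^{k-1}\sqrt{\log n}$ for all sufficiently large $n$. Then the probability that every $k$-edge-colouring of the random tournament on $N_n$ vertices contains a monochromatic path of length $n$ tends to $1$ as $n \to \infty$. (b) There is $n_0 = n_0(k)$ such that for every $n \ge n_0$, every tournament on at most $\frac12\, n^{k-1} (\log n)^{1/k}$ vertices has a $k$-edge-colouring with no monochromatic path of length $n$. -/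

import Mathlib

open Filter Topology MeasureTheory

/-- A tournament: an orientation of the complete graph. There are no loops, and between any two
distinct vertices exactly one of the two possible directed edges is present. -/
def Digraph.IsTournament {V : Type*} (T : Digraph V) : Prop :=
  (∀ v, ¬ T.Adj v v) ∧ ∀ u v, u ≠ v → Xor (T.Adj u v) (T.Adj v u)

/-- A `k`-edge-colouring of a directed graph: a colour in `Fin k` for each directed edge. -/
def Digraph.EdgeColouring {V : Type*} (T : Digraph V) (k : ℕ) : Type _ :=
  ∀ u v : V, T.Adj u v → Fin k

/-- The coloured digraph contains a monochromatic directed path of length `n`, that is, distinct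
vertices `p 0, …, p n` such that all the `n` edges `p i → p (i + 1)` are present and have the same
colour. -/
def Digraph.EdgeColouring.HasMonoPath {V : Type*} {T : Digraph V} {k : ℕ}
    (c : T.EdgeColouring k) (n : ℕ) : Prop :=
  ∃ (a : Fin k) (p : Fin (n + 1) → V), Function.Injective p ∧
    ∀ i : Fin n, ∃ h : T.Adj (p i.castSucc) (p i.succ), c _ _ h = a

/-- The edges of the complete graph on `Fin N`, written as pairs `(i, j)` with `i < j`. -/
abbrev CompleteEdge (N : ℕ) : Type := {e : Fin N × Fin N // e.1 < e.2}

/-- The orientation of the complete graph on `Fin N` in which the edge between `i < j` is directed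
from `i` to `j` if `ω (i, j)` is `true` and from `j` to `i` if it is `false`. -/
def orientComplete {N : ℕ} (ω : CompleteEdge N → Bool) : Digraph (Fin N) where
  Adj u v := (∃ h : u < v, ω ⟨(u, v), h⟩ = true) ∨ (∃ h : v < u, ω ⟨(v, u), h⟩ = false)

/-- Sanity check: every orientation of the complete graph is a tournament. -/
theorem orientComplete_isTournament {N : ℕ} (ω : CompleteEdge N → Bool) :
    (orientComplete ω).IsTournament := by
  refine ⟨fun v h => ?_, fun u v huv => ?_⟩
  · rcases h with ⟨h, _⟩ | ⟨h, _⟩ <;> exact lt_irrefl _ h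
  · rcases lt_or_gt_of_ne huv with h | h
    · have h' : ¬ v < u := not_lt.mpr h.le
      cases hω : ω ⟨(u, v), h⟩ <;> simp [orientComplete, Xor, h, h', hω]
    · have h' : ¬ u < v := not_lt.mpr h.le
      cases hω : ω ⟨(v, u), h⟩ <;> simp [orientComplete, Xor, h, h', hω]

/-- The probability space of the random tournament on `N` vertices: independent fair coins, one for
each edge of the complete graph. The random tournament itself is `orientComplete ω`. -/
noncomputable def coinMeasure (N : ℕ) : Measure (CompleteEdge N → Bool) :=
  Measure.pi fun _ => (PMF.uniformOfFintype Bool).toMeasure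

/-- Sanity check: this is a probability measure. -/
instance coinMeasure_isProbabilityMeasure (N : ℕ) : IsProbabilityMeasure (coinMeasure N) := by
  unfold coinMeasure
  infer_instance

/-! For (a), restrict to about `n ^ (k - 1) * √log n` vertices and suppose that no colour has a path
with `n` edges. A colour without long paths has a rank function with `n` values that every edge
changes, so some rank class of proportion `1 / n` avoids that colour; peeling off `k - 2` colours
leaves a two-coloured set `W`. With high probability any two disjoint sets of `κ = O(log n)`
vertices span edges in both directions, and the aim is `W.card ≤ m + 400 * n` with `m = O(n √log
n)`.

Suppose first that some `m` vertices contain no monochromatic cycle of length at least `10 * κ`. For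
each colour, a depth-first search yields a forest and a rank below `n` such that every edge raises
the rank or goes to a near ancestor (`exists_parent_rank`). The two ranks embed the `m` vertices in
an `n × n` grid, and a pair increasing in both ranks and not near in either forest must be oriented
upwards. Cutting the grid into squares of side about `√log n` and counting along coarse diagonals
gives more than `5 * log₂ M` forced pairs per vertex, `M` being the number of vertices kept
(`mul_card_le_card_forcedPairs`). The data forcing them (embedding, two ranks, two parent maps) cost
at most `5 * log₂ M` bits per vertex, so a union bound excludes this.

Otherwise every `m`-set contains a long monochromatic cycle. Such cycles can be replaced by cycles
of length between `10 * κ` and `40 * κ`, and `W` is exhausted greedily by them up to fewer than `m`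
vertices. Disjoint cycles of one colour that can be linked one after another form a path. If two
cycles cannot be linked in either direction, the other colour has an alternating cycle between them;
a pairing argument together with paths through half of a two-coloured complete digraph then bounds
the number of cycles by `O(n / κ)` (`IsTwoColoured.mul_card_le`). Hence `W` is too small.

For (b), it suffices to place the vertices in the grid `[n]^k` so that `u ≤ v` coordinatewise forces
the edge `u → v`: every edge then increases some coordinate, which serves as its colour
(`IsTournament.exists_edgeColouring`). The grid is cut into cells of side `s` with `s ^ k` a small
multiple of `log n`; a transitive subtournament of `s ^ k` vertices fills a cell in a linear
extension of the product order. Only cells in `r + 1` consecutive layers of constant coordinate sum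
are used, and gaps confine comparability to blocks of bounded size. Dependent random choice gives
nested sets in which small subsets have many common out-neighbours; in them a whole block can be
filled greedily with all comparable cells joined upwards (`IsHost.exists_isPlacement`). A second
moment computation shows that the best window has about `(r + 1) / √k` times `(n / s) ^ (k - 1)`
cells, and `r` is chosen so that the resulting constant exceeds `1 / 2`. -/

/-! ### Depth-first search: forests and ranks -/

/-- `f 0, …, f (s - 1)` is a directed cycle of length `s` in the relation `R`. -/
def IsDicycle {V : Type*} (R : V → V → Prop) (s : ℕ) (f : ℕ → V) : Prop :=
  Set.InjOn f (Set.Iio s) ∧ (∀ i, i + 1 < s → R (f i) (f (i + 1))) ∧ R (f (s - 1)) (f 0)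

theorem Digraph.EdgeColouring.hasMonoPath_of_list {V : Type*} {T : Digraph V} {k : ℕ}
    (c : T.EdgeColouring k) (a : Fin k) (n : ℕ) (l : List V) (hl : l.Nodup)
    (hc : l.IsChain fun u v => ∃ h : T.Adj u v, c u v h = a) (hn : n < l.length) :
    c.HasMonoPath n := by
  refine ⟨a, fun i => l[(i : ℕ)]'(by omega), fun i j hij => ?_, fun i => ?_⟩
  · exact Fin.ext ((List.Nodup.getElem_inj_iff hl).1 hij)
  · exact hc.getElem (i : ℕ) (by omega)

/-- In a relation that increases a rank and whose chains are bounded by `n`, the length of the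
longest chain ending at a vertex is a rank with values below `n`. -/
theorem exists_rank_lt_of_chain_length_le {V : Type*} (Q : V → V → Prop) (pos : V → ℕ)
    (hpos : ∀ u v, Q u v → pos u < pos v) (n : ℕ)
    (hlen : ∀ l : List V, l.Nodup → l.IsChain Q → l.length ≤ n) :
    ∃ ρ : V → ℕ, (∀ v, ρ v < n) ∧ ∀ u v, Q u v → ρ u < ρ v := by
  classical
  have hlen' : ∀ l : List V, l.IsChain (fun a b => Q b a) → l.length ≤ n := by
    intro l hl
    have h1 : l.reverse.IsChain Q := List.isChain_reverse.2 hl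
    have h2 : l.reverse.Pairwise (fun a b => pos a < pos b) := by
      have : Trans (fun a b : V => pos a < pos b) (fun a b : V => pos a < pos b)
          (fun a b : V => pos a < pos b) := ⟨fun h h' => lt_trans h h'⟩
      exact (h1.imp fun a b h => hpos a b h).pairwise
    have h3 : l.reverse.Nodup := h2.imp (fun h h' => by subst h'; exact lt_irrefl _ h)
    simpa using hlen _ h3 h1
  -- Here `k` counts the vertices of a chain before its end `v`, without `v` itself; this keeps the
  -- rank strictly below `n`.
  let P : V → ℕ → Prop := fun v k => ∃ l : List V, l.length = k ∧
    (v :: l).IsChain (fun a b => Q b a)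
  have hP : ∀ v k, P v k → k < n := by
    rintro v k ⟨l, rfl, h⟩
    have := hlen' _ h
    simpa using this
  have h0 : ∀ v, P v 0 := fun v => ⟨[], rfl, List.isChain_singleton _⟩
  refine ⟨fun v => Nat.findGreatest (P v) n, fun v => hP v _ ?_, fun u v huv => ?_⟩
  · exact Nat.findGreatest_spec (P := P v) (Nat.zero_le n) (h0 v)
  · obtain ⟨l, hl, hc⟩ := Nat.findGreatest_spec (P := P u) (Nat.zero_le n) (h0 u)
    have h1 : P v (Nat.findGreatest (P u) n + 1) :=
      ⟨u :: l, by simp [hl], List.isChain_cons_cons.2 ⟨huv, hc⟩⟩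
    exact Nat.lt_of_succ_le (Nat.le_findGreatest (hP _ _ h1).le h1)

/-- The state of a depth-first search: `A` lists the finished vertices, the most recent first,
`P` is the stack, and `par` the parent map. -/
structure DFSState {V : Type*} (R : V → V → Prop) (ℓ : ℕ) (par : V → V) (A P : List V) : Prop where
  nodup : (A ++ P).Nodup
  chain : P.IsChain fun a b => par a = b ∧ R b a
  root : ∀ r ∈ P.getLast?, par r = r
  closed : ∀ x ∈ A ++ P, par x ∈ A ++ P
  finished : ∀ A₁ a A₂, A = A₁ ++ a :: A₂ →
    (∀ v, R a v → v ≠ a → v ∈ A₂ ∨ ∃ j < ℓ, v = par^[j] a) ∧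
      (par a = a ∨ (R (par a) a ∧ par a ∉ A₂))

namespace DFSState

variable {V : Type*} {R : V → V → Prop} {ℓ : ℕ} {par : V → V} {A P : List V}

/-- The visited vertices are closed under `par`, so giving a parent to the new vertex `b` changes
none of their iterates. The default in `P.headD b` makes `b` its own parent when the stack is empty,
that is, a root. -/
theorem push [DecidableEq V] (h : DFSState R ℓ par A P) (b : V) (hb : b ∉ A ++ P)
    (hR : ∀ x ∈ P.head?, R x b) :
    DFSState R ℓ (Function.update par b (P.headD b)) A (b :: P) := by
  have hne : ∀ y ∈ A ++ P, Function.update par b (P.headD b) y = par y := fun y hy =>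
    Function.update_of_ne (by rintro rfl; exact hb hy) _ _
  have hit : ∀ j, ∀ y ∈ A ++ P, (Function.update par b (P.headD b))^[j] y = par^[j] y := by
    intro j
    induction j with
    | zero => intro y _; rfl
    | succ j ih =>
      intro y hy
      rw [Function.iterate_succ_apply, Function.iterate_succ_apply, hne y hy, ih _ (h.closed y hy)]
  refine ⟨?_, ?_, ?_, ?_, ?_⟩
  · rw [List.nodup_append_comm, List.cons_append, List.nodup_cons]
    exact ⟨fun h' => hb (by simp at h' ⊢; tauto), List.nodup_append_comm.1 h.nodup⟩
  · refine List.IsChain.cons ?_ ?_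
    · refine h.chain.imp_of_mem_imp fun x y hx hy hxy => ?_
      rwa [hne x (List.mem_append_right _ hx)]
    · intro y hy
      refine ⟨?_, hR y hy⟩
      rw [Function.update_self]
      cases P with
      | nil => simp at hy
      | cons p P => simpa using hy
  · intro r hr
    cases P with
    | nil => simp at hr; subst hr; simp
    | cons p P =>
      rw [List.getLast?_cons_cons] at hr
      rw [hne r (List.mem_append_right _ (List.mem_of_getLast? hr)), h.root r hr]
  · intro x hx
    by_cases hxb : x = b
    · subst hxb
      rw [Function.update_self]
      cases P with
      | nil => simp
      | cons p P => simp
    · have hx' : x ∈ A ++ P := by simp at hx ⊢; tauto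
      rw [hne x hx']
      have := h.closed x hx'
      simp at this ⊢; tauto
  · intro A₁ a A₂ hA
    have ha : a ∈ A ++ P := by simp [hA]
    obtain ⟨h1, h2⟩ := h.finished A₁ a A₂ hA
    rw [hne a ha]
    refine ⟨fun v hv hva => ?_, h2⟩
    simpa only [hit _ a ha] using h1 v hv hva

/-- A vertex is finished once all its out-neighbours are visited, so each of them was finished
earlier or is on the stack, where it equals some `par^[j] x`. If `j ≥ ℓ`, the stack from that
ancestor up to `x` and the edge back form a cycle with `j + 1` vertices, which is excluded. -/
theorem pop {x : V} (h : DFSState R ℓ par A (x :: P)) (hℓ : ∀ s f, ℓ ≤ s → ¬ IsDicycle R s f)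
    (hx : ∀ v, R x v → v ∈ A ++ (x :: P)) : DFSState R ℓ par (x :: A) P := by
  have hperm : (A ++ x :: P).Perm (x :: A ++ P) := List.perm_middle
  have hnd := h.nodup
  have hPnd : (x :: P).Nodup := (List.nodup_append.1 hnd).2.1
  have hidx : ∀ j (hj : j < (x :: P).length), (x :: P)[j] = par^[j] x := by
    intro j
    induction j with
    | zero => intro _; rfl
    | succ j ih =>
      intro hj
      rw [Function.iterate_succ_apply', ← ih (by omega)]
      exact (h.chain.getElem j hj).1.symm
  refine ⟨hperm.nodup_iff.1 hnd, h.chain.tail, ?_, ?_, ?_⟩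
  · intro r hr
    cases P with
    | nil => simp at hr
    | cons p P => exact h.root r (by rwa [List.getLast?_cons_cons])
  · intro y hy
    exact hperm.mem_iff.1 (h.closed y (hperm.mem_iff.2 hy))
  · intro A₁ a A₂ hA
    rcases List.cons_eq_append_iff.1 hA with ⟨rfl, hA'⟩ | ⟨A₁', rfl, hA'⟩
    · obtain ⟨rfl, rfl⟩ := List.cons_eq_cons.1 hA'
      refine ⟨fun v hv hva => ?_, ?_⟩
      · rcases List.mem_append.1 (hx v hv) with h' | h'
        · exact Or.inl h'
        · right
          obtain ⟨j, hj, rfl⟩ := List.getElem_of_mem h'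
          refine ⟨j, ?_, hidx j hj⟩
          by_contra hjℓ
          refine hℓ (j + 1) (fun i => if hi : i ≤ j then (a :: P)[j - i]'(by omega) else a)
            (by omega) ⟨?_, ?_, ?_⟩
          · intro i hi i' hi' hii
            simp only [Set.mem_Iio] at hi hi'
            simp only [show i ≤ j by omega, show i' ≤ j by omega, dif_pos] at hii
            have := (List.Nodup.getElem_inj_iff hPnd).1 hii
            omega
          · intro i hi
            simp only [show i ≤ j by omega, show i + 1 ≤ j by omega, dif_pos]
            have := (h.chain.getElem (j - (i + 1)) (by omega)).2
            simpa only [show j - (i + 1) + 1 = j - i by omega] using this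
          · simp
            exact hv
      · cases P with
        | nil => exact Or.inl (h.root a (by simp))
        | cons p P =>
          have h3 := (List.isChain_cons_cons.1 h.chain).1
          right
          rw [h3.1]
          refine ⟨h3.2, fun hp => ?_⟩
          exact (List.nodup_append.1 hnd).2.2 p hp p (by simp) rfl
    · exact h.finished A₁' a A₂ hA'

theorem exists_finished [Fintype V] (hℓ : ∀ s f, ℓ ≤ s → ¬ IsDicycle R s f)
    (h : DFSState R ℓ par A P) :
    ∃ par' A', DFSState R ℓ par' A' [] ∧ ∀ v, v ∈ A' := by
  classical
  -- A push lowers the number of unvisited vertices by one and lengthens the stack by one; a pop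
  -- only shortens the stack. Either way the measure drops by one.
  induction hk : 2 * (Fintype.card V - (A ++ P).length) + P.length using Nat.strong_induction_on
    generalizing par A P with
  | _ k ih =>
    by_cases hb : ∃ b, b ∉ A ++ P ∧ ∀ x ∈ P.head?, R x b
    · obtain ⟨b, hb, hR⟩ := hb
      have h' := h.push b hb hR
      have hcard := List.Nodup.length_le_card h'.nodup
      refine ih _ ?_ h' rfl
      simp at hcard hk ⊢
      omega
    · push Not at hb
      cases P with
      | nil =>
        refine ⟨par, A, h, fun v => ?_⟩
        by_contra hv
        obtain ⟨x, hx, -⟩ := hb v (by simpa using hv)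
        simp at hx
      | cons x P =>
        have h' := h.pop hℓ (fun v hv => by
          by_contra hv'
          obtain ⟨y, hy, hy'⟩ := hb v hv'
          simp at hy
          subst hy
          exact hy' hv)
        refine ih _ ?_ h' rfl
        simp at hk ⊢
        omega

end DFSState

/-- A digraph whose paths have at most `n` vertices and which has no directed cycle of length at
least `ℓ` has a forest (given by a parent map) and a rank below `n` such that every edge increases
the rank or goes to one of the nearest `ℓ` ancestors, which has smaller rank. -/
theorem exists_parent_rank {V : Type*} [Fintype V] (R : V → V → Prop) (n ℓ : ℕ)
    (hn : ∀ l : List V, l.Nodup → l.IsChain R → l.length ≤ n)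
    (hℓ : ∀ s f, ℓ ≤ s → ¬ IsDicycle R s f) :
    ∃ (par : V → V) (ρ : V → ℕ), (∀ v, ρ v < n) ∧
      ∀ u v, R u v → u ≠ v → ρ u < ρ v ∨ ((∃ j < ℓ, v = par^[j] u) ∧ ρ v < ρ u) := by
  classical
  obtain ⟨par, A, hA, hmem⟩ := DFSState.exists_finished (R := R) (ℓ := ℓ) (par := id) (A := [])
    (P := []) hℓ ⟨by simp, by simp, by simp, by simp, by simp⟩
  have hnd : A.Nodup := by simpa using hA.nodup
  have hpos : ∀ A₁ a A₂, A = A₁ ++ a :: A₂ → ∀ v, (v ∈ A₂ ↔ A.idxOf a < A.idxOf v) := by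
    rintro A₁ a A₂ rfl v
    obtain ⟨h1, h2, h3⟩ := List.nodup_append.1 hnd
    have ha : a ∉ A₁ := fun h => h3 a h a (by simp) rfl
    rw [List.idxOf_append_of_notMem ha, List.idxOf_cons_self]
    constructor
    · intro hv
      have hv1 : v ∉ A₁ := fun h => h3 v h v (by simp [hv]) rfl
      have hva : a ≠ v := by rintro rfl; exact (List.nodup_cons.1 h2).1 hv
      rw [List.idxOf_append_of_notMem hv1, List.idxOf_cons_ne _ hva]
      omega
    · intro hlt
      by_contra hv
      by_cases hv1 : v ∈ A₁
      · rw [List.idxOf_append_of_mem hv1] at hlt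
        have := List.idxOf_lt_length_of_mem hv1
        omega
      · have hva : v = a := by
          have := hmem v
          simp at this
          tauto
        subst hva
        rw [List.idxOf_append_of_notMem hv1, List.idxOf_cons_self] at hlt
        omega
  -- The list `A` begins with the vertex finished last, so the edges increasing the index are those
  -- to vertices finished earlier; they form an acyclic relation. Tree edges belong to it, since a
  -- parent finishes after its child, so ancestors have smaller rank. All other edges go to near
  -- ancestors.
  obtain ⟨ρ, hρn, hρ⟩ := exists_rank_lt_of_chain_length_le
    (fun u v => R u v ∧ A.idxOf u < A.idxOf v) A.idxOf (fun u v h => h.2) n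
    (fun l hl hc => hn l hl (hc.imp fun a b h => h.1))
  have hpar : ∀ a, par a = a ∨ ρ (par a) < ρ a := by
    intro a
    obtain ⟨A₁, A₂, hsplit⟩ := List.append_of_mem (hmem a)
    rcases (hA.finished A₁ a A₂ hsplit).2 with h | ⟨h, h'⟩
    · exact Or.inl h
    · by_cases hne : par a = a
      · exact Or.inl hne
      right
      refine hρ _ _ ⟨h, ?_⟩
      rw [hpos A₁ a A₂ hsplit] at h'
      have h3 : A.idxOf (par a) ≠ A.idxOf a := fun h4 =>
        hne ((List.idxOf_inj (hmem _)).1 h4)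
      omega
  have hit : ∀ j a, par^[j] a = a ∨ ρ (par^[j] a) < ρ a := by
    intro j
    induction j with
    | zero => intro a; exact Or.inl rfl
    | succ j ih =>
      intro a
      rw [Function.iterate_succ_apply]
      rcases ih (par a) with h | h <;> rcases hpar a with h' | h'
      · left; rw [h, h']
      · right; rwa [h]
      · right; rw [h'] at h ⊢; exact h
      · right; exact h.trans h'
  refine ⟨par, ρ, hρn, fun u v huv hne => ?_⟩
  obtain ⟨A₁, A₂, hsplit⟩ := List.append_of_mem (hmem u)
  rcases (hA.finished A₁ u A₂ hsplit).1 v huv (Ne.symm hne) with h | ⟨j, hj, rfl⟩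
  · exact Or.inl (hρ _ _ ⟨huv, (hpos A₁ u A₂ hsplit v).1 h⟩)
  · right
    exact ⟨⟨j, hj, rfl⟩, (hit j u).resolve_left (Ne.symm hne)⟩

/-! ### Covering a complete digraph by two paths; Hamiltonian paths -/

/-- A path of `R`, written `P.reverse ++ G ++ D`: the vertices of `P` are active (the end first),
those of `D` are settled, and those of `G` may be dropped. Every vertex of `U` can be placed just
before `D`. -/
structure PathState {V : Type*} (R : V → V → Prop) (S U : Finset V) (P G D : List V) : Prop where
  chain : (P.reverse ++ (G ++ D)).IsChain R
  nodup : (P.reverse ++ (G ++ D)).Nodup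
  head : ∀ d ∈ D.head?, ∀ u ∈ U, R u d
  mem : ∀ x ∈ P.reverse ++ (G ++ D), x ∈ S ∧ x ∉ U

namespace PathState

variable {V : Type*} {R : V → V → Prop} {S U : Finset V} {P G D : List V}

theorem mono {U' : Finset V} (h : PathState R S U P G D) (hU : U' ⊆ U) : PathState R S U' P G D :=
  ⟨h.chain, h.nodup, fun d hd u hu => h.head d hd u (hU hu),
    fun x hx => ⟨(h.mem x hx).1, fun hx' => (h.mem x hx).2 (hU hx')⟩⟩

/-- By the invariant `head` an unvisited vertex has an edge straight to `D`, so the ghosts can be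
bypassed. -/
theorem dropGhosts (h : PathState R S U P G D) {v : V} (hv : v ∈ U) (hUS : U ⊆ S)
    (hR : ∀ x ∈ P.head?, R x v) [DecidableEq V] :
    PathState R S (U.erase v) (v :: P) [] D := by
  have hsub : (P.reverse ++ D).Sublist (P.reverse ++ (G ++ D)) :=
    (List.sublist_append_right G D).append_left _
  have hv' : v ∉ P.reverse ++ D := fun h' => (h.mem v (hsub.subset h')).2 hv
  have heq : (v :: P).reverse ++ ([] ++ D) = P.reverse ++ v :: D := by simp
  have hperm : (P.reverse ++ v :: D).Perm (v :: (P.reverse ++ D)) := List.perm_middle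
  refine ⟨?_, ?_, ?_, ?_⟩
  · rw [heq]
    refine List.IsChain.append h.chain.left_of_append ?_ ?_
    · exact List.IsChain.cons (h.chain.right_of_append.right_of_append)
        fun d hd => h.head d hd v hv
    · intro x hx y hy
      simp at hy hx
      subst hy
      exact hR x hx
  · rw [heq, hperm.nodup_iff, List.nodup_cons]
    exact ⟨hv', hsub.nodup h.nodup⟩
  · exact fun d hd u hu => h.head d hd u (Finset.mem_of_mem_erase hu)
  · intro x hx
    rw [heq, hperm.mem_iff, List.mem_cons] at hx
    rcases hx with rfl | hx
    · exact ⟨hUS hv, Finset.notMem_erase _ _⟩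
    · exact ⟨(h.mem x (hsub.subset hx)).1,
        fun h' => (h.mem x (hsub.subset hx)).2 (Finset.mem_of_mem_erase h')⟩

/-- Here `y` is the visited end of the other path. It may occur among the ghosts, which are
discarded at the same moment. -/
theorem pushTwo (h : PathState R S U P G D) {v y : V} (hv : v ∈ U) (hUS : U ⊆ S)
    (hR : ∀ x ∈ P.head?, R x y) (hy : y ∉ P) (hyD : y ∉ D) (hyS : y ∈ S) (hyU : y ∉ U)
    (hyv : R y v) [DecidableEq V] :
    PathState R S (U.erase v) (v :: y :: P) [] D := by
  have hsub : (P.reverse ++ D).Sublist (P.reverse ++ (G ++ D)) :=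
    (List.sublist_append_right G D).append_left _
  have hv' : v ∉ P.reverse ++ D := fun h' => (h.mem v (hsub.subset h')).2 hv
  have hvy : v ≠ y := by rintro rfl; exact hyU hv
  have heq : (v :: y :: P).reverse ++ ([] ++ D) = P.reverse ++ y :: v :: D := by simp
  have hperm : (P.reverse ++ y :: v :: D).Perm (y :: v :: (P.reverse ++ D)) :=
    List.perm_middle.trans (List.Perm.cons _ List.perm_middle)
  refine ⟨?_, ?_, ?_, ?_⟩
  · rw [heq]
    refine List.IsChain.append h.chain.left_of_append ?_ ?_
    · refine List.isChain_cons_cons.2 ⟨hyv, ?_⟩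
      exact List.IsChain.cons (h.chain.right_of_append.right_of_append)
        fun d hd => h.head d hd v hv
    · intro x hx z hz
      simp at hz hx
      subst hz
      exact hR x hx
  · rw [heq, hperm.nodup_iff, List.nodup_cons, List.nodup_cons]
    refine ⟨?_, hv', hsub.nodup h.nodup⟩
    simp [Ne.symm hvy, hy, hyD]
  · exact fun d hd u hu => h.head d hd u (Finset.mem_of_mem_erase hu)
  · intro x hx
    rw [heq, hperm.mem_iff, List.mem_cons, List.mem_cons] at hx
    rcases hx with rfl | rfl | hx
    · exact ⟨hyS, fun h' => hyU (Finset.mem_of_mem_erase h')⟩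
    · exact ⟨hUS hv, Finset.notMem_erase _ _⟩
    · exact ⟨(h.mem x (hsub.subset hx)).1,
        fun h' => (h.mem x (hsub.subset hx)).2 (Finset.mem_of_mem_erase h')⟩

theorem ghost {x : V} (h : PathState R S U (x :: P) G D) : PathState R S U P (x :: G) D := by
  have heq : (x :: P).reverse ++ (G ++ D) = P.reverse ++ (x :: G ++ D) := by simp
  obtain ⟨h1, h2, h3, h4⟩ := h
  rw [heq] at h1 h2 h4
  exact ⟨h1, h2, h3, h4⟩

/-- The ghosts behind `x` become permanent, as they connect `x` to the old `D`. -/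
theorem settle {x : V} (h : PathState R S U (x :: P) G D) (hx : ∀ u ∈ U, R u x) :
    PathState R S U P [] (x :: G ++ D) := by
  have heq : (x :: P).reverse ++ (G ++ D) = P.reverse ++ ([] ++ (x :: G ++ D)) := by simp
  obtain ⟨h1, h2, h3, h4⟩ := h
  rw [heq] at h1 h2 h4
  exact ⟨h1, h2, by simpa using hx, h4⟩

end PathState

/-- Two partial paths, one in `A` and one in `B`, can be extended over the unvisited
vertices `U` until together they cover `S`. -/
theorem exists_two_paths {V : Type*} [DecidableEq V] (A B : V → V → Prop) (S : Finset V)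
    (h : ∀ u ∈ S, ∀ v ∈ S, u ≠ v → A u v ∨ B v u) (U : Finset V) (hU : U ⊆ S)
    (P G D Q G' D' : List V) (hP : PathState A S U P G D) (hQ : PathState B S U Q G' D')
    (hcov : ∀ x ∈ S, x ∈ U ∨ x ∈ P ∨ x ∈ D ∨ x ∈ Q ∨ x ∈ D') :
    ∃ l l' : List V, l.Nodup ∧ l.IsChain A ∧ l'.Nodup ∧ l'.IsChain B ∧
      (∀ x ∈ l, x ∈ S) ∧ (∀ x ∈ l', x ∈ S) ∧ ∀ x ∈ S, x ∈ l ∨ x ∈ l' := by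
  -- Every move lowers this measure by one. In the last case a vertex leaves `U`, one active part
  -- gains two vertices and the other loses one.
  induction hk : 2 * U.card + P.length + Q.length using Nat.strong_induction_on
    generalizing U P G D Q G' D' with
  | _ k ih =>
  rcases U.eq_empty_or_nonempty with rfl | ⟨v₀, hv₀⟩
  · refine ⟨_, _, hP.nodup, hP.chain, hQ.nodup, hQ.chain, fun x hx => (hP.mem x hx).1,
      fun x hx => (hQ.mem x hx).1, fun x hx => ?_⟩
    have := hcov x hx
    simp at this ⊢
    tauto
  have hcard : ∀ v ∈ U, (U.erase v).card + 1 = U.card := fun v hv => Finset.card_erase_add_one hv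
  have herase : ∀ v, U.erase v ⊆ U := fun v => Finset.erase_subset _ _
  have hsplit : ∀ v x, x ∈ U → x ∈ U.erase v ∨ x = v := fun v x hx => by
    by_cases hxv : x = v
    · exact Or.inr hxv
    · exact Or.inl (Finset.mem_erase.2 ⟨hxv, hx⟩)
  by_cases hpushP : ∃ v ∈ U, ∀ x ∈ P.head?, A x v
  · obtain ⟨v, hv, hx⟩ := hpushP
    refine ih _ ?_ (U.erase v) ((herase v).trans hU) (v :: P) [] D Q G' D'
      (hP.dropGhosts hv hU hx) (hQ.mono (herase v)) ?_ rfl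
    · have := hcard v hv
      simp; omega
    · intro x hx
      have h1 := hcov x hx
      have h2 := hsplit v x
      simp only [List.mem_cons]
      clear * - h1 h2
      tauto
  by_cases hpushQ : ∃ v ∈ U, ∀ x ∈ Q.head?, B x v
  · obtain ⟨v, hv, hx⟩ := hpushQ
    refine ih _ ?_ (U.erase v) ((herase v).trans hU) P G D (v :: Q) [] D'
      (hP.mono (herase v)) (hQ.dropGhosts hv hU hx) ?_ rfl
    · have := hcard v hv
      simp; omega
    · intro x hx
      have h1 := hcov x hx
      have h2 := hsplit v x
      simp only [List.mem_cons]
      clear * - h1 h2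
      tauto
  push Not at hpushP hpushQ
  rcases P with _ | ⟨x, P⟩
  · simpa using hpushP v₀ hv₀
  rcases Q with _ | ⟨y, Q⟩
  · simpa using hpushQ v₀ hv₀
  simp only [List.head?_cons, Option.mem_some_iff, exists_eq_left'] at hpushP hpushQ
  -- Neither path can be extended now. An end that the other path also covers can become a ghost,
  -- since `hcov` does not count ghosts.
  by_cases hxQ : x ∈ y :: Q ∨ x ∈ D'
  · refine ih _ ?_ U hU P (x :: G) D (y :: Q) G' D' hP.ghost hQ ?_ rfl
    · simp at hk ⊢; omega
    · intro z hz
      have h1 := hcov z hz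
      by_cases hzx : z = x
      · subst hzx
        clear * - hxQ
        tauto
      · simp only [List.mem_cons, hzx, false_or] at h1 ⊢
        clear * - h1
        tauto
  by_cases hyP : y ∈ x :: P ∨ y ∈ D
  · refine ih _ ?_ U hU (x :: P) G D Q (y :: G') D' hP hQ.ghost ?_ rfl
    · simp at hk ⊢; omega
    · intro z hz
      have h1 := hcov z hz
      by_cases hzy : z = y
      · subst hzy
        clear * - hyP
        tauto
      · simp only [List.mem_cons, hzy, false_or] at h1 ⊢
        clear * - h1
        tauto
  by_cases hdx : ∀ u ∈ U, A u x
  · refine ih _ ?_ U hU P [] (x :: G ++ D) (y :: Q) G' D' (hP.settle hdx) hQ ?_ rfl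
    · simp at hk ⊢; omega
    · intro z hz
      have h1 := hcov z hz
      simp only [List.mem_cons, List.mem_append, List.cons_append] at h1 ⊢
      clear * - h1
      tauto
  by_cases hdy : ∀ u ∈ U, B u y
  · refine ih _ ?_ U hU (x :: P) G D Q [] (y :: G' ++ D') hP (hQ.settle hdy) ?_ rfl
    · simp at hk ⊢; omega
    · intro z hz
      have h1 := hcov z hz
      simp only [List.mem_cons, List.mem_append, List.cons_append] at h1 ⊢
      clear * - h1
      tauto
  push Not at hdx hdy hxQ hyP
  -- Neither end can be settled, so by `h` the vertex `x` has a `B`-edge into `U` and `y` an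
  -- `A`-edge into `U`. Whichever relation joins `x` and `y`, the path in that relation absorbs the
  -- other end and then continues into `U`.
  obtain ⟨v, hv, hvx⟩ := hdx
  obtain ⟨w, hw, hwy⟩ := hdy
  have hxS := hP.mem x (by simp)
  have hyS := hQ.mem y (by simp)
  have hxv : B x v := (h v (hU hv) x hxS.1 (by rintro rfl; exact hxS.2 hv)).resolve_left hvx
  have hyw : A y w := (h y hyS.1 w (hU hw) (by rintro rfl; exact hyS.2 hw)).resolve_right hwy
  rcases h x hxS.1 y hyS.1 (by rintro rfl; exact hxQ.1 (by simp)) with hxy | hyx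
  · refine ih _ ?_ (U.erase w) ((herase w).trans hU) (w :: y :: x :: P) [] D Q (y :: G') D'
      (hP.pushTwo hw hU (by simpa using hxy) hyP.1 hyP.2 hyS.1 hyS.2 hyw)
      (hQ.ghost.mono (herase w)) ?_ rfl
    · have := hcard w hw
      simp at hk ⊢; omega
    · intro z hz
      have h1 := hcov z hz
      have h2 := hsplit w z
      simp only [List.mem_cons] at h1 ⊢
      clear * - h1 h2
      tauto
  · refine ih _ ?_ (U.erase v) ((herase v).trans hU) P (x :: G) D (v :: x :: y :: Q) [] D'
      (hP.ghost.mono (herase v))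
      (hQ.pushTwo hv hU (by simpa using hyx) hxQ.1 hxQ.2 hxS.1 hxS.2 hxv) ?_ rfl
    · have := hcard v hv
      simp at hk ⊢; omega
    · intro z hz
      have h1 := hcov z hz
      have h2 := hsplit v z
      simp only [List.mem_cons] at h1 ⊢
      clear * - h1 h2
      tauto

/-- In a complete digraph whose edges are covered by two relations, one of them has a path through
at least half of the vertices. -/
theorem exists_half_path {V : Type*} [DecidableEq V] (A B : V → V → Prop) (S : Finset V)
    (h : ∀ u ∈ S, ∀ v ∈ S, u ≠ v → A u v ∨ B u v) :
    ∃ l : List V, l.Nodup ∧ (∀ x ∈ l, x ∈ S) ∧ S.card ≤ 2 * l.length ∧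
      (l.IsChain A ∨ l.IsChain B) := by
  -- The second relation is reversed to match the form `A u v ∨ B v u`; the second path is turned
  -- around at the end.
  obtain ⟨l, l', h1, h2, h3, h4, h5, h6, h7⟩ := exists_two_paths A (fun u v => B v u) S h S
    (Finset.Subset.refl S) [] [] [] [] [] [] ⟨by simp, by simp, by simp, by simp⟩
    ⟨by simp, by simp, by simp, by simp⟩ (fun x hx => Or.inl hx)
  have hcard : S.card ≤ l.length + l'.length := by
    have : S ⊆ l.toFinset ∪ l'.toFinset := fun x hx => by simpa using h7 x hx
    calc S.card ≤ _ := Finset.card_le_card this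
      _ ≤ _ := Finset.card_union_le _ _
      _ ≤ _ := add_le_add (List.toFinset_card_le _) (List.toFinset_card_le _)
  rcases le_total l.length l'.length with hle | hle
  · refine ⟨l'.reverse, by simpa using h3, by simpa using h6, by simp; omega, Or.inr ?_⟩
    exact List.isChain_reverse.2 h4
  · exact ⟨l, h1, h5, by omega, Or.inl h2⟩

/-- Rédei: a semicomplete digraph has a Hamiltonian path. -/
theorem exists_hamiltonian_path {V : Type*} [DecidableEq V] (R : V → V → Prop) (S : Finset V)
    (h : ∀ u ∈ S, ∀ v ∈ S, u ≠ v → R u v ∨ R v u) :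
    ∃ l : List V, l.Nodup ∧ l.toFinset = S ∧ l.IsChain R := by
  induction S using Finset.induction_on with
  | empty => exact ⟨[], by simp⟩
  | insert a S ha ih =>
    obtain ⟨l, hl, rfl, hc⟩ := ih fun u hu v hv =>
      h u (Finset.mem_insert_of_mem hu) v (Finset.mem_insert_of_mem hv)
    have key : ∀ l : List V, l.IsChain R → (∀ x ∈ l, R a x ∨ R x a) →
        ∃ l₁ l₂, l = l₁ ++ l₂ ∧ (l₁ ++ a :: l₂).IsChain R := by
      intro l
      induction l with
      | nil => exact fun _ _ => ⟨[], [], rfl, by simp⟩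
      | cons b l ih =>
        intro hc hx
        rcases hx b (by simp) with hab | hba
        · exact ⟨[], b :: l, rfl, List.isChain_cons_cons.2 ⟨hab, hc⟩⟩
        · obtain ⟨l₁, l₂, rfl, h'⟩ := ih hc.tail fun x hx' => hx x (by simp [hx'])
          refine ⟨b :: l₁, l₂, rfl, List.IsChain.cons h' ?_⟩
          cases l₁ with
          | nil => simpa using hba
          | cons c l₁ => simpa using (List.isChain_cons_cons.1 hc).1
    obtain ⟨l₁, l₂, rfl, h'⟩ := key l hc fun x hx => by
      have hx' : x ∈ l.toFinset := by simpa using hx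
      exact h a (Finset.mem_insert_self _ _) x (Finset.mem_insert_of_mem hx')
        (by rintro rfl; exact ha hx')
    refine ⟨l₁ ++ a :: l₂, ?_, ?_, h'⟩
    · rw [List.nodup_middle, List.nodup_cons]
      exact ⟨by simpa using ha, hl⟩
    · ext x; simp

/-! ### Long paths and cycles when large sets always span edges -/

/-- If there is an edge from every `κ`-set to every disjoint `κ`-set, there is a path that misses
at most `2 κ` vertices. -/
theorem exists_path_of_forall_edge {V : Type*} [DecidableEq V] (R : V → V → Prop) (S : Finset V)
    (κ : ℕ) (h : ∀ X Y, X ⊆ S → Y ⊆ S → Disjoint X Y → κ ≤ X.card → κ ≤ Y.card →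
      ∃ x ∈ X, ∃ y ∈ Y, R x y) :
    ∃ l : List V, l.Nodup ∧ (∀ x ∈ l, x ∈ S) ∧ l.IsChain R ∧ S.card ≤ l.length + 2 * κ := by
  -- In a depth-first search `X` is finished, `Y` unvisited and `l` the stack, end first. There is
  -- never an edge from `X` to `Y`, and each move raises `X.card - Y.card` by one. At time `t =
  -- S.card` the two sizes agree, so both are below `κ`.
  have key : ∀ t ≤ 2 * S.card, ∃ (X Y : Finset V) (l : List V), l.Nodup ∧
      l.IsChain (fun a b => R b a) ∧ (∀ x ∈ l, x ∉ X ∧ x ∉ Y) ∧ Disjoint X Y ∧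
      (X ∪ Y ∪ l.toFinset = S) ∧ (∀ x ∈ X, ∀ y ∈ Y, ¬ R x y) ∧ X.card + S.card = Y.card + t := by
    intro t
    induction t with
    | zero => exact fun _ => ⟨∅, S, [], by simp⟩
    | succ t ih =>
      intro ht
      obtain ⟨X, Y, l, hl, hc, hmem, hXY, hS, hno, hcard⟩ := ih (by omega)
      by_cases hpush : ∃ b ∈ Y, ∀ x ∈ l.head?, R x b
      · obtain ⟨b, hb, hR⟩ := hpush
        have hbX : b ∉ X := fun h' => Finset.disjoint_left.1 hXY h' hb
        refine ⟨X, Y.erase b, b :: l, ?_, ?_, ?_, ?_, ?_, ?_, ?_⟩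
        · exact List.nodup_cons.2 ⟨fun h' => (hmem b h').2 hb, hl⟩
        · exact hc.cons hR
        · intro x hx
          rcases List.mem_cons.1 hx with rfl | hx
          · exact ⟨hbX, Finset.notMem_erase _ _⟩
          · exact ⟨(hmem x hx).1, fun h' => (hmem x hx).2 (Finset.mem_of_mem_erase h')⟩
        · exact hXY.mono_right (Finset.erase_subset _ _)
        · rw [← hS]
          ext z
          by_cases hz : z = b
          · subst hz; simp [hb]
          · simp [hz]
        · exact fun x hx y hy => hno x hx y (Finset.mem_of_mem_erase hy)
        · have := Finset.card_erase_add_one hb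
          omega
      · push Not at hpush
        cases l with
        | nil =>
          exfalso
          have hY : Y = ∅ := by
            by_contra hY
            obtain ⟨b, hb⟩ := Finset.nonempty_iff_ne_empty.2 hY
            simpa using hpush b hb
          subst hY
          simp at hS
          subst hS
          simp at hcard
          omega
        | cons x l =>
          simp only [List.head?_cons, Option.mem_some_iff, exists_eq_left'] at hpush
          have hx := hmem x (by simp)
          have hxl := List.nodup_cons.1 hl
          refine ⟨insert x X, Y, l, hxl.2, hc.tail, ?_, ?_, ?_, ?_, ?_⟩
          · intro z hz
            refine ⟨fun h' => ?_, (hmem z (by simp [hz])).2⟩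
            rcases Finset.mem_insert.1 h' with rfl | h'
            · exact hxl.1 hz
            · exact (hmem z (by simp [hz])).1 h'
          · exact Finset.disjoint_insert_left.2 ⟨hx.2, hXY⟩
          · rw [← hS]
            ext z
            simp
          · intro z hz y hy
            rcases Finset.mem_insert.1 hz with rfl | hz
            · exact hpush y hy
            · exact hno z hz y hy
          · rw [Finset.card_insert_of_notMem hx.1]
            omega
  obtain ⟨X, Y, l, hl, hc, hmem, hXY, hS, hno, hcard⟩ := key S.card (by omega)
  have hXk : X.card < κ := by
    by_contra hX
    obtain ⟨x, hx, y, hy, hxy⟩ := h X Y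
      (by rw [← hS]; exact Finset.subset_union_left.trans Finset.subset_union_left)
      (by rw [← hS]; exact Finset.subset_union_right.trans Finset.subset_union_left)
      hXY (by omega) (by omega)
    exact hno x hx y hy hxy
  refine ⟨l.reverse, by simpa using hl, ?_, List.isChain_reverse.2 hc, ?_⟩
  · intro x hx
    rw [← hS]
    simp at hx ⊢
    tauto
  · have h1 : S.card ≤ X.card + Y.card + l.length := by
      calc S.card = (X ∪ Y ∪ l.toFinset).card := by rw [hS]
        _ ≤ _ := Finset.card_union_le _ _
        _ ≤ _ := add_le_add (Finset.card_union_le _ _) (List.toFinset_card_le _)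
    simp
    omega

/-- If there is an edge from every `κ`-set to every disjoint `κ`-set, there is a cycle that misses
at most `4 κ` vertices. -/
theorem exists_dicycle_of_forall_edge {V : Type*} [DecidableEq V] (R : V → V → Prop)
    (S : Finset V) (κ : ℕ) (h : ∀ X Y, X ⊆ S → Y ⊆ S → Disjoint X Y → κ ≤ X.card → κ ≤ Y.card →
      ∃ x ∈ X, ∃ y ∈ Y, R x y) (hS : 4 * κ ≤ S.card) (hκ : 0 < κ) :
    ∃ s f, IsDicycle R s f ∧ (∀ i < s, f i ∈ S) ∧ S.card ≤ s + 4 * κ := by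
  obtain ⟨l, hl, hmem, hc, hlen⟩ := exists_path_of_forall_edge R S κ h
  have hinj : ∀ i j (hi : i < l.length) (hj : j < l.length), l[i] = l[j] → i = j :=
    fun i j hi hj hij => (List.Nodup.getElem_inj_iff hl).1 hij
  have hX : (l.drop (l.length - κ)).toFinset.card = κ := by
    rw [List.toFinset_card_of_nodup (hl.sublist (List.drop_sublist _ _)), List.length_drop]
    omega
  have hY : (l.take κ).toFinset.card = κ := by
    rw [List.toFinset_card_of_nodup (hl.sublist (List.take_sublist _ _)), List.length_take]
    omega
  -- An edge from the last `κ` vertices of the path to the first `κ` closes it into a cycle, at the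
  -- cost of at most `2 * κ` further vertices.
  obtain ⟨x, hx, y, hy, hxy⟩ := h (l.drop (l.length - κ)).toFinset (l.take κ).toFinset
    (fun z hz => hmem z (List.mem_of_mem_drop (List.mem_toFinset.1 hz)))
    (fun z hz => hmem z (List.mem_of_mem_take (List.mem_toFinset.1 hz)))
    (by
      rw [Finset.disjoint_left]
      intro z hz hz'
      rw [List.mem_toFinset] at hz hz'
      obtain ⟨i, hi, rfl⟩ := List.getElem_of_mem hz
      obtain ⟨j, hj, hij⟩ := List.getElem_of_mem hz'
      simp only [List.length_drop, List.length_take, List.getElem_drop, List.getElem_take]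
        at hi hj hij
      have := hinj _ _ _ _ hij
      omega) hX.ge hY.ge
  rw [List.mem_toFinset] at hx hy
  obtain ⟨i, hi, rfl⟩ := List.getElem_of_mem hx
  obtain ⟨j, hj, rfl⟩ := List.getElem_of_mem hy
  simp only [List.length_drop, List.length_take, List.getElem_drop, List.getElem_take] at hi hj hxy
  refine ⟨l.length - κ + i - j + 1, fun t => if ht : j + t < l.length then l[j + t] else l[j],
    ⟨?_, ?_, ?_⟩, ?_, ?_⟩
  · intro a ha b hb hab
    simp only [Set.mem_Iio] at ha hb
    simp only [show j + a < l.length by omega, show j + b < l.length by omega, dif_pos] at hab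
    have := hinj _ _ _ _ hab
    omega
  · intro a ha
    simp only [show j + a < l.length by omega, show j + (a + 1) < l.length by omega, dif_pos]
    exact hc.getElem (j + a) (by omega)
  · simp only [show j + (l.length - κ + i - j + 1 - 1) < l.length by omega,
      show j + 0 < l.length by omega, dif_pos]
    simp only [show j + (l.length - κ + i - j + 1 - 1) = l.length - κ + i by omega, add_zero]
    exact hxy
  · intro a ha
    simp only [show j + a < l.length by omega, dif_pos]
    exact hmem _ (List.getElem_mem _)
  · omega

theorem IsDicycle.rel_mod {V : Type*} {R : V → V → Prop} {s : ℕ} {f : ℕ → V}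
    (h : IsDicycle R s f) (hs : 0 < s) (m : ℕ) : R (f (m % s)) (f ((m + 1) % s)) := by
  have hlt := Nat.mod_lt m hs
  by_cases hm : m % s + 1 < s
  · have : (m + 1) % s = m % s + 1 := by
      rw [Nat.add_mod, Nat.mod_eq_of_lt (a := 1) (by omega), Nat.mod_eq_of_lt hm]
    rw [this]
    exact h.2.1 _ hm
  · have h1 : m % s = s - 1 := by omega
    have : (m + 1) % s = 0 := by
      rw [← Nat.mod_add_mod, h1, Nat.sub_add_cancel hs, Nat.mod_self]
    rw [this, h1]
    exact h.2.2

theorem IsDicycle.inj_mod {V : Type*} {R : V → V → Prop} {s : ℕ} {f : ℕ → V}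
    (h : IsDicycle R s f) (i a b : ℕ) (ha : a < s) (hb : b < s)
    (hab : f ((i + a) % s) = f ((i + b) % s)) : a = b := by
  have h1 := h.1 (Nat.mod_lt _ (by omega)) (Nat.mod_lt _ (by omega)) hab
  have h2 : a ≡ b [MOD s] := Nat.ModEq.add_left_cancel' i h1
  rwa [Nat.ModEq, Nat.mod_eq_of_lt ha, Nat.mod_eq_of_lt hb] at h2

/-- A chord of a cycle cuts off a shorter cycle. -/
theorem IsDicycle.chord {V : Type*} {R : V → V → Prop} {s : ℕ} {f : ℕ → V}
    (h : IsDicycle R s f) (i s' : ℕ) (hss : s' ≤ s)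
    (hR : R (f ((i + (s' - 1)) % s)) (f (i % s))) :
    IsDicycle R s' (fun t => f ((i + t) % s)) := by
  refine ⟨fun a ha b hb hab => ?_, fun t ht => ?_, by simpa using hR⟩
  · simp only [Set.mem_Iio] at ha hb
    exact h.inj_mod i a b (by omega) (by omega) hab
  · exact h.rel_mod (by omega) (i + t)

/-- Greedy: while fewer than `j` edges are chosen, both unmatched parts still have `κ` vertices. -/
theorem exists_matching {V : Type*} [DecidableEq V] (E : V → V → Prop) (X Y : Finset V) (κ : ℕ)
    (h : ∀ X' Y', X' ⊆ X → Y' ⊆ Y → κ ≤ X'.card → κ ≤ Y'.card → ∃ x ∈ X', ∃ y ∈ Y', E x y)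
    (j : ℕ) (hX : j + κ ≤ X.card + 1) (hY : j + κ ≤ Y.card + 1) :
    ∃ M : Finset (V × V), M.card = j ∧ (∀ p ∈ M, p.1 ∈ X ∧ p.2 ∈ Y ∧ E p.1 p.2) ∧
      Set.InjOn Prod.fst (M : Set (V × V)) ∧ Set.InjOn Prod.snd (M : Set (V × V)) := by
  induction j with
  | zero => exact ⟨∅, by simp⟩
  | succ j ih =>
    obtain ⟨M, hM, hmem, h1, h2⟩ := ih (by omega) (by omega)
    have hc1 := Finset.card_image_le (s := M) (f := Prod.fst)
    have hc2 := Finset.card_image_le (s := M) (f := Prod.snd)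
    have hd1 := Finset.le_card_sdiff (M.image Prod.fst) X
    have hd2 := Finset.le_card_sdiff (M.image Prod.snd) Y
    obtain ⟨x, hx, y, hy, hxy⟩ := h (X \ M.image Prod.fst) (Y \ M.image Prod.snd)
      Finset.sdiff_subset Finset.sdiff_subset (by omega) (by omega)
    rw [Finset.mem_sdiff, Finset.mem_image] at hx hy
    have hnot : (x, y) ∉ M := fun h' => hx.2 ⟨_, h', rfl⟩
    refine ⟨insert (x, y) M, by rw [Finset.card_insert_of_notMem hnot, hM], ?_, ?_, ?_⟩
    · intro p hp
      rcases Finset.mem_insert.1 hp with rfl | hp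
      · exact ⟨hx.1, hy.1, hxy⟩
      · exact hmem p hp
    · rw [Finset.coe_insert, Set.injOn_insert (by simpa using hnot)]
      refine ⟨h1, ?_⟩
      rintro ⟨p, hp, hpx⟩
      exact hx.2 ⟨p, hp, hpx⟩
    · rw [Finset.coe_insert, Set.injOn_insert (by simpa using hnot)]
      refine ⟨h2, ?_⟩
      rintro ⟨p, hp, hpx⟩
      exact hy.2 ⟨p, hp, hpx⟩

/-- Two disjoint sets with edges in both directions between all of their large subsets contain an
alternating cycle through most of their vertices. -/
theorem exists_alternating_dicycle {V : Type*} [DecidableEq V] (E : V → V → Prop)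
    (X Y : Finset V) (hXY : Disjoint X Y) (κ μ : ℕ) (hκ : 0 < κ)
    (h : ∀ X' Y', X' ⊆ X → Y' ⊆ Y → κ ≤ X'.card → κ ≤ Y'.card →
      (∃ x ∈ X', ∃ y ∈ Y', E x y) ∧ ∃ y ∈ Y', ∃ x ∈ X', E y x)
    (hμ : 6 * κ ≤ μ) (hX : μ ≤ X.card) (hY : μ ≤ Y.card) :
    ∃ s f, IsDicycle E (2 * s) f ∧ (∀ i < s, f (2 * i) ∈ X ∧ f (2 * i + 1) ∈ Y) ∧
      μ ≤ s + 5 * κ ∧ s ≤ μ := by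
  obtain ⟨M, hM, hmem, h1, h2⟩ := exists_matching E X Y κ
    (fun X' Y' hX' hY' hcX hcY => (h X' Y' hX' hY' hcX hcY).1) (μ - κ) (by omega) (by omega)
  -- The matching edges are the vertices of an auxiliary digraph, with `p → q` when `E p.2 q.1`; a
  -- cycle there unfolds to an alternating cycle. The loss is `κ` vertices of each side for the
  -- matching and `4 * κ` for the cycle.
  obtain ⟨s, f, hf, hfM, hs⟩ := exists_dicycle_of_forall_edge (fun p q : V × V => E p.2 q.1) M κ
    (fun P Q hP hQ _ hcP hcQ => by
      obtain ⟨-, y, hy, x, hx, hyx⟩ := h (Q.image Prod.fst) (P.image Prod.snd)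
        (fun x hx => by
          obtain ⟨q, hq, rfl⟩ := Finset.mem_image.1 hx
          exact (hmem q (hQ hq)).1)
        (fun x hx => by
          obtain ⟨q, hq, rfl⟩ := Finset.mem_image.1 hx
          exact (hmem q (hP hq)).2.1)
        (by rwa [Finset.card_image_of_injOn (h1.mono (by exact_mod_cast hQ))])
        (by rwa [Finset.card_image_of_injOn (h2.mono (by exact_mod_cast hP))])
      obtain ⟨p, hp, rfl⟩ := Finset.mem_image.1 hy
      obtain ⟨q, hq, rfl⟩ := Finset.mem_image.1 hx
      exact ⟨p, hp, q, hq, hyx⟩) (by omega) hκ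
  have hsM : s ≤ M.card := by
    rw [← Finset.card_range s]
    refine Finset.card_le_card_of_injOn f (fun i hi => hfM i (by simpa using hi)) ?_
    intro i hi j hj hij
    exact hf.1 (by simpa using hi) (by simpa using hj) hij
  refine ⟨s, fun i => if i % 2 = 0 then (f (i / 2)).1 else (f (i / 2)).2, ⟨?_, ?_, ?_⟩, ?_, ?_, ?_⟩
  · intro i hi j hj hij
    simp only [Set.mem_Iio] at hi hj
    have hi' := hfM (i / 2) (by omega)
    have hj' := hfM (j / 2) (by omega)
    have hXi := (hmem _ hi').1
    have hXj := (hmem _ hj').1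
    have hYi := (hmem _ hi').2.1
    have hYj := (hmem _ hj').2.1
    rcases Nat.mod_two_eq_zero_or_one i with hpi | hpi <;>
      rcases Nat.mod_two_eq_zero_or_one j with hpj | hpj <;>
      simp [hpi, hpj] at hij
    · have := hf.1 (show i / 2 < s by omega) (show j / 2 < s by omega) (h1 hi' hj' hij)
      omega
    · rw [hij] at hXi
      exact absurd hYj (Finset.disjoint_left.1 hXY hXi)
    · rw [← hij] at hXj
      exact absurd hYi (Finset.disjoint_left.1 hXY hXj)
    · have := hf.1 (show i / 2 < s by omega) (show j / 2 < s by omega) (h2 hi' hj' hij)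
      omega
  · intro i hi
    rcases Nat.mod_two_eq_zero_or_one i with hpi | hpi
    · have h3 : (i + 1) % 2 = 1 := by omega
      have h4 : (i + 1) / 2 = i / 2 := by omega
      simp only [hpi, h3, h4, if_true, one_ne_zero, if_false]
      exact (hmem _ (hfM (i / 2) (by omega))).2.2
    · have h3 : (i + 1) % 2 = 0 := by omega
      have h4 : (i + 1) / 2 = i / 2 + 1 := by omega
      simp only [hpi, h3, h4, if_true, one_ne_zero, if_false]
      exact hf.2.1 (i / 2) (by omega)
  · have h3 : (2 * s - 1) % 2 = 1 := by omega
    have h4 : (2 * s - 1) / 2 = s - 1 := by omega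
    simp only [h3, h4, one_ne_zero, if_false, Nat.zero_mod, Nat.zero_div, if_true]
    exact hf.2.2
  · intro i hi
    have h3 : (2 * i) % 2 = 0 := by omega
    have h4 : (2 * i) / 2 = i := by omega
    have h5 : (2 * i + 1) % 2 = 1 := by omega
    have h6 : (2 * i + 1) / 2 = i := by omega
    simp only [h3, h4, h5, h6, one_ne_zero, if_false, if_true]
    exact ⟨(hmem _ (hfM i hi)).1, (hmem _ (hfM i hi)).2.1⟩
  · omega
  · omega

/-! ### Cycles of controlled length in two-coloured digraphs -/

/-- A two-coloured digraph on `W` (with colour classes `R` and `B`) in which any two large disjoint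
sets span an edge. -/
structure IsTwoColoured {V : Type*} (E R B : V → V → Prop) (W : Finset V) (κ : ℕ) : Prop where
  pos : 0 < κ
  colour : ∀ u ∈ W, ∀ v ∈ W, E u v → R u v ∨ B u v
  edge : ∀ X Y, X ⊆ W → Y ⊆ W → Disjoint X Y → κ ≤ X.card → κ ≤ Y.card → ∃ x ∈ X, ∃ y ∈ Y, E x y

namespace IsTwoColoured

variable {V : Type*} {E R B : V → V → Prop} {W : Finset V} {κ : ℕ}

theorem symm (h : IsTwoColoured E R B W κ) : IsTwoColoured E B R W κ :=
  ⟨h.pos, fun u hu v hv huv => (h.colour u hu v hv huv).symm, h.edge⟩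

theorem mono (h : IsTwoColoured E R B W κ) {W' : Finset V} (hW : W' ⊆ W) :
    IsTwoColoured E R B W' κ :=
  ⟨h.pos, fun u hu v hv => h.colour u (hW hu) v (hW hv),
    fun X Y hX hY => h.edge X Y (hX.trans hW) (hY.trans hW)⟩

/-- If no edge between `X` and `Y` is in `R`, there is an alternating cycle in `B`. -/
theorem exists_alternating [DecidableEq V] (h : IsTwoColoured E R B W κ) (X Y : Finset V)
    (hXW : X ⊆ W) (hYW : Y ⊆ W) (hXY : Disjoint X Y) (μ : ℕ) (hμ : 6 * κ ≤ μ)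
    (hX : μ ≤ X.card) (hY : μ ≤ Y.card) (hno : ∀ x ∈ X, ∀ y ∈ Y, ¬ R x y ∧ ¬ R y x) :
    ∃ s f, IsDicycle B (2 * s) f ∧ (∀ i < s, f (2 * i) ∈ X ∧ f (2 * i + 1) ∈ Y) ∧
      μ ≤ s + 5 * κ ∧ s ≤ μ := by
  refine exists_alternating_dicycle B X Y hXY κ μ h.pos (fun X' Y' hX' hY' hcX hcY => ?_) hμ hX hY
  have hd : Disjoint X' Y' := Finset.disjoint_of_subset_left hX' (hXY.mono_right hY')
  obtain ⟨x, hx, y, hy, hxy⟩ := h.edge X' Y' (hX'.trans hXW) (hY'.trans hYW) hd hcX hcY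
  obtain ⟨y', hy', x', hx', hyx⟩ := h.edge Y' X' (hY'.trans hYW) (hX'.trans hXW) hd.symm hcY hcX
  refine ⟨⟨x, hx, y, hy, ?_⟩, ⟨y', hy', x', hx', ?_⟩⟩
  · exact (h.colour x (hXW (hX' hx)) y (hYW (hY' hy)) hxy).resolve_left
      (hno x (hX' hx) y (hY' hy)).1
  · exact (h.colour y' (hYW (hY' hy')) x' (hXW (hX' hx')) hyx).resolve_left
      (hno x' (hX' hx') y' (hY' hy')).2

/-- A long monochromatic cycle can be replaced by one whose length is controlled. -/
theorem exists_dicycle_le [DecidableEq V] (h : IsTwoColoured E R B W κ) (l : ℕ)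
    (hl : 10 * κ ≤ l) (hc : ∃ s f, l ≤ s ∧ (∀ i < s, f i ∈ W) ∧ IsDicycle R s f) :
    ∃ s f, l ≤ s ∧ s ≤ 4 * l ∧ (∀ i < s, f i ∈ W) ∧ (IsDicycle R s f ∨ IsDicycle B s f) := by
  classical
  have hκ := h.pos
  let P : ℕ → Prop := fun s => ∃ f, l ≤ s ∧ (∀ i < s, f i ∈ W) ∧ IsDicycle R s f
  have hP : ∃ s, P s := hc
  obtain ⟨f, hls, hfW, hf⟩ := Nat.find_spec hP
  have hmin : ∀ s < Nat.find hP, ¬ P s := fun s hs => Nat.find_min hP hs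
  set s := Nat.find hP with hs
  by_cases h4 : s ≤ 4 * l
  · exact ⟨s, f, hls, h4, hfW, Or.inl hf⟩
  -- `s` is the least length at least `l` of an `R`-cycle in `W`, so no `R`-chord cuts off a shorter
  -- one that is still long enough.
  have hchord : ∀ i s', l ≤ s' → s' < s → ¬ R (f ((i + (s' - 1)) % s)) (f (i % s)) :=
    fun i s' h1 h2 hR => hmin s' h2
      ⟨_, h1, fun t _ => hfW _ (Nat.mod_lt _ (by omega)), hf.chord i s' h2.le hR⟩
  have hinj : ∀ a b, a < s → b < s → f a = f b → a = b := fun a b ha hb hab => hf.1 ha hb hab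
  have hcard : ∀ c, c + l ≤ s → ((Finset.range l).image fun i => f (c + i)).card = l := by
    intro c hcs
    rw [Finset.card_image_of_injOn, Finset.card_range]
    intro a ha b hb hab
    simp at ha hb
    have := hinj _ _ (by omega) (by omega) hab
    omega
  -- The arcs `[0, l)` and `[2 * l, 3 * l)` are more than `l` apart both ways round because `s > 4 *
  -- l`, so there is no `R`-edge between them. The alternating `B`-cycle has length `2 * s'` with `l
  -- ≤ 2 * (l - 5 * κ) ≤ 2 * s' ≤ 2 * l`.
  obtain ⟨s', f', hf', hXY, h1, h2⟩ := h.exists_alternating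
    ((Finset.range l).image fun i => f (0 + i)) ((Finset.range l).image fun i => f (2 * l + i))
    (by
      intro x hx
      obtain ⟨i, hi, rfl⟩ := Finset.mem_image.1 hx
      simp at hi
      exact hfW _ (by omega))
    (by
      intro x hx
      obtain ⟨i, hi, rfl⟩ := Finset.mem_image.1 hx
      simp at hi
      exact hfW _ (by omega))
    (by
      rw [Finset.disjoint_left]
      intro x hx hx'
      obtain ⟨i, hi, rfl⟩ := Finset.mem_image.1 hx
      obtain ⟨j, hj, hij⟩ := Finset.mem_image.1 hx'
      simp at hi hj
      have := hinj _ _ (by omega) (by omega) hij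
      omega) l (by omega) (hcard 0 (by omega)).ge (hcard (2 * l) (by omega)).ge (by
      intro x hx y hy
      obtain ⟨i, hi, rfl⟩ := Finset.mem_image.1 hx
      obtain ⟨j, hj, rfl⟩ := Finset.mem_image.1 hy
      simp at hi hj
      constructor
      · have := hchord (2 * l + j) (s - (2 * l + j - i) + 1) (by omega) (by omega)
        rwa [show 2 * l + j + (s - (2 * l + j - i) + 1 - 1) = i + s by omega, Nat.add_mod_right,
          Nat.mod_eq_of_lt (by omega : i < s), Nat.mod_eq_of_lt (by omega : 2 * l + j < s),
          ← zero_add i] at this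
      · have := hchord i (2 * l + j - i + 1) (by omega) (by omega)
        rwa [show i + (2 * l + j - i + 1 - 1) = 2 * l + j by omega,
          Nat.mod_eq_of_lt (by omega : i < s), Nat.mod_eq_of_lt (by omega : 2 * l + j < s),
          ← zero_add i] at this)
  refine ⟨2 * s', f', by omega, by omega, fun i hi => ?_, Or.inr hf'⟩
  have := hXY (i / 2) (by omega)
  rcases Nat.mod_two_eq_zero_or_one i with hpi | hpi
  · have h5 : 2 * (i / 2) = i := by omega
    rw [h5] at this
    obtain ⟨j, hj, hij⟩ := Finset.mem_image.1 this.1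
    rw [← hij]
    simp at hj
    exact hfW _ (by omega)
  · have h5 : 2 * (i / 2) + 1 = i := by omega
    rw [h5] at this
    obtain ⟨j, hj, hij⟩ := Finset.mem_image.1 this.2
    rw [← hij]
    simp at hj
    exact hfW _ (by omega)

end IsTwoColoured

/-! ### Robust sets and links between them -/

/-- From every vertex of `Z`, all but `a` vertices of `Z` can be reached inside `Z` by a path of
`R` with at least `a` vertices. -/
def IsRobust {V : Type*} (R : V → V → Prop) (Z : Finset V) (a : ℕ) : Prop :=
  ∀ x ∈ Z, ∃ F ⊆ Z, F.card ≤ a ∧ ∀ y ∈ Z, y ∉ F → ∃ l : List V, l.Nodup ∧ l.IsChain R ∧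
    (∀ z ∈ l, z ∈ Z) ∧ l.head? = some x ∧ l.getLast? = some y ∧ a ≤ l.length

/-- From every vertex of `Z` one can enter `Z'` after a path of at least `a` vertices of `Z`. -/
def IsLinked {V : Type*} (R : V → V → Prop) (Z Z' : Finset V) (a : ℕ) : Prop :=
  ∀ x ∈ Z, ∃ l : List V, l.Nodup ∧ l.IsChain R ∧ (∀ z ∈ l, z ∈ Z) ∧ l.head? = some x ∧
    a ≤ l.length ∧ ∃ y ∈ l.getLast?, ∃ z ∈ Z', R y z

/-- The exceptional set consists of the `a` cycle vertices starting at `x`; going round the cycle to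
any other vertex passes at least `a` vertices. -/
theorem IsDicycle.isRobust {V : Type*} [DecidableEq V] {R : V → V → Prop} {s : ℕ} {f : ℕ → V}
    (h : IsDicycle R s f) (a : ℕ) : IsRobust R ((Finset.range s).image f) a := by
  intro x hx
  obtain ⟨i, hi, rfl⟩ := Finset.mem_image.1 hx
  rw [Finset.mem_range] at hi
  refine ⟨((Finset.range a).image fun t => f ((i + t) % s)), ?_, ?_, ?_⟩
  · intro y hy
    obtain ⟨t, -, rfl⟩ := Finset.mem_image.1 hy
    exact Finset.mem_image_of_mem _ (Finset.mem_range.2 (Nat.mod_lt _ (by omega)))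
  · exact Finset.card_image_le.trans (by simp)
  · intro y hy hyF
    obtain ⟨j, hj, rfl⟩ := Finset.mem_image.1 hy
    rw [Finset.mem_range] at hj
    obtain ⟨t, hts, htj⟩ : ∃ t < s, (i + t) % s = j := by
      rcases le_or_gt i j with hij | hij
      · exact ⟨j - i, by omega, by rw [Nat.add_sub_cancel' hij, Nat.mod_eq_of_lt hj]⟩
      · exact ⟨j + s - i, by omega, by
          rw [show i + (j + s - i) = j + s by omega, Nat.add_mod_right, Nat.mod_eq_of_lt hj]⟩
    have hat : a ≤ t := by
      by_contra hta
      exact hyF (Finset.mem_image.2 ⟨t, Finset.mem_range.2 (by omega), by rw [htj]⟩)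
    refine ⟨(List.range (t + 1)).map fun u => f ((i + u) % s), ?_, ?_, ?_, ?_, ?_, ?_⟩
    · refine List.Nodup.map_on ?_ List.nodup_range
      intro u hu v hv huv
      simp at hu hv
      exact h.inj_mod i u v (by omega) (by omega) huv
    · rw [List.isChain_iff_getElem]
      intro u hu
      simp at hu ⊢
      exact h.rel_mod (by omega) (i + u)
    · intro z hz
      obtain ⟨u, -, rfl⟩ := List.mem_map.1 hz
      exact Finset.mem_image_of_mem _ (Finset.mem_range.2 (Nat.mod_lt _ (by omega)))
    · simp [List.range_succ_eq_map, Nat.mod_eq_of_lt hi]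
    · simp [List.range_succ, htj]
    · simp; omega

/-- Let `x` witness that there is no link. Every vertex outside the exceptional set of `x` ends a
long path from `x`, so an edge from it to `Z'` would be a link. -/
theorem IsRobust.exists_forall_not {V : Type*} {R : V → V → Prop} {Z Z' : Finset V} {a : ℕ}
    (h : IsRobust R Z a) (hZ : ¬ IsLinked R Z Z' a) :
    ∃ F ⊆ Z, F.card ≤ a ∧ ∀ y ∈ Z, y ∉ F → ∀ z ∈ Z', ¬ R y z := by
  unfold IsLinked at hZ
  push Not at hZ
  obtain ⟨x, hx, hx'⟩ := hZ
  obtain ⟨F, hF, hFc, hF'⟩ := h x hx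
  refine ⟨F, hF, hFc, fun y hy hyF z hz => ?_⟩
  obtain ⟨l, h1, h2, h3, h4, h5, h6⟩ := hF' y hy hyF
  exact hx' l h1 h2 h3 h4 h6 y h5 z hz

/-- A chain of linked disjoint robust sets contains a long path. -/
theorem exists_path_of_isChain_isLinked {V ι : Type*} {R : V → V → Prop} (Z : ι → Finset V)
    (a : ℕ) (L : List ι) (hL : L.Nodup)
    (hdisj : ∀ i ∈ L, ∀ j ∈ L, i ≠ j → Disjoint (Z i) (Z j))
    (hrob : ∀ i ∈ L, IsRobust R (Z i) a) (hcard : ∀ i ∈ L, a < (Z i).card)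
    (hlink : L.IsChain fun i j => IsLinked R (Z i) (Z j) a) :
    ∀ i ∈ L.head?, ∀ x ∈ Z i, ∃ l : List V, l.Nodup ∧ l.IsChain R ∧ l.head? = some x ∧
      (∀ z ∈ l, ∃ j ∈ L, z ∈ Z j) ∧ a * L.length ≤ l.length := by
  induction L with
  | nil => simp
  | cons i L ih =>
    intro i' hi' x hx
    simp at hi'
    subst hi'
    cases L with
    | nil =>
      obtain ⟨F, hF, hFc, hF'⟩ := hrob i (by simp) x hx
      obtain ⟨y, hy, hyF⟩ := Finset.exists_mem_notMem_of_card_lt_card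
        (hFc.trans_lt (hcard i (by simp)))
      obtain ⟨l, h1, h2, h3, h4, h5, h6⟩ := hF' y hy hyF
      exact ⟨l, h1, h2, h4, fun z hz => ⟨i, by simp, h3 z hz⟩, by simpa using h6⟩
    | cons j L =>
      have hl := List.isChain_cons_cons.1 hlink
      obtain ⟨l, h1, h2, h3, h4, h5, y, hy, z, hz, hyz⟩ := hl.1 x hx
      have hL' := List.nodup_cons.1 hL
      obtain ⟨l', h1', h2', h3', h4', h5'⟩ := ih hL'.2
        (fun i hi j hj => hdisj i (List.mem_cons_of_mem _ hi) j (List.mem_cons_of_mem _ hj))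
        (fun i hi => hrob i (List.mem_cons_of_mem _ hi))
        (fun i hi => hcard i (List.mem_cons_of_mem _ hi)) hl.2 j (by simp) z hz
      refine ⟨l ++ l', ?_, ?_, ?_, ?_, ?_⟩
      · refine List.nodup_append.2 ⟨h1, h1', ?_⟩
        rintro u hu v hv rfl
        obtain ⟨j', hj', hj''⟩ := h4' u hv
        refine Finset.disjoint_left.1 (hdisj i (by simp) j' (List.mem_cons_of_mem _ hj') ?_)
          (h3 u hu) hj''
        rintro rfl
        exact hL'.1 hj'
      · refine h2.append h2' fun u hu v hv => ?_
        rw [Option.mem_def] at hu hv hy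
        rw [hy] at hu
        rw [h3'] at hv
        obtain rfl := Option.some.inj hu
        obtain rfl := Option.some.inj hv
        exact hyz
      · simp [h4]
      · intro u hu
        rcases List.mem_append.1 hu with hu | hu
        · exact ⟨i, by simp, h3 u hu⟩
        · obtain ⟨j', hj', hj''⟩ := h4' u hu
          exact ⟨j', List.mem_cons_of_mem _ hj', hj''⟩
      · simp only [List.length_append, List.length_cons] at h5' ⊢
        nlinarith

/-- All paths of `R` inside `W` have at most `n` vertices. -/
def PathsBounded {V : Type*} (R : V → V → Prop) (W : Finset V) (n : ℕ) : Prop :=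
  ∀ l : List V, l.Nodup → l.IsChain R → (∀ x ∈ l, x ∈ W) → l.length ≤ n

/-- Bad pairs are removed greedily. Below, bad means unlinked in both directions, so the leftover
`U` is semicomplete for linking. -/
theorem exists_maximal_pairing {ι : Type*} [DecidableEq ι] (bad : ι → ι → Prop) (I : Finset ι) :
    ∃ (M : Finset (ι × ι)) (U : Finset ι), U ⊆ I ∧ I.card = 2 * M.card + U.card ∧
      (∀ i ∈ U, ∀ j ∈ U, i ≠ j → ¬ bad i j) ∧
      (∀ p ∈ M, p.1 ∈ I ∧ p.2 ∈ I ∧ p.1 ≠ p.2 ∧ bad p.1 p.2) ∧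
      ∀ p ∈ M, ∀ q ∈ M, p ≠ q → p.1 ≠ q.1 ∧ p.1 ≠ q.2 ∧ p.2 ≠ q.1 ∧ p.2 ≠ q.2 := by
  induction I using Finset.strongInduction with
  | H I ih =>
    by_cases hbad : ∃ i ∈ I, ∃ j ∈ I, i ≠ j ∧ bad i j
    · obtain ⟨i, hi, j, hj, hij, hb⟩ := hbad
      have hj' : j ∈ I.erase i := Finset.mem_erase.2 ⟨hij.symm, hj⟩
      obtain ⟨M, U, hU, hc, hUb, hM, hMd⟩ := ih ((I.erase i).erase j)
        ((Finset.erase_ssubset hj').trans (Finset.erase_ssubset hi))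
      have hc1 := Finset.card_erase_add_one hi
      have hc2 := Finset.card_erase_add_one hj'
      have hmem : ∀ p ∈ M, p.1 ∈ I ∧ p.2 ∈ I ∧ p.1 ≠ i ∧ p.1 ≠ j ∧ p.2 ≠ i ∧ p.2 ≠ j := by
        intro p hp
        have := hM p hp
        simp only [Finset.mem_erase] at this
        tauto
      have hnot : (i, j) ∉ M := fun h => (hmem _ h).2.2.1 rfl
      refine ⟨insert (i, j) M, U,
        hU.trans ((Finset.erase_subset _ _).trans (Finset.erase_subset _ _)), ?_, hUb, ?_, ?_⟩
      · rw [Finset.card_insert_of_notMem hnot]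
        omega
      · intro p hp
        rcases Finset.mem_insert.1 hp with rfl | hp
        · exact ⟨hi, hj, hij, hb⟩
        · exact ⟨(hmem p hp).1, (hmem p hp).2.1, (hM p hp).2.2⟩
      · intro p hp q hq hpq
        rcases Finset.mem_insert.1 hp with rfl | hp <;> rcases Finset.mem_insert.1 hq with rfl | hq
        · exact absurd rfl hpq
        · obtain ⟨-, -, h1, h2, h3, h4⟩ := hmem q hq
          exact ⟨h1.symm, h3.symm, h2.symm, h4.symm⟩
        · obtain ⟨-, -, h1, h2, h3, h4⟩ := hmem p hp
          exact ⟨h1, h2, h3, h4⟩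
        · exact hMd p hp q hq hpq
    · push Not at hbad
      exact ⟨∅, I, subset_rfl, by simp, hbad, by simp, by simp⟩

/-- A chain of linked robust sets is short if paths are short. -/
theorem PathsBounded.mul_length_le {V ι : Type*} {R : V → V → Prop} {W : Finset V} {n : ℕ}
    (h : PathsBounded R W n) (Z : ι → Finset V) (a : ℕ) (L : List ι) (hL : L.Nodup)
    (hW : ∀ i ∈ L, Z i ⊆ W) (hdisj : ∀ i ∈ L, ∀ j ∈ L, i ≠ j → Disjoint (Z i) (Z j))
    (hrob : ∀ i ∈ L, IsRobust R (Z i) a) (hcard : ∀ i ∈ L, a < (Z i).card)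
    (hlink : L.IsChain fun i j => IsLinked R (Z i) (Z j) a) : a * L.length ≤ n := by
  cases L with
  | nil => simp
  | cons i L =>
    obtain ⟨x, hx⟩ := Finset.card_pos.1 ((Nat.zero_le a).trans_lt (hcard i (by simp)))
    obtain ⟨l, h1, h2, -, h4, h5⟩ := exists_path_of_isChain_isLinked Z a (i :: L) hL hdisj hrob
      hcard hlink i (by simp) x hx
    refine h5.trans (h l h1 h2 fun z hz => ?_)
    obtain ⟨j, hj, hzj⟩ := h4 z hz
    exact hW j hj hzj

namespace IsTwoColoured

variable {V : Type*} {E R B : V → V → Prop} {W : Finset V} {κ n : ℕ}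

/-- Between two unlinked robust sets there is a long cycle of the other colour. -/
theorem exists_robust_of_not_isLinked [DecidableEq V] (h : IsTwoColoured E R B W κ)
    (Z Z' : Finset V) (hZW : Z ⊆ W) (hZW' : Z' ⊆ W) (hd : Disjoint Z Z')
    (hZ : 10 * κ ≤ Z.card) (hZ' : 10 * κ ≤ Z'.card)
    (hr : IsRobust R Z κ) (hr' : IsRobust R Z' κ)
    (hl : ¬ IsLinked R Z Z' κ) (hl' : ¬ IsLinked R Z' Z κ) :
    ∃ O ⊆ Z ∪ Z', IsRobust B O κ ∧ 4 * κ ≤ (O ∩ Z).card := by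
  obtain ⟨F, hF, hFc, hFn⟩ := hr.exists_forall_not hl
  obtain ⟨F', hF', hFc', hFn'⟩ := hr'.exists_forall_not hl'
  have hc := Finset.le_card_sdiff F Z
  have hc' := Finset.le_card_sdiff F' Z'
  -- Outside `F` and `F'` no `R`-edge runs either way. Both remainders have at least `9 * κ`
  -- vertices, and the alternating cycle loses `5 * κ` of them on each side.
  obtain ⟨s, f, hf, hmem, h1, -⟩ := h.exists_alternating (Z \ F) (Z' \ F')
    (Finset.sdiff_subset.trans hZW) (Finset.sdiff_subset.trans hZW')
    (Finset.disjoint_of_subset_left Finset.sdiff_subset (hd.mono_right Finset.sdiff_subset))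
    (9 * κ) (by omega) (by omega) (by omega) (fun x hx y hy => by
      rw [Finset.mem_sdiff] at hx hy
      exact ⟨hFn x hx.1 hx.2 y hy.1, hFn' y hy.1 hy.2 x hx.1⟩)
  refine ⟨(Finset.range (2 * s)).image f, ?_, hf.isRobust κ, ?_⟩
  · intro y hy
    obtain ⟨i, hi, rfl⟩ := Finset.mem_image.1 hy
    rw [Finset.mem_range] at hi
    have := hmem (i / 2) (by omega)
    rcases Nat.mod_two_eq_zero_or_one i with hpi | hpi
    · rw [show 2 * (i / 2) = i by omega] at this
      exact Finset.mem_union_left _ (Finset.mem_sdiff.1 this.1).1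
    · rw [show 2 * (i / 2) + 1 = i by omega] at this
      exact Finset.mem_union_right _ (Finset.mem_sdiff.1 this.2).1
  · have hs : 4 * κ ≤ (Finset.range s).card := by
      rw [Finset.card_range]
      omega
    refine hs.trans (Finset.card_le_card_of_injOn (fun i => f (2 * i)) ?_ ?_)
    · intro i hi
      simp only [Finset.coe_range, Set.mem_Iio] at hi
      rw [Finset.mem_coe, Finset.mem_inter]
      exact ⟨Finset.mem_image_of_mem _ (Finset.mem_range.2 (by omega)),
        (Finset.mem_sdiff.1 (hmem i hi).1).1⟩
    · intro i hi j hj hij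
      simp only [Finset.coe_range, Set.mem_Iio] at hi hj
      have := hf.1 (show 2 * i < 2 * s by omega) (show 2 * j < 2 * s by omega) hij
      omega

/-- If monochromatic paths are short, a family of disjoint robust sets is small. -/
theorem mul_card_le [DecidableEq V] {ι : Type*} [DecidableEq ι] (h : IsTwoColoured E R B W κ)
    (hR : PathsBounded R W n) (hB : PathsBounded B W n) (Z : ι → Finset V) (I : Finset ι)
    (hZW : ∀ i ∈ I, Z i ⊆ W) (hcard : ∀ i ∈ I, 10 * κ ≤ (Z i).card)
    (hdisj : ∀ i ∈ I, ∀ j ∈ I, i ≠ j → Disjoint (Z i) (Z j))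
    (hrob : ∀ i ∈ I, IsRobust R (Z i) κ) : κ * I.card ≤ 5 * n := by
  have hκ := h.pos
  obtain ⟨M, U, hU, hc, hUb, hM, hMd⟩ := exists_maximal_pairing
    (fun i j => ¬ IsLinked R (Z i) (Z j) κ ∧ ¬ IsLinked R (Z j) (Z i) κ) I
  -- The unpaired sets have a Hamiltonian path of links, which unrolls to an `R`-path with at least
  -- `κ * U.card` vertices.
  have h1 : κ * U.card ≤ n := by
    obtain ⟨L, hL, hLU, hch⟩ := exists_hamiltonian_path (fun i j => IsLinked R (Z i) (Z j) κ) U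
      (fun i hi j hj hij => by
        have := hUb i hi j hj hij
        tauto)
    have hmem : ∀ i ∈ L, i ∈ I := fun i hi => hU (hLU ▸ List.mem_toFinset.2 hi)
    have := hR.mul_length_le Z κ L hL (fun i hi => hZW i (hmem i hi))
      (fun i hi j hj => hdisj i (hmem i hi) j (hmem j hj)) (fun i hi => hrob i (hmem i hi))
      (fun i hi => by have := hcard i (hmem i hi); omega) hch
    rwa [← hLU, List.toFinset_card_of_nodup hL]
  have hO : ∀ p : ι × ι, ∃ O, p ∈ M →
      O ⊆ Z p.1 ∪ Z p.2 ∧ IsRobust B O κ ∧ 4 * κ ≤ (O ∩ Z p.1).card := by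
    intro p
    by_cases hp : p ∈ M
    · obtain ⟨h1, h2, h3, h4, h5⟩ := hM p hp
      obtain ⟨O, hO⟩ := h.exists_robust_of_not_isLinked (Z p.1) (Z p.2) (hZW _ h1) (hZW _ h2)
        (hdisj _ h1 _ h2 h3) (hcard _ h1) (hcard _ h2) (hrob _ h1) (hrob _ h2) h4 h5
      exact ⟨O, fun _ => hO⟩
    · exact ⟨∅, fun h => absurd h hp⟩
  choose O hO using hO
  have hOd : ∀ p ∈ M, ∀ q ∈ M, p ≠ q → Disjoint (O p) (O q) := by
    intro p hp q hq hpq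
    obtain ⟨h1, h2, h3, h4⟩ := hMd p hp q hq hpq
    refine Finset.disjoint_of_subset_left (hO p hp).1
      (Disjoint.mono_right (hO q hq).1 ?_)
    rw [Finset.disjoint_union_left, Finset.disjoint_union_right, Finset.disjoint_union_right]
    exact ⟨⟨hdisj _ (hM p hp).1 _ (hM q hq).1 h1, hdisj _ (hM p hp).1 _ (hM q hq).2.1 h2⟩,
      hdisj _ (hM p hp).2.1 _ (hM q hq).1 h3, hdisj _ (hM p hp).2.1 _ (hM q hq).2.1 h4⟩
  have h2 : κ * M.card ≤ 2 * n := by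
    obtain ⟨L, hL, hLM, hLc, hch⟩ := exists_half_path
      (fun p q : ι × ι => IsLinked R (Z p.1) (Z q.1) κ) (fun p q => IsLinked B (O p) (O q) κ) M
      (fun p hp q hq hpq => by
        -- If both links fail, removing `F` and `F'` leaves at least `2 * κ` vertices of `O p ∩ Z
        -- p`. By `edge` one of them is joined to `O q ∩ Z q`, but neither colour is possible. Hence
        -- half of the pairs lie on a path of links of one kind, so `κ * M.card ≤ 2 * n`, and the
        -- total is at most `2 * (2 * n) + n`.
        by_contra hcon
        push Not at hcon
        obtain ⟨F, -, hFc, hFn⟩ := (hrob _ (hM p hp).1).exists_forall_not hcon.1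
        obtain ⟨F', -, hFc', hFn'⟩ := (hO p hp).2.1.exists_forall_not hcon.2
        have hc1 := Finset.le_card_sdiff F (O p ∩ Z p.1)
        have hc2 := Finset.le_card_sdiff F' ((O p ∩ Z p.1) \ F)
        have hc3 := (hO p hp).2.2
        have hc4 := (hO q hq).2.2
        have hpW := hZW _ (hM p hp).1
        have hqW := hZW _ (hM q hq).1
        have hXs : (((O p ∩ Z p.1) \ F) \ F') ⊆ (Z p.1) :=
          (Finset.sdiff_subset.trans Finset.sdiff_subset).trans Finset.inter_subset_right
        obtain ⟨x, hx, y, hy, hxy⟩ := h.edge (((O p ∩ Z p.1) \ F) \ F') (O q ∩ Z q.1)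
          (hXs.trans hpW) (Finset.inter_subset_right.trans hqW)
          (Finset.disjoint_of_subset_left hXs (Disjoint.mono_right Finset.inter_subset_right
            (hdisj _ (hM p hp).1 _ (hM q hq).1 (hMd p hp q hq hpq).1)))
          (by omega) (by omega)
        simp only [Finset.mem_sdiff, Finset.mem_inter] at hx hy
        rcases h.colour x (hpW hx.1.1.2) y (hqW hy.2) hxy with hc | hc
        · exact hFn x hx.1.1.2 hx.1.2 y hy.2 hc
        · exact hFn' x hx.1.1.1 hx.2 y hy.1 hc)
    have hle : κ * L.length ≤ n := by
      rcases hch with hch | hch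
      · refine hR.mul_length_le (fun p : ι × ι => Z p.1) κ L hL
          (fun p hp => hZW _ (hM p (hLM p hp)).1)
          (fun p hp q hq hpq => hdisj _ (hM p (hLM p hp)).1 _ (hM q (hLM q hq)).1
            (hMd p (hLM p hp) q (hLM q hq) hpq).1)
          (fun p hp => hrob _ (hM p (hLM p hp)).1)
          (fun p hp => ?_) hch
        have := hcard _ (hM p (hLM p hp)).1
        omega
      · refine hB.mul_length_le O κ L hL
          (fun p hp => (hO p (hLM p hp)).1.trans (Finset.union_subset
            (hZW _ (hM p (hLM p hp)).1) (hZW _ (hM p (hLM p hp)).2.1)))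
          (fun p hp q hq => hOd p (hLM p hp) q (hLM q hq))
          (fun p hp => (hO p (hLM p hp)).2.1) (fun p hp => ?_) hch
        have h1 := (hO p (hLM p hp)).2.2
        have h2 := Finset.card_le_card (Finset.inter_subset_left (s₁ := O p) (s₂ := Z p.1))
        omega
    nlinarith
  rw [hc]
  nlinarith

/-- Greedy choice of disjoint monochromatic cycles of controlled length. -/
theorem exists_families [DecidableEq V] (h : IsTwoColoured E R B W κ) (m : ℕ)
    (hcyc : ∀ W' ⊆ W, m ≤ W'.card → ∃ s f, 10 * κ ≤ s ∧ (∀ i < s, f i ∈ W') ∧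
      (IsDicycle R s f ∨ IsDicycle B s f)) :
    ∀ W' ⊆ W, ∃ P Q : Finset (Finset V), W'.card ≤ m + 40 * κ * (P.card + Q.card) ∧
      (∀ Z ∈ P, Z ⊆ W' ∧ 10 * κ ≤ Z.card ∧ IsRobust R Z κ) ∧
      (∀ Z ∈ Q, Z ⊆ W' ∧ 10 * κ ≤ Z.card ∧ IsRobust B Z κ) ∧
      (∀ Z ∈ P, ∀ Z' ∈ P, Z ≠ Z' → Disjoint Z Z') ∧
      ∀ Z ∈ Q, ∀ Z' ∈ Q, Z ≠ Z' → Disjoint Z Z' := by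
  have hκ := h.pos
  intro W'
  induction W' using Finset.strongInduction with
  | H W' ih =>
    intro hW'
    by_cases hm : m ≤ W'.card
    swap
    · exact ⟨∅, ∅, by simp; omega, by simp, by simp, by simp, by simp⟩
    obtain ⟨s, f, hs, hs4, hfW, hf⟩ : ∃ s f, 10 * κ ≤ s ∧ s ≤ 4 * (10 * κ) ∧
        (∀ i < s, f i ∈ W') ∧ (IsDicycle R s f ∨ IsDicycle B s f) := by
      obtain ⟨s, f, hs, hfW, hf | hf⟩ := hcyc W' hW' hm
      · exact (h.mono hW').exists_dicycle_le _ le_rfl ⟨s, f, hs, hfW, hf⟩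
      · obtain ⟨s, f, h1, h2, h3, h4⟩ :=
          (h.mono hW').symm.exists_dicycle_le _ le_rfl ⟨s, f, hs, hfW, hf⟩
        exact ⟨s, f, h1, h2, h3, h4.symm⟩
    set Z := (Finset.range s).image f with hZdef
    have hinj : Set.InjOn f (Set.Iio s) := by
      rcases hf with hf | hf
      · exact hf.1
      · exact hf.1
    have hZc : Z.card = s := by
      rw [hZdef, Finset.card_image_of_injOn (by simpa using hinj), Finset.card_range]
    have hZW : Z ⊆ W' := by
      intro y hy
      obtain ⟨i, hi, rfl⟩ := Finset.mem_image.1 hy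
      exact hfW i (Finset.mem_range.1 hi)
    have hZne : Z.Nonempty := Finset.card_pos.1 (by omega)
    obtain ⟨P, Q, hc, hP, hQ, hPd, hQd⟩ := ih (W' \ Z) (Finset.sdiff_ssubset hZW hZne)
      (Finset.sdiff_subset.trans hW')
    have hc' : W'.card = (W' \ Z).card + Z.card := by
      rw [Finset.card_sdiff_add_card_eq_card hZW]
    have hdisj : ∀ Y, Y ⊆ W' \ Z → Disjoint Z Y := fun Y hY =>
      Disjoint.mono_right hY Finset.disjoint_sdiff
    have hne : ∀ Y, Y ⊆ W' \ Z → Z ≠ Y := by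
      rintro Y hY rfl
      exact hZne.ne_empty (Finset.disjoint_self_iff_empty _ |>.1 (hdisj _ hY))
    have hins : ∀ P : Finset (Finset V), (∀ Y ∈ P, Y ⊆ W' \ Z) →
        (∀ Y ∈ P, ∀ Y' ∈ P, Y ≠ Y' → Disjoint Y Y') →
        ∀ Y ∈ insert Z P, ∀ Y' ∈ insert Z P, Y ≠ Y' → Disjoint Y Y' := by
      intro P hP hPd Y hY Y' hY' hYY
      rcases Finset.mem_insert.1 hY with rfl | hY <;> rcases Finset.mem_insert.1 hY' with rfl | hY'
      · exact absurd rfl hYY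
      · exact hdisj _ (hP _ hY')
      · exact (hdisj _ (hP _ hY)).symm
      · exact hPd _ hY _ hY' hYY
    have hsub : ∀ Y, Y ⊆ W' \ Z → Y ⊆ W' := fun Y hY => hY.trans Finset.sdiff_subset
    rcases hf with hf | hf
    · refine ⟨insert Z P, Q, ?_, ?_, fun Y hY => ⟨hsub Y (hQ Y hY).1, (hQ Y hY).2⟩,
        hins P (fun Y hY => (hP Y hY).1) hPd, hQd⟩
      · rw [Finset.card_insert_of_notMem fun hZP => hne _ (hP Z hZP).1 rfl]
        nlinarith
      · intro Y hY
        rcases Finset.mem_insert.1 hY with rfl | hY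
        · exact ⟨hZW, by omega, hf.isRobust κ⟩
        · exact ⟨hsub Y (hP Y hY).1, (hP Y hY).2⟩
    · refine ⟨P, insert Z Q, ?_, fun Y hY => ⟨hsub Y (hP Y hY).1, (hP Y hY).2⟩, ?_, hPd,
        hins Q (fun Y hY => (hQ Y hY).1) hQd⟩
      · rw [Finset.card_insert_of_notMem fun hZP => hne _ (hQ Z hZP).1 rfl]
        nlinarith
      · intro Y hY
        rcases Finset.mem_insert.1 hY with rfl | hY
        · exact ⟨hZW, by omega, hf.isRobust κ⟩
        · exact ⟨hsub Y (hQ Y hY).1, (hQ Y hY).2⟩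

/-- If monochromatic paths are short and every large set contains a long monochromatic cycle, then
the vertex set is small. -/
theorem card_le [DecidableEq V] (h : IsTwoColoured E R B W κ) (m : ℕ)
    (hR : PathsBounded R W n) (hB : PathsBounded B W n)
    (hcyc : ∀ W' ⊆ W, m ≤ W'.card → ∃ s f, 10 * κ ≤ s ∧ (∀ i < s, f i ∈ W') ∧
      (IsDicycle R s f ∨ IsDicycle B s f)) : W.card ≤ m + 400 * n := by
  obtain ⟨P, Q, hc, hP, hQ, hPd, hQd⟩ := h.exists_families m hcyc W subset_rfl
  have h1 := h.mul_card_le hR hB id P (fun Z hZ => (hP Z hZ).1) (fun Z hZ => (hP Z hZ).2.1)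
    hPd (fun Z hZ => (hP Z hZ).2.2)
  have h2 := h.symm.mul_card_le hB hR id Q (fun Z hZ => (hQ Z hZ).1) (fun Z hZ => (hQ Z hZ).2.1)
    hQd (fun Z hZ => (hQ Z hZ).2.2)
  -- The families satisfy `κ * P.card ≤ 5 * n` and `κ * Q.card ≤ 5 * n`, and each cycle accounts for
  -- at most `40 * κ` vertices: `40 * (5 + 5) = 400`.
  nlinarith

end IsTwoColoured

/-! ### Ranks, forced pairs and the reduction to two colours -/

/-- A digraph with short paths has a large independent set. -/
theorem PathsBounded.exists_independent {V : Type*} {R : V → V → Prop} {W : Finset V} {n : ℕ}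
    (h : PathsBounded R W n) :
    ∃ W' ⊆ W, W.card ≤ n * W'.card ∧ ∀ u ∈ W', ∀ v ∈ W', u ≠ v → ¬ R u v := by
  classical
  rcases W.eq_empty_or_nonempty with rfl | hW
  · exact ⟨∅, subset_rfl, by simp, by simp⟩
  -- No cycle has `W.card + 1` distinct vertices, so the condition on cycles is void. Every edge
  -- changes the rank, and the most popular rank class is independent.
  obtain ⟨par, ρ, hρ, hedge⟩ := exists_parent_rank (fun u v : W => R u v) n (W.card + 1)
    (fun l hl hc => by
      have := h (l.map Subtype.val) (hl.map Subtype.val_injective)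
        (List.isChain_map _ |>.2 hc) (fun x hx => by
          obtain ⟨y, -, rfl⟩ := List.mem_map.1 hx
          exact y.2)
      simpa using this)
    (fun s f hs hf => by
      have : (Finset.range s).card ≤ (Finset.univ : Finset W).card :=
        Finset.card_le_card_of_injOn f (fun _ _ => Finset.mem_univ _) (by simpa using hf.1)
      simp at this
      omega)
  have hn : (Finset.range n).Nonempty := by
    obtain ⟨x, hx⟩ := hW
    exact ⟨ρ ⟨x, hx⟩, Finset.mem_range.2 (hρ _)⟩
  obtain ⟨r, -, hr⟩ := Finset.exists_max_image (Finset.range n)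
    (fun r => (Finset.univ.filter fun v : W => ρ v = r).card) hn
  refine ⟨(Finset.univ.filter fun v : W => ρ v = r).map (Function.Embedding.subtype _), ?_, ?_, ?_⟩
  · intro x hx
    obtain ⟨y, -, rfl⟩ := Finset.mem_map.1 hx
    exact y.2
  · rw [Finset.card_map]
    have h1 := Finset.card_eq_sum_card_fiberwise (s := (Finset.univ : Finset W))
      (t := Finset.range n) (f := ρ) (fun v _ => Finset.mem_coe.2 (Finset.mem_range.2 (hρ v)))
    have h2 := Finset.sum_le_card_nsmul _ _ _ hr
    simp only [Finset.card_univ, Fintype.card_coe, Finset.card_range, smul_eq_mul] at h1 h2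
    omega
  · intro u hu v hv huv hR
    obtain ⟨u', hu', rfl⟩ := Finset.mem_map.1 hu
    obtain ⟨v', hv', rfl⟩ := Finset.mem_map.1 hv
    have h1 := (Finset.mem_filter.1 hu').2
    have h2 := (Finset.mem_filter.1 hv').2
    have := hedge u' v' hR (fun h => huv (by rw [h]))
    omega

/-- The pairs which increase in both ranks and are not close in either of the forests given by the
parent functions `p` and `q`. -/
def forcedPairs {U : Type*} [Fintype U] [DecidableEq U] (ρ β : U → ℕ) (p q : U → U) (ℓ : ℕ) :
    Finset (U × U) :=
  Finset.univ.filter fun x => (ρ x.1 < ρ x.2 ∧ β x.1 < β x.2) ∧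
    (∀ j < ℓ, p^[j] x.2 ≠ x.1) ∧ ∀ j < ℓ, q^[j] x.2 ≠ x.1

theorem card_filter_iterate_le {U : Type*} [Fintype U] [DecidableEq U] (p : U → U) (ℓ : ℕ) :
    (Finset.univ.filter fun x : U × U => ∃ j < ℓ, p^[j] x.2 = x.1).card ≤ Fintype.card U * ℓ := by
  calc _ ≤ (((Finset.univ : Finset U) ×ˢ Finset.range ℓ).image
        fun y => (p^[y.2] y.1, y.1)).card := by
        refine Finset.card_le_card fun x hx => ?_
        obtain ⟨j, hj, hx⟩ := (Finset.mem_filter.1 hx).2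
        exact Finset.mem_image.2 ⟨(x.2, j), by simpa using hj, by simp [hx]⟩
    _ ≤ _ := Finset.card_image_le.trans (by simp)

/-- Points of a grid, counted along coarse diagonals, contain many comparable pairs. -/
theorem mul_card_le_card_forcedPairs {U : Type*} [Fintype U] [DecidableEq U] (ρ β : U → ℕ)
    (p q : U → U) (n σ ℓ G : ℕ) (hσ : 0 < σ) (hρ : ∀ u, ρ u < n) (hβ : ∀ u, β u < n)
    (hinj : ∀ u v, ρ u = ρ v → β u = β v → u = v)
    (hm : 2 * (n / σ + 1) * (2 * G + 4 * ℓ + σ ^ 2) ≤ Fintype.card U) :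
    G * Fintype.card U ≤ (forcedPairs ρ β p q ℓ).card := by
  generalize hmdef : Fintype.card U = m at hm ⊢
  obtain ⟨a, ha⟩ : ∃ a : U → ℕ, ∀ u, a u = ρ u / σ := ⟨_, fun _ => rfl⟩
  obtain ⟨b, hb⟩ : ∃ b : U → ℕ, ∀ u, b u = β u / σ := ⟨_, fun _ => rfl⟩
  have hρσ : ∀ u, a u ≤ n / σ := fun u => ha u ▸ Nat.div_le_div_right (hρ u).le
  have hβσ : ∀ u, b u ≤ n / σ := fun u => hb u ▸ Nat.div_le_div_right (hβ u).le
  generalize n / σ = c at hm hρσ hβσ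
  obtain ⟨D, hD⟩ : ∃ D, D = 2 * (c + 1) := ⟨_, rfl⟩
  rw [← hD] at hm
  -- The index of the coarse diagonal; adding `c` first prevents truncation of the subtraction.
  let δ : U → ℕ := fun u => a u + c - b u
  have hδ : ∀ u, δ u < D := fun u => by
    have := hρσ u
    simp only [δ, hD]
    omega
  let S : Finset (U × U) := Finset.univ.filter fun x => δ x.1 = δ x.2
  let P : Finset (U × U) := Finset.univ.filter fun x => ρ x.1 < ρ x.2 ∧ β x.1 < β x.2
  let K : Finset (U × U) :=
    Finset.univ.filter fun x => a x.1 = a x.2 ∧ b x.1 = b x.2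
  -- Cauchy–Schwarz over the `D` diagonals.
  have hS : m ^ 2 ≤ D * S.card := by
    have h1 := Finset.card_eq_sum_card_fiberwise (s := (Finset.univ : Finset U))
      (t := Finset.range D) (f := δ) (fun v _ => Finset.mem_coe.2 (Finset.mem_range.2 (hδ v)))
    have h2 := Finset.card_eq_sum_card_fiberwise (s := S)
      (t := Finset.range D) (f := fun x => δ x.1)
      (fun v _ => Finset.mem_coe.2 (Finset.mem_range.2 (hδ _)))
    have h3 : ∀ d, (S.filter fun x => δ x.1 = d).card
        = (Finset.univ.filter fun u => δ u = d).card ^ 2 := by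
      intro d
      rw [sq, ← Finset.card_product]
      congr 1
      ext x
      simp only [S, Finset.mem_filter, Finset.mem_univ, true_and, Finset.mem_product]
      constructor
      · rintro ⟨h, rfl⟩
        exact ⟨rfl, h.symm⟩
      · rintro ⟨rfl, h⟩
        exact ⟨h.symm, rfl⟩
    have h4 := sq_sum_le_card_mul_sum_sq (s := Finset.range D)
      (f := fun d => (Finset.univ.filter fun u => δ u = d).card)
    simp only [h3] at h2
    rw [← h2, Finset.card_range] at h4
    rw [← hmdef, ← Finset.card_univ, h1]
    exact h4
  -- A coarse square contains at most `σ ^ 2` points, by injectivity of the pair of ranks.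
  have hK : K.card ≤ m * σ ^ 2 := by
    calc K.card ≤ ((Finset.univ : Finset U) ×ˢ (Finset.range σ ×ˢ Finset.range σ)).card := by
          refine Finset.card_le_card_of_injOn (fun x => (x.1, ρ x.2 % σ, β x.2 % σ)) ?_ ?_
          · intro x _
            simp [Nat.mod_lt _ hσ]
          · rintro ⟨u, v⟩ hx ⟨u', v'⟩ hy hxy
            simp only [K, Finset.coe_filter, Finset.mem_univ, true_and, Set.mem_ofPred_eq,
              ha, hb] at hx hy
            simp only [Prod.mk.injEq] at hxy
            obtain ⟨rfl, h1, h2⟩ := hxy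
            have h3 : v = v' := hinj _ _
              (by rw [← Nat.div_add_mod (ρ v) σ, ← Nat.div_add_mod (ρ v') σ, h1, ← hx.1, ← hy.1])
              (by rw [← Nat.div_add_mod (β v) σ, ← Nat.div_add_mod (β v') σ, h2, ← hx.2, ← hy.2])
            rw [h3]
      _ = m * σ ^ 2 := by simp [sq, hmdef]
  -- Two points on one coarse diagonal are in the same coarse square, or one lies strictly below the
  -- other in both coordinates.
  have hSP : S.card ≤ K.card + (P.card + P.card) := by
    have hsub : S ⊆ K ∪ (P ∪ P.map (Equiv.prodComm U U).toEmbedding) := by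
      intro x hx
      simp only [S, Finset.mem_filter, Finset.mem_univ, true_and, δ] at hx
      simp only [K, P, Finset.mem_union, Finset.mem_filter, Finset.mem_univ, true_and,
        Finset.mem_map_equiv, Equiv.prodComm_symm, Equiv.prodComm_apply, Prod.fst_swap,
        Prod.snd_swap]
      have h1 := hβσ x.1
      have h2 := hβσ x.2
      have hlt : ∀ a b : ℕ, a / σ < b / σ → a < b := fun a b h => by
        by_contra hab
        exact absurd (Nat.div_le_div_right (c := σ) (not_lt.1 hab)) (not_le.2 h)
      have hlta : ∀ u v, a u < a v → ρ u < ρ v := fun u v h => hlt _ _ (ha u ▸ ha v ▸ h)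
      have hltb : ∀ u v, b u < b v → β u < β v := fun u v h => hlt _ _ (hb u ▸ hb v ▸ h)
      rcases lt_trichotomy (a x.1) (a x.2) with h | h | h
      · exact Or.inr (Or.inl ⟨hlta _ _ h, hltb _ _ (by omega)⟩)
      · exact Or.inl ⟨h, by omega⟩
      · exact Or.inr (Or.inr ⟨hlta _ _ h, hltb _ _ (by omega)⟩)
    refine (Finset.card_le_card hsub).trans ((Finset.card_union_le _ _).trans ?_)
    have := Finset.card_union_le P (P.map (Equiv.prodComm U U).toEmbedding)
    rw [Finset.card_map] at this
    omega
  have hPF : P.card ≤ (forcedPairs ρ β p q ℓ).card + (m * ℓ + m * ℓ) := by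
    have hsub : P ⊆ forcedPairs ρ β p q ℓ ∪
        ((Finset.univ.filter fun x : U × U => ∃ j < ℓ, p^[j] x.2 = x.1) ∪
          Finset.univ.filter fun x : U × U => ∃ j < ℓ, q^[j] x.2 = x.1) := by
      intro x hx
      simp only [P, Finset.mem_filter, Finset.mem_univ, true_and] at hx
      simp only [forcedPairs, Finset.mem_union, Finset.mem_filter, Finset.mem_univ, true_and]
      by_cases h1 : ∃ j < ℓ, p^[j] x.2 = x.1
      · exact Or.inr (Or.inl h1)
      by_cases h2 : ∃ j < ℓ, q^[j] x.2 = x.1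
      · exact Or.inr (Or.inr h2)
      push Not at h1 h2
      exact Or.inl ⟨hx, h1, h2⟩
    refine (Finset.card_le_card hsub).trans ((Finset.card_union_le _ _).trans ?_)
    have h1 := Finset.card_union_le
      (Finset.univ.filter fun x : U × U => ∃ j < ℓ, p^[j] x.2 = x.1)
      (Finset.univ.filter fun x : U × U => ∃ j < ℓ, q^[j] x.2 = x.1)
    have h2 := card_filter_iterate_le p ℓ
    have h3 := card_filter_iterate_le q ℓ
    rw [hmdef] at h2 h3
    omega
  generalize (forcedPairs ρ β p q ℓ).card = F at hPF ⊢
  have hDpos : 0 < D := by omega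
  have h1 : S.card ≤ m * σ ^ 2 + 2 * (F + 2 * (m * ℓ)) := by omega
  have h2 : m * (D * (2 * G + 4 * ℓ + σ ^ 2)) ≤ D * (m * σ ^ 2 + 2 * (F + 2 * (m * ℓ))) :=
    calc m * (D * (2 * G + 4 * ℓ + σ ^ 2)) ≤ m * m := Nat.mul_le_mul_left _ hm
      _ = m ^ 2 := (sq m).symm
      _ ≤ D * S.card := hS
      _ ≤ _ := Nat.mul_le_mul_left _ h1
  have h3 : m * (2 * G + 4 * ℓ + σ ^ 2) ≤ m * σ ^ 2 + 2 * (F + 2 * (m * ℓ)) := by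
    refine Nat.le_of_mul_le_mul_left ?_ hDpos
    calc _ = m * (D * (2 * G + 4 * ℓ + σ ^ 2)) := by ring
      _ ≤ _ := h2
  nlinarith

/-- A two-coloured semicomplete digraph without long monochromatic paths and cycles determines many
of its edges by a small amount of data. -/
theorem exists_forcedPairs {V : Type*} {E R B : V → V → Prop} {W : Finset V} {n m σ ℓ G : ℕ}
    (hE : ∀ u v, u ≠ v → E u v ∨ E v u) (hcol : ∀ u ∈ W, ∀ v ∈ W, E u v → R u v ∨ B u v)
    (hR : PathsBounded R W n) (hB : PathsBounded B W n)
    (hcyc : ∀ s f, ℓ ≤ s → (∀ i < s, f i ∈ W) → ¬ IsDicycle R s f ∧ ¬ IsDicycle B s f)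
    (hσ : 0 < σ) (hm : 2 * (n / σ + 1) * (2 * G + 4 * ℓ + σ ^ 2) ≤ m) (hW : m ≤ W.card) :
    ∃ (e : Fin m → V) (ρ β : Fin m → Fin n) (p q : Fin m → Fin m), Function.Injective e ∧
      G * m ≤ (forcedPairs (fun u => (ρ u : ℕ)) (fun u => (β u : ℕ)) p q ℓ).card ∧
      ∀ x ∈ forcedPairs (fun u => (ρ u : ℕ)) (fun u => (β u : ℕ)) p q ℓ, E (e x.1) (e x.2) := by
  obtain ⟨W', hW', hcard⟩ := Finset.exists_subset_card_eq hW
  let e : Fin m → V := fun i => (W'.equivFinOfCardEq hcard).symm i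
  have he : Function.Injective e := fun i j h =>
    (W'.equivFinOfCardEq hcard).symm.injective (Subtype.ext h)
  have heW : ∀ i, e i ∈ W := fun i => hW' ((W'.equivFinOfCardEq hcard).symm i).2
  have key : ∀ R : V → V → Prop, PathsBounded R W n →
      (∀ s f, ℓ ≤ s → (∀ i < s, f i ∈ W) → ¬ IsDicycle R s f) →
      ∃ (p : Fin m → Fin m) (ρ : Fin m → Fin n), ∀ u v, R (e u) (e v) → u ≠ v →
        ρ u < ρ v ∨ ((∃ j < ℓ, v = p^[j] u) ∧ ρ v < ρ u) := by
    intro R hR hcyc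
    obtain ⟨p, ρ, hρ, h⟩ := exists_parent_rank (fun u v => R (e u) (e v)) n ℓ
      (fun l hl hc => by
        have := hR (l.map e) (hl.map he) (List.isChain_map _ |>.2 hc) (fun x hx => by
          obtain ⟨y, -, rfl⟩ := List.mem_map.1 hx
          exact heW y)
        simpa using this)
      (fun s f hs hf => hcyc s (fun i => e (f i)) hs (fun i _ => heW _)
        ⟨fun a ha b hb hab => hf.1 ha hb (he hab), hf.2⟩)
    exact ⟨p, fun u => ⟨ρ u, hρ u⟩, fun u v huv huv' => h u v huv huv'⟩
  obtain ⟨p, ρ, hρ⟩ := key R hR fun s f hs hf => (hcyc s f hs hf).1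
  obtain ⟨q, β, hβ⟩ := key B hB fun s f hs hf => (hcyc s f hs hf).2
  refine ⟨e, ρ, β, p, q, he, ?_, ?_⟩
  -- Every edge changes the rank of its own colour, so two vertices cannot agree in both ranks.
  · have := mul_card_le_card_forcedPairs (fun u => (ρ u : ℕ)) (fun u => (β u : ℕ)) p q n σ ℓ G hσ
      (fun u => (ρ u).2) (fun u => (β u).2) (fun u v h1 h2 => by
        by_contra huv
        have h3 := Fin.ext h1
        have h4 := Fin.ext h2
        have hd : ∀ u v, u ≠ v → ρ u = ρ v → β u = β v → ¬ E (e u) (e v) := by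
          intro u v huv h3 h4 hE
          rcases hcol _ (heW u) _ (heW v) hE with h | h
          · rcases hρ u v h huv with h | h
            · exact absurd h (by simp [h3])
            · exact absurd h.2 (by simp [h3])
          · rcases hβ u v h huv with h | h
            · exact absurd h (by simp [h4])
            · exact absurd h.2 (by simp [h4])
        rcases hE (e u) (e v) (fun h => huv (he h)) with h | h
        · exact hd u v huv h3 h4 h
        · exact hd v u (Ne.symm huv) h3.symm h4.symm h) (by simpa using hm)
    simpa using this
  · rintro ⟨u, v⟩ hx
    simp only [forcedPairs, Finset.mem_filter, Finset.mem_univ, true_and, Fin.val_fin_lt] at hx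
    obtain ⟨⟨h1, h2⟩, h3, h4⟩ := hx
    have huv : u ≠ v := by
      rintro rfl
      exact lt_irrefl _ h1
    -- The edge `v → u` would decrease both ranks, so in its own colour it would go to a near
    -- ancestor of `v`; this is excluded by the definition of forced pairs.
    rcases hE (e u) (e v) (fun h => huv (he h)) with h | h
    · exact h
    · exfalso
      rcases hcol _ (heW v) _ (heW u) h with h | h
      · rcases hρ v u h huv.symm with h | ⟨⟨j, hj, hj'⟩, -⟩
        · exact lt_asymm h h1
        · exact h3 j hj hj'.symm
      · rcases hβ v u h huv.symm with h | ⟨⟨j, hj, hj'⟩, -⟩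
        · exact lt_asymm h h2
        · exact h4 j hj hj'.symm

/-- A semicomplete digraph with the two pseudorandomness properties `hP` and `hQ` contains a long
monochromatic path in every `k`-colouring. -/
theorem exists_long_monochromatic_path {V : Type*} [Fintype V] [DecidableEq V]
    {E : V → V → Prop} {k n m σ κ G : ℕ} (hk : 2 ≤ k) (R : ℕ → V → V → Prop)
    (hE : ∀ u v, u ≠ v → E u v ∨ E v u) (hE' : ∀ u, ¬ E u u)
    (hcol : ∀ u v, E u v → ∃ i < k, R i u v)
    (hκ : 0 < κ) (hσ : 0 < σ) (hm : 2 * (n / σ + 1) * (2 * G + 4 * (10 * κ) + σ ^ 2) ≤ m)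
    (hP : ∀ X Y : Finset V, Disjoint X Y → κ ≤ X.card → κ ≤ Y.card → ∃ x ∈ X, ∃ y ∈ Y, E x y)
    (hQ : ∀ (e : Fin m → V) (ρ β : Fin m → Fin n) (p q : Fin m → Fin m), Function.Injective e →
      G * m ≤ (forcedPairs (fun u => (ρ u : ℕ)) (fun u => (β u : ℕ)) p q (10 * κ)).card →
      ∃ x ∈ forcedPairs (fun u => (ρ u : ℕ)) (fun u => (β u : ℕ)) p q (10 * κ),
        ¬ E (e x.1) (e x.2))
    (hV : n ^ (k - 2) * (m + 400 * n) < Fintype.card V) :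
    ∃ i < k, ∃ l : List V, l.Nodup ∧ l.IsChain (R i) ∧ n < l.length := by
  by_contra hcon
  push Not at hcon
  have hb : ∀ i < k, ∀ W, PathsBounded (R i) W n := fun i hi W l h1 h2 _ => hcon i hi l h1 h2
  have hred : ∀ j ≤ k - 2, ∃ W : Finset V, Fintype.card V ≤ n ^ j * W.card ∧
      ∀ i, 2 ≤ i → i < 2 + j → ∀ u ∈ W, ∀ v ∈ W, u ≠ v → ¬ R i u v := by
    intro j
    induction j with
    | zero => exact fun _ => ⟨Finset.univ, by simp, fun i h1 h2 => by omega⟩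
    | succ j ih =>
      intro hj
      obtain ⟨W, hW, hi⟩ := ih (by omega)
      obtain ⟨W', hW', hc, hind⟩ := (hb (2 + j) (by omega) W).exists_independent
      refine ⟨W', hW.trans ?_, fun i h1 h2 u hu v hv huv => ?_⟩
      · rw [pow_succ, mul_assoc]
        exact Nat.mul_le_mul_left _ hc
      · rcases (show i = 2 + j ∨ i < 2 + j by omega) with rfl | h3
        · exact hind u hu v hv huv
        · exact hi i h1 h3 u (hW' hu) v (hW' hv) huv
  obtain ⟨W, hW, hi⟩ := hred (k - 2) le_rfl
  have hcol' : ∀ u ∈ W, ∀ v ∈ W, E u v → R 0 u v ∨ R 1 u v := by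
    intro u hu v hv huv
    obtain ⟨i, hik, hR⟩ := hcol u v huv
    rcases (show i = 0 ∨ i = 1 ∨ 2 ≤ i by omega) with rfl | rfl | h2
    · exact Or.inl hR
    · exact Or.inr hR
    · refine absurd hR (hi i h2 (by omega) u hu v hv ?_)
      rintro rfl
      exact hE' _ huv
  have h2 : IsTwoColoured E (R 0) (R 1) W κ :=
    ⟨hκ, hcol', fun X Y _ _ hd hX hY => hP X Y hd hX hY⟩
  -- An `m`-set without a long monochromatic cycle would have all its forced pairs oriented upwards,
  -- against `hQ`.
  have hle := h2.card_le m (hb 0 (by omega) W) (hb 1 (by omega) W) (fun W' hW' hmW => by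
    by_contra hno
    push Not at hno
    obtain ⟨e, ρ, β, p, q, he, hF, hFE⟩ := exists_forcedPairs (ℓ := 10 * κ) (G := G) hE
      (fun u hu v hv => hcol' u (hW' hu) v (hW' hv)) (hb 0 (by omega) W') (hb 1 (by omega) W')
      (fun s f hs hf => hno s f hs hf) hσ hm hmW
    obtain ⟨x, hx, hxE⟩ := hQ e ρ β p q he hF
    exact hxE (hFE x hx))
  exact absurd hV (not_lt.2 (hW.trans (Nat.mul_le_mul_left _ hle)))

/-! ### Union bounds for the random tournament -/

theorem coin_singleton (b : Bool) : (PMF.uniformOfFintype Bool).toMeasure {b} = 1 / 2 := by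
  rw [PMF.toMeasure_apply_singleton _ _ (measurableSet_singleton b)]
  simp

/-- The probability that all pairs of an antisymmetric set are edges of the random tournament. -/
theorem coinMeasure_forall_adj_le {N : ℕ} (F : Finset (Fin N × Fin N))
    (hF : ∀ x ∈ F, x.swap ∉ F) :
    coinMeasure N {ω | ∀ x ∈ F, (orientComplete ω).Adj x.1 x.2} ≤ (1 / 2) ^ F.card := by
  classical
  let t : CompleteEdge N → Set Bool :=
    fun e => {b | (e.1 ∈ F → b = true) ∧ (e.1.swap ∈ F → b = false)}
  let S : Finset (CompleteEdge N) := Finset.univ.filter fun e => e.1 ∈ F ∨ e.1.swap ∈ F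
  have hsub : {ω | ∀ x ∈ F, (orientComplete ω).Adj x.1 x.2} ⊆ Set.univ.pi t := by
    intro ω hω e _
    constructor
    · intro he
      rcases hω _ he with ⟨h, h'⟩ | ⟨h, h'⟩
      · exact h'
      · exact absurd h (not_lt.2 e.2.le)
    · intro he
      rcases hω _ he with ⟨h, h'⟩ | ⟨h, h'⟩
      · exact absurd h (not_lt.2 e.2.le)
      · exact h'
  have ht : ∀ e, (PMF.uniformOfFintype Bool).toMeasure (t e) ≤ if e ∈ S then 1 / 2 else 1 := by
    intro e
    split_ifs with he
    · rcases (Finset.mem_filter.1 he).2 with he | he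
      · exact (measure_mono (t := {true}) fun b hb => hb.1 he).trans (coin_singleton _).le
      · exact (measure_mono (t := {false}) fun b hb => hb.2 he).trans (coin_singleton _).le
    · exact prob_le_one
  have hFS : F.card ≤ S.card := by
    have h1 : F ⊆ S.image fun e => if e.1 ∈ F then e.1 else e.1.swap := by
      intro x hx
      have hne : x.1 ≠ x.2 := by
        intro h
        refine hF x hx ?_
        rwa [show x.swap = x from Prod.ext h.symm h]
      rcases lt_or_gt_of_ne hne with h | h
      · exact Finset.mem_image.2 ⟨⟨x, h⟩, Finset.mem_filter.2 ⟨Finset.mem_univ _, Or.inl hx⟩,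
          if_pos hx⟩
      · refine Finset.mem_image.2 ⟨⟨x.swap, h⟩,
          Finset.mem_filter.2 ⟨Finset.mem_univ _, Or.inr (by simpa using hx)⟩, ?_⟩
        rw [if_neg (hF x hx), Prod.swap_swap]
    exact (Finset.card_le_card h1).trans Finset.card_image_le
  calc _ ≤ coinMeasure N (Set.univ.pi t) := measure_mono hsub
    _ = ∏ e, (PMF.uniformOfFintype Bool).toMeasure (t e) := Measure.pi_pi _ _
    _ ≤ ∏ e, if e ∈ S then 1 / 2 else 1 := Finset.prod_le_prod' fun e _ => ht e
    _ = (1 / 2) ^ S.card := by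
      rw [Finset.prod_ite_mem, Finset.univ_inter, Finset.prod_const]
    _ ≤ (1 / 2) ^ F.card := pow_le_pow_right_of_le_one' (by simp) hFS

/-- Union bound over structures which force many edges. -/
theorem coinMeasure_exists_forall_adj_le {N : ℕ} {ι : Type*} [Fintype ι]
    (F : ι → Finset (Fin N × Fin N)) (P : ι → Prop) (f : ℕ)
    (hF : ∀ s, P s → f ≤ (F s).card ∧ ∀ x ∈ F s, x.swap ∉ F s) :
    coinMeasure N {ω | ∃ s, P s ∧ ∀ x ∈ F s, (orientComplete ω).Adj x.1 x.2} ≤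
      Fintype.card ι * (1 / 2) ^ f := by
  have hsub : {ω | ∃ s, P s ∧ ∀ x ∈ F s, (orientComplete ω).Adj x.1 x.2} ⊆
      ⋃ s, {ω | P s ∧ ∀ x ∈ F s, (orientComplete ω).Adj x.1 x.2} := by
    rintro ω ⟨s, hs⟩
    exact Set.mem_iUnion.2 ⟨s, hs⟩
  refine (measure_mono hsub).trans ((measure_iUnion_fintype_le _ _).trans ?_)
  rw [← nsmul_eq_mul, ← Finset.card_univ]
  refine Finset.sum_le_card_nsmul _ _ _ fun s _ => ?_
  by_cases hs : P s
  · refine (measure_mono fun ω hω => hω.2).trans ((coinMeasure_forall_adj_le (F s)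
      (hF s hs).2).trans (pow_le_pow_right_of_le_one' (by simp) (hF s hs).1))
  · simp [hs]

theorem ENNReal.two_pow_mul_half_pow (a b : ℕ) :
    (2 : ENNReal) ^ a * (1 / 2) ^ (a + b) = (1 / 2) ^ b := by
  rw [pow_add, ← mul_assoc, ← mul_pow, one_div, ENNReal.mul_inv_cancel (by simp) (by simp),
    one_pow, one_mul]

/-- With `κ = 2 * lam + 1` there are at most `2 ^ (2 * lam * κ)` pairs of `κ`-tuples, and each
forces `κ ^ 2 = 2 * lam * κ + κ` edges. -/
theorem coinMeasure_no_edge_le {M N lam : ℕ} (g : Fin M ↪ Fin N) (hM : M ≤ 2 ^ lam) :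
    coinMeasure N {ω | ∃ X Y : Finset (Fin M), Disjoint X Y ∧ 2 * lam + 1 ≤ X.card ∧
      2 * lam + 1 ≤ Y.card ∧ ∀ x ∈ X, ∀ y ∈ Y, ¬ (orientComplete ω).Adj (g x) (g y)} ≤
      (1 / 2) ^ (2 * lam + 1) := by
  classical
  obtain ⟨κ, hκ⟩ : ∃ κ, κ = 2 * lam + 1 := ⟨_, rfl⟩
  rw [← hκ]
  have hb := coinMeasure_exists_forall_adj_le (N := N) (ι := (Fin κ → Fin M) × (Fin κ → Fin M))
    (fun s => Finset.univ.image fun x : Fin κ × Fin κ => (g (s.1 x.1), g (s.2 x.2)))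
    (fun s => Function.Injective s.1 ∧ Function.Injective s.2 ∧ ∀ i j, s.1 i ≠ s.2 j) (κ * κ)
    (by
      rintro ⟨s, t⟩ ⟨hs, ht, hst⟩
      constructor
      · rw [Finset.card_image_of_injective]
        · simp
        · intro x y hxy
          simp only [Prod.mk.injEq] at hxy
          exact Prod.ext (hs (g.injective hxy.1)) (ht (g.injective hxy.2))
      · intro x hx hx'
        obtain ⟨y, -, rfl⟩ := Finset.mem_image.1 hx
        obtain ⟨z, -, hz⟩ := Finset.mem_image.1 hx'
        simp only [Prod.swap_prod_mk, Prod.mk.injEq] at hz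
        exact hst _ _ (g.injective hz.1))
  refine (measure_mono ?_).trans (hb.trans ?_)
  · rintro ω ⟨X, Y, hXY, hX, hY, hno⟩
    obtain ⟨X', hX', hXc⟩ := Finset.exists_subset_card_eq hX
    obtain ⟨Y', hY', hYc⟩ := Finset.exists_subset_card_eq hY
    let a : Fin κ → Fin M := fun i => (X'.equivFinOfCardEq hXc).symm i
    let b : Fin κ → Fin M := fun i => (Y'.equivFinOfCardEq hYc).symm i
    have ha : ∀ i, a i ∈ X := fun i => hX' ((X'.equivFinOfCardEq hXc).symm i).2
    have hb : ∀ i, b i ∈ Y := fun i => hY' ((Y'.equivFinOfCardEq hYc).symm i).2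
    have hba : ∀ i j, b i ≠ a j := fun i j h =>
      Finset.disjoint_left.1 hXY (ha j) (h ▸ hb i)
    -- The order is swapped: having no edge from `X` to `Y` forces all edges from `Y` to `X`.
    refine ⟨(b, a), ⟨fun i j h => (Y'.equivFinOfCardEq hYc).symm.injective (Subtype.ext h),
      fun i j h => (X'.equivFinOfCardEq hXc).symm.injective (Subtype.ext h), hba⟩, ?_⟩
    intro x hx
    obtain ⟨y, -, rfl⟩ := Finset.mem_image.1 hx
    have := (orientComplete_isTournament ω).2 (g (b y.1)) (g (a y.2))
      (fun h => hba _ _ (g.injective h))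
    have h2 := hno _ (ha y.2) _ (hb y.1)
    rcases this with h | h
    · exact h.1
    · exact absurd h.1 h2
  · have h1 : (Fintype.card ((Fin κ → Fin M) × (Fin κ → Fin M)) : ENNReal) ≤
        2 ^ (2 * lam * κ) := by
      have : Fintype.card ((Fin κ → Fin M) × (Fin κ → Fin M)) ≤ 2 ^ (2 * lam * κ) := by
        simp only [Fintype.card_prod, Fintype.card_pi, Fintype.card_fin, Finset.prod_const,
          Finset.card_univ]
        calc M ^ κ * M ^ κ ≤ (2 ^ lam) ^ κ * (2 ^ lam) ^ κ := by gcongr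
          _ = _ := by
            rw [← pow_mul, ← pow_add]
            ring_nf
      exact_mod_cast this
    calc _ ≤ (2 : ENNReal) ^ (2 * lam * κ) * (1 / 2) ^ (κ * κ) := by gcongr
      _ = _ := by
        rw [show κ * κ = 2 * lam * κ + κ by rw [hκ]; ring, ENNReal.two_pow_mul_half_pow]

/-- The structure consists of five functions on `Fin m`, each with at most `2 ^ (lam * m)` choices.
One forced pair per vertex beyond `5 * lam` leaves the factor `(1 / 2) ^ m`. -/
theorem coinMeasure_forcedPairs_le {M N lam n m ℓ : ℕ} (g : Fin M ↪ Fin N) (hM : M ≤ 2 ^ lam)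
    (hn : n ≤ M) (hm : m ≤ M) :
    coinMeasure N {ω | ∃ (e : Fin m → Fin M) (ρ β : Fin m → Fin n) (p q : Fin m → Fin m),
      Function.Injective e ∧
      (5 * lam + 1) * m ≤ (forcedPairs (fun u => (ρ u : ℕ)) (fun u => (β u : ℕ)) p q ℓ).card ∧
      ∀ x ∈ forcedPairs (fun u => (ρ u : ℕ)) (fun u => (β u : ℕ)) p q ℓ,
        (orientComplete ω).Adj (g (e x.1)) (g (e x.2))} ≤ (1 / 2) ^ m := by
  classical
  let ι := (Fin m → Fin M) × (Fin m → Fin n) × (Fin m → Fin n) × (Fin m → Fin m) × (Fin m → Fin m)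
  let F : ι → Finset (Fin m × Fin m) := fun s =>
    forcedPairs (fun u => (s.2.1 u : ℕ)) (fun u => (s.2.2.1 u : ℕ)) s.2.2.2.1 s.2.2.2.2 ℓ
  have hb := coinMeasure_exists_forall_adj_le (N := N) (ι := ι)
    (fun s => (F s).image fun x => (g (s.1 x.1), g (s.1 x.2)))
    (fun s => Function.Injective s.1 ∧ (5 * lam + 1) * m ≤ (F s).card) ((5 * lam + 1) * m)
    (by
      rintro s ⟨hs, hF⟩
      constructor
      · rwa [Finset.card_image_of_injective]
        intro x y hxy
        simp only [Prod.mk.injEq] at hxy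
        exact Prod.ext (hs (g.injective hxy.1)) (hs (g.injective hxy.2))
      · intro x hx hx'
        obtain ⟨y, hy, rfl⟩ := Finset.mem_image.1 hx
        obtain ⟨z, hz, hzy⟩ := Finset.mem_image.1 hx'
        simp only [Prod.swap_prod_mk, Prod.mk.injEq] at hzy
        have h1 := hs (g.injective hzy.1)
        have h2 := hs (g.injective hzy.2)
        have h3 := (Finset.mem_filter.1 hy).2.1.1
        have h4 := (Finset.mem_filter.1 hz).2.1.1
        simp only [h1, h2] at h4
        exact lt_asymm h3 h4)
  refine (measure_mono ?_).trans (hb.trans ?_)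
  · rintro ω ⟨e, ρ, β, p, q, he, hF, hadj⟩
    refine ⟨(e, ρ, β, p, q), ⟨he, hF⟩, fun x hx => ?_⟩
    obtain ⟨y, hy, rfl⟩ := Finset.mem_image.1 hx
    exact hadj y hy
  · have h1 : (Fintype.card ι : ENNReal) ≤ 2 ^ (5 * lam * m) := by
      have : Fintype.card ι ≤ 2 ^ (5 * lam * m) := by
        simp only [ι, Fintype.card_prod, Fintype.card_pi, Fintype.card_fin, Finset.prod_const,
          Finset.card_univ]
        calc M ^ m * (n ^ m * (n ^ m * (m ^ m * m ^ m)))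
            ≤ (2 ^ lam) ^ m * ((2 ^ lam) ^ m * ((2 ^ lam) ^ m *
              ((2 ^ lam) ^ m * (2 ^ lam) ^ m))) := by
              have := hn.trans hM
              have := hm.trans hM
              gcongr
          _ = _ := by
            simp only [← pow_mul, ← pow_add]
            ring_nf
      exact_mod_cast this
    calc _ ≤ (2 : ENNReal) ^ (5 * lam * m) * (1 / 2) ^ ((5 * lam + 1) * m) := by gcongr
      _ = _ := by
        rw [show (5 * lam + 1) * m = 5 * lam * m + m by ring, ENNReal.two_pow_mul_half_pow]

/-- The probability that the random tournament has a colouring without long monochromatic paths. -/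
theorem coinMeasure_compl_hasMonoPath_le {k M N lam n m σ : ℕ} (hk : 2 ≤ k) (hn : 0 < n)
    (hMN : M ≤ N) (hM : M ≤ 2 ^ lam) (hσ : 0 < σ)
    (hm : 2 * (n / σ + 1) * (2 * (5 * lam + 1) + 4 * (10 * (2 * lam + 1)) + σ ^ 2) ≤ m)
    (hV : n ^ (k - 2) * (m + 400 * n) < M) :
    coinMeasure N {ω | ∀ c : (orientComplete ω).EdgeColouring k, c.HasMonoPath n}ᶜ ≤
      (1 / 2) ^ (2 * lam + 1) + (1 / 2) ^ m := by
  have hmM : m + 400 * n ≤ M := (Nat.le_mul_of_pos_left _ (pow_pos hn _)).trans hV.le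
  -- Only the first `M` vertices are used, so the union bounds do not depend on `N`, which may be
  -- arbitrarily large.
  let g : Fin M ↪ Fin N := Fin.castLEEmb hMN
  refine le_trans ?_ (add_le_add (coinMeasure_no_edge_le g hM)
    (coinMeasure_forcedPairs_le (n := n) (m := m) (ℓ := 10 * (2 * lam + 1)) g hM
      (by omega) (by omega)))
  refine le_trans (measure_mono ?_) (measure_union_le _ _)
  intro ω hω
  by_contra hno
  simp only [Set.mem_union, Set.mem_ofPred_eq, not_or, not_exists, not_and] at hno
  refine hω fun c => ?_
  obtain ⟨i, hi, l, hl, hc, hln⟩ := exists_long_monochromatic_path (n := n) (m := m) (σ := σ)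
    (κ := 2 * lam + 1) (G := 5 * lam + 1) hk
    (E := fun u v => (orientComplete ω).Adj (g u) (g v))
    (fun i u v => ∃ h : (orientComplete ω).Adj (g u) (g v), (c _ _ h : ℕ) = i)
    (fun u v huv => by
      rcases (orientComplete_isTournament ω).2 (g u) (g v) (fun h => huv (g.injective h)) with h | h
      · exact Or.inl h.1
      · exact Or.inr h.1)
    (fun u => (orientComplete_isTournament ω).1 _)
    (fun u v h => ⟨c _ _ h, (c _ _ h).2, h, rfl⟩) (by omega) hσ hm
    (fun X Y hXY hX hY => by
      have := hno.1 X Y hXY hX hY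
      push Not at this
      exact this)
    (fun e ρ β p q he hF => by
      have := hno.2 e ρ β p q he hF
      push Not at this
      exact this)
    (by simpa using hV)
  refine c.hasMonoPath_of_list ⟨i, hi⟩ n (l.map g) (hl.map g.injective) ?_ (by simpa using hln)
  refine (List.isChain_map _).2 (hc.imp fun u v huv => ?_)
  obtain ⟨h, h'⟩ := huv
  exact ⟨h, Fin.ext h'⟩

/-! ### Parameters and conclusion of the upper bound -/

theorem clog_two_le_logb_add_one {n : ℕ} (hn : 2 ≤ n) :
    (Nat.clog 2 n : ℝ) ≤ Real.logb 2 n + 1 := by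
  have h1 : 2 ^ (Nat.clog 2 n - 1) < n := Nat.pow_pred_clog_lt_self (by norm_num) (by omega)
  have h2 : ((2 : ℝ) ^ ((Nat.clog 2 n - 1 : ℕ) : ℝ)) ≤ n := by
    rw [Real.rpow_natCast]
    exact_mod_cast h1.le
  have h3 := (Real.le_logb_iff_rpow_le (by norm_num) (by positivity)).2 h2
  have h4 : 0 < Nat.clog 2 n := Nat.clog_pos (by norm_num) hn
  rw [Nat.cast_sub (by omega)] at h3
  push_cast at h3
  linarith

theorem eventually_mul_sqrt_logb_add_one_le (c : ℝ) (hc : 0 < c) :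
    ∀ᶠ n : ℕ in atTop, c * Real.sqrt (Real.logb 2 n) + 1 ≤ n := by
  have h2 : 0 < Real.log 2 := Real.log_pos (by norm_num)
  have h := (Real.isLittleO_log_id_atTop.comp_tendsto tendsto_natCast_atTop_atTop).bound
    (show 0 < Real.log 2 / (2 * c) by positivity)
  filter_upwards [h, eventually_ge_atTop 2] with n hn h2n
  have h2n' : (2 : ℝ) ≤ n := by exact_mod_cast h2n
  have h1 : 1 ≤ Real.logb 2 n := by
    rw [Real.le_logb_iff_rpow_le (by norm_num) (by positivity)]
    simpa using h2n'
  have hs : Real.sqrt (Real.logb 2 n) ≤ Real.logb 2 n := by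
    rw [Real.sqrt_le_left (by linarith)]
    nlinarith
  have hL : c * Real.logb 2 n ≤ n / 2 := by
    simp only [Function.comp_apply, id_eq, Real.norm_eq_abs] at hn
    rw [abs_of_nonneg (Real.log_nonneg (by linarith)), abs_of_nonneg (by linarith)] at hn
    rw [Real.logb]
    calc c * (Real.log n / Real.log 2) ≤ c * (Real.log 2 / (2 * c) * n / Real.log 2) := by gcongr
      _ = n / 2 := by field_simp
  nlinarith [mul_le_mul_of_nonneg_left hs hc.le]

/-- The choice of parameters in the upper bound. -/
theorem parameter_bound {k n σ q : ℕ} (hk : 2 ≤ k) (hn : 2 ≤ n) (hq : q = Nat.clog 2 n)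
    (hσ : σ = Nat.sqrt q) :
    ((n ^ (k - 2) * (2 * (n / σ + 1) * (133 * k * q) + 400 * n) : ℕ) : ℝ) <
      2000 * k * ((n : ℝ) ^ (k - 1) * Real.sqrt (Real.logb 2 n)) := by
  have hq1 : 1 ≤ q := hq ▸ Nat.clog_pos (by norm_num) hn
  have hσ1 : 1 ≤ σ := hσ ▸ Nat.sqrt_pos.2 hq1
  have hqn : q ≤ n := by
    rw [hq]
    exact Nat.clog_le_of_le_pow (Nat.lt_two_pow_self).le
  have hσn : σ ≤ n := (hσ ▸ Nat.sqrt_le_self q).trans hqn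
  have hn' : (2 : ℝ) ≤ n := by exact_mod_cast hn
  have hk' : (2 : ℝ) ≤ k := by exact_mod_cast hk
  have hσ' : (1 : ℝ) ≤ σ := by exact_mod_cast hσ1
  have hσn' : (σ : ℝ) ≤ n := by exact_mod_cast hσn
  have hL1 : 1 ≤ Real.logb 2 n := by
    rw [Real.le_logb_iff_rpow_le (by norm_num) (by positivity)]
    simpa using hn'
  obtain ⟨r, hr⟩ : ∃ r, r = Real.sqrt (Real.logb 2 n) := ⟨_, rfl⟩
  have hr1 : 1 ≤ r := by
    rw [hr]
    exact Real.one_le_sqrt.2 hL1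
  have hr2 : r ^ 2 = Real.logb 2 n := by rw [hr, Real.sq_sqrt (by linarith)]
  have hqL : (q : ℝ) ≤ 2 * r ^ 2 := by
    have := clog_two_le_logb_add_one hn
    rw [← hq] at this
    rw [hr2]
    linarith
  have hqσ : (q : ℝ) ≤ (2 * σ) ^ 2 := by
    have : q ≤ (2 * σ) ^ 2 := by
      have h1 := Nat.lt_succ_sqrt q
      rw [← hσ, Nat.succ_eq_add_one] at h1
      nlinarith
    exact_mod_cast this
  -- From `q ≤ 2 * r ^ 2` and `q ≤ 4 * σ ^ 2` one gets `q ^ 2 ≤ 8 * (r * σ) ^ 2`. This turns `(n /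
  -- σ) * q` into a multiple of `n * r`.
  have hqr : (q : ℝ) ≤ 3 * r * σ := by
    have h0 : (0 : ℝ) ≤ q := by positivity
    have h1 : (q : ℝ) ^ 2 ≤ (3 * r * σ) ^ 2 := by
      nlinarith [mul_le_mul hqL hqσ h0 (by positivity), sq_nonneg (r * σ)]
    exact abs_le_of_sq_le_sq' h1 (by positivity) |>.2
  have hdiv : ((n / σ : ℕ) : ℝ) ≤ n / σ := Nat.cast_div_le
  have h1n : (1 : ℝ) ≤ n / σ := by rwa [le_div_iff₀ (by linarith), one_mul]
  have hm : (2 * ((n / σ : ℕ) + 1 : ℝ) * (133 * k * q)) ≤ 1596 * k * n * r := by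
    calc (2 * ((n / σ : ℕ) + 1 : ℝ) * (133 * k * q))
        ≤ 2 * (n / σ + n / σ) * (133 * k * (3 * r * σ)) := by
          gcongr
      _ = 1596 * k * n * r := by
          field_simp
          ring
  have h400 : 400 * (n : ℝ) ≤ 200 * k * n * r := by
    have : (2 : ℝ) * 1 ≤ k * r := by gcongr
    nlinarith
  have hpow : (n : ℝ) ^ (k - 1) = n ^ (k - 2) * n := by
    rw [← pow_succ]
    congr 1
    omega
  rw [← hr, hpow]
  push_cast
  have hpos : (0 : ℝ) < n ^ (k - 2) := by positivity
  have hfin : 2 * ((n / σ : ℕ) + 1 : ℝ) * (133 * k * q) + 400 * n < 2000 * k * n * r := by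
    have : 0 < k * n * r := by positivity
    nlinarith
  calc _ < (n : ℝ) ^ (k - 2) * (2000 * k * n * r) := by
        exact mul_lt_mul_of_pos_left (by exact_mod_cast hfin) hpos
    _ = _ := by ring

theorem tendsto_coinMeasure_hasMonoPath (k : ℕ) (hk : 2 ≤ k) (N : ℕ → ℕ)
    (hN : ∀ᶠ n : ℕ in atTop,
      2000 * (k : ℝ) * ((n : ℝ) ^ (k - 1) * Real.sqrt (Real.logb 2 (n : ℝ))) ≤ (N n : ℝ)) :
    Tendsto (fun n : ℕ => coinMeasure (N n)
      {ω | ∀ c : (orientComplete ω).EdgeColouring k, c.HasMonoPath n}) atTop (𝓝 1) := by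
  have hk0 : (0 : ℝ) < 2000 * k := by positivity
  have hclog : Tendsto (fun n : ℕ => Nat.clog 2 n) atTop atTop := by
    refine tendsto_atTop.2 fun b => ?_
    filter_upwards [eventually_gt_atTop (2 ^ b)] with n hn
    exact ((Nat.lt_clog_iff_pow_lt (by norm_num)).2 hn).le
  have hlim : Tendsto (fun n : ℕ => 1 - ((1 / 2 : ENNReal) ^ (Nat.clog 2 n) +
      (1 / 2) ^ (Nat.clog 2 n))) atTop (𝓝 1) := by
    have h1 : Tendsto (fun n : ℕ => (1 / 2 : ENNReal) ^ (Nat.clog 2 n)) atTop (𝓝 0) :=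
      (ENNReal.tendsto_pow_atTop_nhds_zero_of_lt_one (by simp)).comp hclog
    have h2 := ENNReal.Tendsto.sub (tendsto_const_nhds (x := (1 : ENNReal))) (h1.add h1)
      (Or.inl (by simp))
    simpa using h2
  refine tendsto_of_tendsto_of_tendsto_of_le_of_le' hlim tendsto_const_nhds ?_
    (Eventually.of_forall fun n => prob_le_one)
  filter_upwards [hN, eventually_mul_sqrt_logb_add_one_le _ hk0, eventually_ge_atTop 2]
    with n hNn hsq hn
  obtain ⟨q, hq⟩ : ∃ q, q = Nat.clog 2 n := ⟨_, rfl⟩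
  obtain ⟨σ, hσ⟩ : ∃ σ, σ = Nat.sqrt q := ⟨_, rfl⟩
  have hq1 : 1 ≤ q := hq ▸ Nat.clog_pos (by norm_num) hn
  have hσ1 : 1 ≤ σ := hσ ▸ Nat.sqrt_pos.2 hq1
  have hkq : q ≤ k * q := Nat.le_mul_of_pos_left _ (by omega)
  obtain ⟨x, hx⟩ : ∃ x, x = 2000 * (k : ℝ) * ((n : ℝ) ^ (k - 1) * Real.sqrt (Real.logb 2 n)) :=
    ⟨_, rfl⟩
  have hx0 : 0 ≤ x := by rw [hx]; positivity
  have hpar := parameter_bound hk hn hq hσ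
  rw [← hx] at hpar hNn
  have hMN : ⌈x⌉₊ ≤ N n := Nat.ceil_le.2 hNn
  -- For large `n` the factor `2000 * k * √log n` is below `n`, so `n ^ k` bounds the number of
  -- vertices kept; hence `lam = k * q`.
  have hM : ⌈x⌉₊ ≤ 2 ^ (k * q) := by
    have h1 : n ^ k ≤ 2 ^ (k * q) := by
      rw [mul_comm, pow_mul]
      exact Nat.pow_le_pow_left (hq ▸ Nat.le_pow_clog (by norm_num) n) k
    refine le_trans (Nat.ceil_le.2 ?_) h1
    push_cast
    have h2 : (n : ℝ) ^ k = n ^ (k - 1) * n := by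
      rw [← pow_succ]
      congr 1
      omega
    rw [h2, hx]
    have h3 : (0 : ℝ) < n ^ (k - 1) := by positivity
    nlinarith
  have hσq : σ ^ 2 ≤ q := by
    rw [hσ]
    exact Nat.sqrt_le' q
  have hmono : ∀ a, q ≤ a → (1 / 2 : ENNReal) ^ a ≤ (1 / 2) ^ q := fun a ha =>
    pow_le_pow_right_of_le_one' (by simp) ha
  -- With `lam = k * q ≥ 1` and `σ ^ 2 ≤ lam`, the bracket is `90 * lam + 42 + σ ^ 2 ≤ 133 * lam`.
  have hcompl := coinMeasure_compl_hasMonoPath_le (m := 2 * (n / σ + 1) * (133 * k * q)) hk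
    (by omega) hMN hM hσ1 (Nat.mul_le_mul_left _ (by nlinarith))
    (by exact_mod_cast hpar.trans_le (Nat.le_ceil x))
  have hle := hcompl.trans (add_le_add (hmono _ (by omega)) (hmono _
    ((show q ≤ 133 * k * q by nlinarith).trans (Nat.le_mul_of_pos_left _ (by positivity)))))
  rw [← hq, tsub_le_iff_right]
  exact (measure_univ (μ := coinMeasure (N n))).symm.le.trans
    ((measure_univ_le_add_compl _).trans (add_le_add_right hle _))

/-! ### Grid colourings, transitive sets and dependent random choice -/

/-- A placement of the vertices of a tournament in a grid which respects the order gives an edge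
colouring without long monochromatic paths. -/
theorem Digraph.IsTournament.exists_edgeColouring {V : Type*} {T : Digraph V}
    (hT : T.IsTournament) {k n : ℕ} (φ : V → Fin k → ℕ) (hφ : ∀ v i, φ v i < n)
    (h : ∀ u v, u ≠ v → (∀ i, φ u i ≤ φ v i) → T.Adj u v) :
    ∃ c : T.EdgeColouring k, ¬ c.HasMonoPath n := by
  -- If no coordinate increased along `u → v`, then `φ v ≤ φ u` would force the opposite edge.
  have hex : ∀ u v, T.Adj u v → ∃ i, φ u i < φ v i := by
    intro u v huv
    by_contra hno
    push Not at hno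
    have hne : u ≠ v := by
      rintro rfl
      exact hT.1 u huv
    have h1 := h v u hne.symm hno
    rcases hT.2 u v hne with h2 | h2
    · exact h2.2 h1
    · exact h2.2 huv
  choose c hc using hex
  refine ⟨c, ?_⟩
  rintro ⟨a, p, hp, hpa⟩
  have hmono : StrictMono fun j => φ (p j) a := by
    rw [Fin.strictMono_iff_lt_succ]
    intro i
    obtain ⟨h1, h2⟩ := hpa i
    have := hc _ _ h1
    rwa [h2] at this
  have := Fintype.card_le_of_injective
    (fun j : Fin (n + 1) => (⟨φ (p j) a, hφ _ _⟩ : Fin n))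
    (fun i j hij => hmono.injective (by simpa using hij))
  simp at this

/-- A semicomplete digraph on `2 ^ t` vertices contains a transitive set of size `t`. -/
theorem exists_transitive {V : Type*} [DecidableEq V] (E : V → V → Prop)
    (hE : ∀ u v, u ≠ v → E u v ∨ E v u) (t : ℕ) (U : Finset V) (hU : 2 ^ t ≤ U.card) :
    ∃ l : List V, l.length = t ∧ l.Nodup ∧ l.Pairwise E ∧ ∀ x ∈ l, x ∈ U := by
  classical
  induction t generalizing U with
  | zero => exact ⟨[], by simp⟩
  | succ t ih =>
    obtain ⟨v, hv⟩ : U.Nonempty := Finset.card_pos.1 ((Nat.two_pow_pos _).trans_le hU)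
    have hsplit : (U.erase v).card ≤
        ((U.erase v).filter fun x => E v x).card + ((U.erase v).filter fun x => E x v).card := by
      refine (Finset.card_le_card fun x hx => ?_).trans (Finset.card_union_le _ _)
      rw [Finset.mem_union, Finset.mem_filter, Finset.mem_filter]
      rcases hE v x (Finset.ne_of_mem_erase hx).symm with h | h
      · exact Or.inl ⟨hx, h⟩
      · exact Or.inr ⟨hx, h⟩
    have hc := Finset.card_erase_add_one hv
    have hpos := Nat.two_pow_pos t
    rw [pow_succ] at hU
    by_cases hlarge : 2 ^ t ≤ ((U.erase v).filter fun x => E v x).card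
    · obtain ⟨l, h1, h2, h3, h4⟩ := ih _ hlarge
      simp only [Finset.mem_filter, Finset.mem_erase] at h4
      refine ⟨v :: l, by simp [h1], List.nodup_cons.2 ⟨fun h => (h4 v h).1.1 rfl, h2⟩,
        List.pairwise_cons.2 ⟨fun x hx => (h4 x hx).2, h3⟩, ?_⟩
      intro x hx
      rcases List.mem_cons.1 hx with rfl | hx
      · exact hv
      · exact (h4 x hx).1.2
    · obtain ⟨l, h1, h2, h3, h4⟩ := ih ((U.erase v).filter fun x => E x v) (by omega)
      simp only [Finset.mem_filter, Finset.mem_erase] at h4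
      refine ⟨l ++ [v], by simp [h1], ?_, ?_, ?_⟩
      · refine List.nodup_append.2 ⟨h2, by simp, ?_⟩
        intro x hx y hy
        rw [List.mem_singleton] at hy
        rw [hy]
        exact (h4 x hx).1.1
      · refine List.pairwise_append.2 ⟨h3, by simp, ?_⟩
        intro x hx y hy
        rw [List.mem_singleton] at hy
        rw [hy]
        exact (h4 x hx).2
      · intro x hx
        rcases List.mem_append.1 hx with hx | hx
        · exact (h4 x hx).1.2
        · rw [List.mem_singleton] at hx
          exact hx ▸ hv

open Classical in
/-- The vertices of `W` which are out-neighbours of, or equal to, every vertex in `S`. -/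
noncomputable def commonOut {V : Type*} (E : V → V → Prop) (W S : Finset V) : Finset V :=
  W.filter fun v => ∀ u ∈ S, u = v ∨ E u v

theorem commonOut_subset {V : Type*} (E : V → V → Prop) (W S : Finset V) : commonOut E W S ⊆ W := by
  classical
  exact Finset.filter_subset _ _

theorem eq_or_of_mem_commonOut {V : Type*} {E : V → V → Prop} {W S : Finset V} {v : V}
    (h : v ∈ commonOut E W S) : ∀ u ∈ S, u = v ∨ E u v := by
  classical
  exact (Finset.mem_filter.1 h).2

/-- Of `(x, y)` and `(y, x)` at least one is counted. Since `commonOut` is reflexive, diagonal pairs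
count too, so the bound has no lower-order loss. -/
theorem sq_card_le_two_mul_sum_card {V : Type*} (E : V → V → Prop)
    (hE : ∀ u v, u ≠ v → E u v ∨ E v u) (W : Finset V) :
    W.card ^ 2 ≤ 2 * ∑ x ∈ W, (commonOut E W {x}).card := by
  classical
  have h1 : ∑ x ∈ W, (commonOut E W {x}).card
      = ((W ×ˢ W).filter fun p => p.1 = p.2 ∨ E p.1 p.2).card := by
    rw [Finset.card_filter, Finset.sum_product]
    refine Finset.sum_congr rfl fun x _ => ?_
    rw [← Finset.card_filter]
    simp [commonOut]
  have h2 : ((W ×ˢ W).filter fun p => p.2 = p.1 ∨ E p.2 p.1).card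
      = ((W ×ˢ W).filter fun p => p.1 = p.2 ∨ E p.1 p.2).card := by
    refine Finset.card_bij (fun p _ => p.swap) ?_ ?_ ?_
    · intro p hp
      simp only [Finset.mem_filter, Finset.mem_product, Prod.fst_swap, Prod.snd_swap] at hp ⊢
      exact ⟨hp.1.symm, hp.2⟩
    · exact fun p _ q _ h => Prod.swap_injective h
    · intro p hp
      simp only [Finset.mem_filter, Finset.mem_product] at hp
      exact ⟨p.swap, by simp [hp.1, hp.2], p.swap_swap⟩
  have h3 : (W ×ˢ W).card ≤ ((W ×ˢ W).filter fun p => p.1 = p.2 ∨ E p.1 p.2).card +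
      ((W ×ˢ W).filter fun p => p.2 = p.1 ∨ E p.2 p.1).card := by
    refine (Finset.card_le_card fun p hp => ?_).trans (Finset.card_union_le _ _)
    rw [Finset.mem_union, Finset.mem_filter, Finset.mem_filter]
    by_cases hpp : p.1 = p.2
    · exact Or.inl ⟨hp, Or.inl hpp⟩
    · rcases hE _ _ hpp with h | h
      · exact Or.inl ⟨hp, Or.inr h⟩
      · exact Or.inr ⟨hp, Or.inr h⟩
  rw [Finset.card_product, ← sq] at h3
  omega

/-- Dependent random choice. -/
theorem exists_subset_commonOut {V : Type*} (E : V → V → Prop)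
    (hE : ∀ u v, u ≠ v → E u v ∨ E v u) (W : Finset V) (D b : ℕ) (hD : 0 < D)
    (hb : b ^ 2 ≤ W.card) :
    ∃ W' ⊆ W, W.card ≤ 2 ^ (2 * D) * (W'.card + 1) ∧
      ∀ S ⊆ W', S.card ≤ D → b ≤ (commonOut E W S).card := by
  classical
  rcases W.eq_empty_or_nonempty with rfl | hW
  · refine ⟨∅, subset_rfl, by simp, fun S _ _ => ?_⟩
    have : b = 0 := by simpa using hb
    omega
  -- Sample `q` vertices with repetition and keep those dominating, or equal to, every sample. On
  -- average at least `W.card / 2 ^ q` vertices are kept.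
  set q := 2 * D with hq
  let Z : Finset (Fin q → V) := Fintype.piFinset fun _ => W
  have hZc : Z.card = W.card ^ q := by simp [Z]
  let bad : Finset (Fin D → V) := (Fintype.piFinset fun _ => W).filter fun τ =>
    (commonOut E W (Finset.univ.image τ)).card < b
  let rA : (Fin q → V) → V → Prop := fun z x => ∀ i, x = z i ∨ E x (z i)
  let rB : (Fin q → V) → (Fin D → V) → Prop := fun z τ => ∀ j, rA z (τ j)
  have hA : W.card ^ q * W.card ≤ ∑ z ∈ Z, 2 ^ q * (W.filter fun x => rA z x).card := by
    have h1 : ∑ z ∈ Z, (W.filter fun x => rA z x).card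
        = ∑ x ∈ W, (commonOut E W {x}).card ^ q := by
      have := Finset.sum_card_bipartiteAbove_eq_sum_card_bipartiteBelow (s := Z) (t := W) rA
      simp only [Finset.bipartiteAbove, Finset.bipartiteBelow] at this
      rw [this]
      refine Finset.sum_congr rfl fun x _ => ?_
      rw [← Fintype.card_piFinset_const]
      congr 1
      ext z
      simp only [Z, rA, commonOut, Finset.mem_filter, Fintype.mem_piFinset, Finset.mem_singleton,
        forall_eq]
      exact ⟨fun h i => ⟨h.1 i, h.2 i⟩, fun h => ⟨fun i => (h i).1, fun i => (h i).2⟩⟩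
    have h2 := sq_card_le_two_mul_sum_card E hE W
    have h3 : (∑ x ∈ W, (commonOut E W {x}).card) ^ q
        ≤ W.card ^ (q - 1) * ∑ x ∈ W, (commonOut E W {x}).card ^ q := by
      have := pow_sum_le_card_mul_sum_pow (s := W) (f := fun x => (commonOut E W {x}).card)
        (fun _ _ => Nat.zero_le _) (q - 1)
      rwa [Nat.sub_add_cancel (by omega)] at this
    have hWpos : 0 < W.card := Finset.card_pos.2 hW
    rw [← Finset.mul_sum, h1]
    refine Nat.le_of_mul_le_mul_left ?_ (pow_pos hWpos (q - 1))
    calc W.card ^ (q - 1) * (W.card ^ q * W.card) = (W.card ^ 2) ^ q := by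
          rw [← pow_succ, ← pow_add, ← pow_mul]
          congr 1
          omega
      _ ≤ (2 * ∑ x ∈ W, (commonOut E W {x}).card) ^ q := Nat.pow_le_pow_left h2 q
      _ = 2 ^ q * (∑ x ∈ W, (commonOut E W {x}).card) ^ q := mul_pow _ _ _
      _ ≤ 2 ^ q * (W.card ^ (q - 1) * ∑ x ∈ W, (commonOut E W {x}).card ^ q) :=
        Nat.mul_le_mul_left _ h3
      _ = _ := by ring
  -- There are at most `W.card ^ D` bad tuples, each surviving for at most `b ^ (2 * D) ≤ W.card ^
  -- D` samples: on average at most one bad tuple survives.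
  have hB : ∑ z ∈ Z, (bad.filter fun τ => rB z τ).card ≤ W.card ^ q := by
    have h1 := Finset.sum_card_bipartiteAbove_eq_sum_card_bipartiteBelow (s := Z) (t := bad) rB
    simp only [Finset.bipartiteAbove, Finset.bipartiteBelow] at h1
    rw [h1]
    have h2 : ∀ τ ∈ bad, (Z.filter fun z => rB z τ).card ≤ b ^ q := by
      intro τ hτ
      refine le_trans ?_ (Nat.pow_le_pow_left (Finset.mem_filter.1 hτ).2.le q)
      rw [← Fintype.card_piFinset_const]
      refine Finset.card_le_card fun z hz => ?_
      simp only [Z, rB, rA, Finset.mem_filter, Fintype.mem_piFinset] at hz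
      simp only [commonOut, Finset.mem_filter, Fintype.mem_piFinset, Finset.mem_image,
        Finset.mem_univ, true_and, forall_exists_index, forall_apply_eq_imp_iff]
      exact fun i => ⟨hz.1 i, fun j => hz.2 j i⟩
    have h3 : bad.card ≤ W.card ^ D := by
      refine (Finset.card_filter_le _ _).trans ?_
      simp
    calc _ ≤ bad.card * b ^ q := by
          rw [← smul_eq_mul]
          exact Finset.sum_le_card_nsmul _ _ _ h2
      _ ≤ W.card ^ D * W.card ^ D := by
          rw [hq, pow_mul]
          exact Nat.mul_le_mul h3 (Nat.pow_le_pow_left hb D)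
      _ = W.card ^ q := by
          rw [← pow_add, hq, two_mul]
  obtain ⟨z, hz, hle⟩ : ∃ z ∈ Z, W.card + 2 ^ q * (bad.filter fun τ => rB z τ).card ≤
      2 ^ q * (W.filter fun x => rA z x).card + 2 ^ q := by
    refine Finset.exists_le_of_sum_le ?_ ?_
    · exact Fintype.piFinset_nonempty.2 fun _ => hW
    · rw [Finset.sum_add_distrib, Finset.sum_add_distrib, Finset.sum_const, Finset.sum_const,
        ← Finset.mul_sum, smul_eq_mul, smul_eq_mul, hZc]
      have := Nat.mul_le_mul_left (2 ^ q) hB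
      linarith
  -- Deleting the first entry of each surviving bad tuple destroys all of them.
  let W' := (W.filter fun x => rA z x) \ (bad.filter fun τ => rB z τ).image fun τ => τ ⟨0, hD⟩
  refine ⟨W', Finset.sdiff_subset.trans (Finset.filter_subset _ _), ?_, ?_⟩
  · have h1 := Finset.le_card_sdiff ((bad.filter fun τ => rB z τ).image fun τ => τ ⟨0, hD⟩)
      (W.filter fun x => rA z x)
    have h2 : ((bad.filter fun τ => rB z τ).image fun τ => τ ⟨0, hD⟩).card ≤
      (bad.filter fun τ => rB z τ).card := Finset.card_image_le
    have h3 : (W.filter fun x => rA z x).card ≤ W'.card + (bad.filter fun τ => rB z τ).card := by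
      have h4 : W'.card = ((W.filter fun x => rA z x) \
        (bad.filter fun τ => rB z τ).image fun τ => τ ⟨0, hD⟩).card := rfl
      omega
    have h4 := Nat.mul_le_mul_left (2 ^ q) h3
    rw [mul_add] at h4
    rw [mul_add, mul_one]
    omega
  · intro S hS hSD
    rcases S.eq_empty_or_nonempty with rfl | hSne
    · simp only [commonOut, Finset.notMem_empty, false_implies, implies_true, Finset.filter_true]
      nlinarith
    by_contra hlt
    push Not at hlt
    obtain ⟨x0, hx0⟩ := hSne
    -- A set with fewer than `D` elements is padded by repetition to a `D`-tuple with the same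
    -- image.
    let τ : Fin D → V := fun j => if h : (j : ℕ) < S.card then S.equivFin.symm ⟨j, h⟩ else x0
    have hτS : ∀ j, τ j ∈ S := by
      intro j
      by_cases h : (j : ℕ) < S.card
      · simp only [τ, h, dif_pos]
        exact (S.equivFin.symm ⟨j, h⟩).2
      · simpa only [τ, h, dif_neg, not_false_eq_true] using hx0
    have himg : Finset.univ.image τ = S := by
      ext x
      simp only [Finset.mem_image, Finset.mem_univ, true_and]
      constructor
      · rintro ⟨j, rfl⟩
        exact hτS j
      · intro hx
        have hlt := (S.equivFin ⟨x, hx⟩).2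
        refine ⟨⟨S.equivFin ⟨x, hx⟩, hlt.trans_le hSD⟩, ?_⟩
        simp [τ]
    have hmem : ∀ j, τ j ∈ W ∧ rA z (τ j) := fun j =>
      Finset.mem_filter.1 (Finset.mem_sdiff.1 (hS (hτS j))).1
    refine (Finset.mem_sdiff.1 (hS (hτS ⟨0, hD⟩))).2 (Finset.mem_image.2 ⟨τ, ?_, rfl⟩)
    refine Finset.mem_filter.2 ⟨Finset.mem_filter.2 ⟨?_, ?_⟩, fun j => (hmem j).2⟩
    · exact Fintype.mem_piFinset.2 fun j => (hmem j).1
    · rwa [himg]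

/-- Nested sets such that few vertices of one set have many common out-neighbours in the previous
one. -/
structure IsHost {V : Type*} (E : V → V → Prop) (W : ℕ → Finset V) (r D b : ℕ) : Prop where
  anti : ∀ i < r, W (i + 1) ⊆ W i
  common : ∀ i < r, ∀ S ⊆ W (i + 1), S.card ≤ D → b ≤ (commonOut E (W i) S).card
  last : b ≤ (W r).card

theorem IsHost.subset_zero {V : Type*} {E : V → V → Prop} {W : ℕ → Finset V} {r D b : ℕ}
    (h : IsHost E W r D b) : ∀ i ≤ r, W i ⊆ W 0 := by
  intro i
  induction i with
  | zero => exact fun _ => subset_rfl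
  | succ i ih => exact fun hi => (h.anti i (by omega)).trans (ih (by omega))

theorem IsHost.subset_of_le {V : Type*} {E : V → V → Prop} {W : ℕ → Finset V} {r D b : ℕ}
    (h : IsHost E W r D b) {i j : ℕ} (hij : i ≤ j) (hj : j ≤ r) : W j ⊆ W i := by
  induction j, hij using Nat.le_induction with
  | base => exact subset_rfl
  | succ j _ ih => exact (h.anti j (by omega)).trans (ih (by omega))

/-- Dependent random choice is iterated `r` times. Each round costs a factor `2 ^ (2 * D)`; the
additional factor `4` per round absorbs the `+ 1` in its size bound. -/
theorem exists_isHost {V : Type*} (E : V → V → Prop) (hE : ∀ u v, u ≠ v → E u v ∨ E v u)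
    (D b a : ℕ) (hD : 0 < D) (hb : b ^ 2 ≤ 2 ^ a) (r : ℕ) (U : Finset V)
    (hU : 2 ^ (2 * (D + 1) * r + a) ≤ U.card) : ∃ W, W 0 = U ∧ IsHost E W r D b := by
  induction r generalizing U with
  | zero =>
    refine ⟨fun _ => U, rfl, by simp, by simp, ?_⟩
    rw [mul_zero, zero_add] at hU
    nlinarith
  | succ r ih =>
    obtain ⟨U', hU', hc, hcom⟩ := exists_subset_commonOut E hE U D b hD
      (hb.trans ((Nat.pow_le_pow_right (by norm_num) (by omega)).trans hU))
    have h1 : 2 ^ (2 * (D + 1) * r + a) ≤ U'.card := by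
      have h2 : 2 ^ (2 * D) * (2 ^ (2 * (D + 1) * r + a) * 4) ≤ 2 ^ (2 * D) * (U'.card + 1) := by
        refine le_trans (le_of_eq ?_) (hU.trans hc)
        rw [show (4 : ℕ) = 2 ^ 2 by norm_num, ← pow_add, ← pow_add]
        congr 1
        ring
      have h3 := Nat.le_of_mul_le_mul_left h2 (Nat.two_pow_pos _)
      have h4 := Nat.two_pow_pos (2 * (D + 1) * r + a)
      omega
    obtain ⟨W, hW0, hW⟩ := ih U' h1
    refine ⟨fun i => Nat.casesOn i U W, rfl, ?_, ?_, hW.last⟩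
    · intro i hi
      cases i with
      | zero =>
        show W 0 ⊆ U
        rwa [hW0]
      | succ i => exact hW.anti i (by omega)
    · intro i hi S hS hSD
      cases i with
      | zero =>
        have hS : S ⊆ W 0 := hS
        exact hcom S (by rwa [hW0] at hS) hSD
      | succ i => exact hW.common i (by omega) S hS hSD

/-! ### Placing a tournament on the cells of a grid -/

/-- A placement of transitive sets of size `t` on the elements of the finite set `Q` of a partial
order, with all edges directed upwards between comparable elements. -/
structure IsPlacement {V α : Type*} [PartialOrder α] (E : V → V → Prop) (t : ℕ) (Q : Finset α)
    (A : α → Fin t → V) : Prop where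
  inj : ∀ c ∈ Q, ∀ c' ∈ Q, ∀ i j, A c i = A c' j → c = c' ∧ i = j
  trans : ∀ c ∈ Q, ∀ i j, i < j → E (A c i) (A c j)
  lt : ∀ c ∈ Q, ∀ c' ∈ Q, c < c' → ∀ i j, E (A c i) (A c' j)

/-- A host contains a placement of every small graded partial order. -/
theorem IsHost.exists_isPlacement {V α : Type*} [DecidableEq V] [DecidableEq α] [PartialOrder α]
    [DecidableLT α] {E : V → V → Prop} (hE : ∀ u v, u ≠ v → E u v ∨ E v u)
    {W : ℕ → Finset V} {r D b t : ℕ} (h : IsHost E W r D b) (ρ : α → ℕ)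
    (Q : Finset α) (hρ : ∀ c ∈ Q, ∀ c' ∈ Q, c < c' → ρ c < ρ c') (hQ : ∀ c ∈ Q, ρ c ≤ r)
    (hD : ∀ c ∈ Q, (Q.filter (· < c)).card * t ≤ D)
    (hb : 2 ^ t + Q.card * t ≤ b + t) :
    ∃ A : α → Fin t → V, IsPlacement E t Q A ∧ ∀ c ∈ Q, ∀ i, A c i ∈ W 0 := by
  -- A cell of rank `ρ c` is filled from `W (r - ρ c)`. Its predecessors have smaller rank, so they
  -- lie in `W (r - ρ c + 1)`, where `common` applies.
  suffices H : ∀ Q' ⊆ Q, ∃ A : α → Fin t → V, IsPlacement E t Q' A ∧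
      ∀ c ∈ Q', ∀ i, A c i ∈ W (r - ρ c) by
    obtain ⟨A, h1, h2⟩ := H Q subset_rfl
    exact ⟨A, h1, fun c hc i => h.subset_zero _ (by omega) (h2 c hc i)⟩
  intro Q'
  induction Q' using Finset.induction_on_max_value ρ with
  | empty =>
    rcases Finset.eq_empty_or_nonempty (W r) with hW | ⟨x, -⟩
    · intro _
      rcases Nat.eq_zero_or_pos t with rfl | ht
      · exact ⟨fun _ => Fin.elim0, ⟨by simp, by simp, by simp⟩, by simp⟩
      · have h1 := h.last
        rw [hW, Finset.card_empty] at h1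
        have h2 : t < 2 ^ t := Nat.lt_two_pow_self
        omega
    · exact fun _ => ⟨fun _ _ => x, ⟨by simp, by simp, by simp⟩, by simp⟩
  | insert c s hc hmax ih =>
    intro hsQ
    rw [Finset.insert_subset_iff] at hsQ
    obtain ⟨A, hA, hAW⟩ := ih hsQ.2
    have hcr := hQ c hsQ.1
    let used : Finset V := (s ×ˢ (Finset.univ : Finset (Fin t))).image fun p => A p.1 p.2
    have husedc : used.card + t ≤ Q.card * t := by
      have h1 : used.card ≤ s.card * t := by
        refine Finset.card_image_le.trans ?_
        simp
      have h2 : s.card + 1 ≤ Q.card := by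
        rw [← Finset.card_insert_of_notMem hc]
        exact Finset.card_le_card (Finset.insert_subset hsQ.1 hsQ.2)
      nlinarith
    let S : Finset V :=
      ((s.filter (· < c)) ×ˢ (Finset.univ : Finset (Fin t))).image fun p => A p.1 p.2
    have hSused : S ⊆ used :=
      Finset.image_subset_image (Finset.product_subset_product_left (Finset.filter_subset _ _))
    have hSD : S.card ≤ D := by
      refine le_trans (Finset.card_image_le.trans ?_) (hD c hsQ.1)
      rw [Finset.card_product, Finset.card_univ, Fintype.card_fin]
      exact Nat.mul_le_mul_right _ (Finset.card_le_card (Finset.filter_subset_filter _ hsQ.2))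
    have hcand : ∃ C ⊆ W (r - ρ c), b ≤ C.card ∧ ∀ v ∈ C, ∀ u ∈ S, u = v ∨ E u v := by
      rcases Nat.eq_zero_or_pos (ρ c) with h0 | h0
      · refine ⟨W r, by simp [h0], h.last, fun v _ u hu => ?_⟩
        obtain ⟨p, hp, -⟩ := Finset.mem_image.1 hu
        rw [Finset.mem_product, Finset.mem_filter] at hp
        have := hρ _ (hsQ.2 hp.1.1) _ hsQ.1 hp.1.2
        omega
      · refine ⟨commonOut E (W (r - ρ c)) S, commonOut_subset _ _ _,
          h.common _ (by omega) S ?_ hSD, fun v hv => eq_or_of_mem_commonOut hv⟩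
        intro u hu
        obtain ⟨p, hp, rfl⟩ := Finset.mem_image.1 hu
        rw [Finset.mem_product, Finset.mem_filter] at hp
        have := hρ _ (hsQ.2 hp.1.1) _ hsQ.1 hp.1.2
        exact h.subset_of_le (by omega) (by omega) (hAW _ hp.1.1 _)
    obtain ⟨C, hCW, hbC, hCS⟩ := hcand
    -- At most `(Q.card - 1) * t` vertices are already used, so `hb` leaves `2 ^ t` candidates.
    obtain ⟨l, hlt, hl, hlE, hlC⟩ := exists_transitive E hE t (C \ used) (by
      have := Finset.le_card_sdiff used C
      omega)
    subst hlt
    have hlC' : ∀ i, l.get i ∈ C ∧ l.get i ∉ used := fun i =>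
      Finset.mem_sdiff.1 (hlC _ (List.get_mem _ _))
    have hold : ∀ c' ∈ s, Function.update A c l.get c' = A c' := fun c' hc' =>
      Function.update_of_ne (by rintro rfl; exact hc hc') _ _
    have hnew : Function.update A c l.get c = l.get := Function.update_self _ _ _
    have hmemused : ∀ c' ∈ s, ∀ i, A c' i ∈ used := fun c' hc' i =>
      Finset.mem_image.2 ⟨(c', i), by simp [hc'], rfl⟩
    refine ⟨Function.update A c l.get, ⟨?_, ?_, ?_⟩, ?_⟩
    · intro c₁ h₁ c₂ h₂ i j hij
      rcases Finset.mem_insert.1 h₁ with rfl | h₁' <;>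
        rcases Finset.mem_insert.1 h₂ with rfl | h₂'
      · rw [hnew] at hij
        exact ⟨rfl, hl.injective_get hij⟩
      · rw [hnew, hold _ h₂'] at hij
        exact absurd (hij ▸ hmemused _ h₂' j) (hlC' i).2
      · rw [hnew, hold _ h₁'] at hij
        exact absurd (hij ▸ hmemused _ h₁' i) (hlC' j).2
      · rw [hold _ h₁', hold _ h₂'] at hij
        exact hA.inj _ h₁' _ h₂' i j hij
    · intro c₁ h₁ i j hij
      rcases Finset.mem_insert.1 h₁ with rfl | h₁'
      · rw [hnew]
        exact List.pairwise_iff_get.1 hlE i j hij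
      · rw [hold _ h₁']
        exact hA.trans _ h₁' i j hij
    · intro c₁ h₁ c₂ h₂ hlt i j
      rcases Finset.mem_insert.1 h₁ with rfl | h₁' <;>
        rcases Finset.mem_insert.1 h₂ with rfl | h₂'
      · exact absurd hlt (lt_irrefl _)
      · exact absurd (hρ _ hsQ.1 _ (hsQ.2 h₂') hlt) (not_lt.2 (hmax _ h₂'))
      · rw [hnew, hold _ h₁']
        have hS : A c₁ i ∈ S :=
          Finset.mem_image.2 ⟨(c₁, i), by simp [h₁', hlt], rfl⟩
        refine (hCS _ (hlC' j).1 _ hS).resolve_left fun h => ?_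
        exact (hlC' j).2 (h ▸ hmemused _ h₁' i)
      · rw [hold _ h₁', hold _ h₂']
        exact hA.lt _ h₁' _ h₂' hlt i j
    · intro c₁ h₁ i
      rcases Finset.mem_insert.1 h₁ with rfl | h₁'
      · rw [hnew]
        exact hCW (hlC' i).1
      · rw [hold _ h₁']
        exact hAW _ h₁' i

/-- Few vertices can be placed in different clusters. -/
theorem exists_position_of_card_lt {V α β : Type*} [DecidableEq V] [DecidableEq α] [PartialOrder α]
    [DecidableEq β] (E : V → V → Prop) (t K X : ℕ) (ht : 0 < t) (hK : 0 < K)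
    (Q : β → Finset α) (I : Finset β)
    (hinc : ∀ q ∈ I, ∀ q' ∈ I, q ≠ q' → ∀ c ∈ Q q, ∀ c' ∈ Q q', ¬ c ≤ c')
    (hQK : ∀ q ∈ I, (Q q).card ≤ K) (U : Finset V) (hUX : U.card < X)
    (hU : K * t * X ≤ ∑ q ∈ I, (Q q).card * t) :
    ∃ pos : V → α × Fin t, (∀ u ∈ U, ∃ q ∈ I, (pos u).1 ∈ Q q) ∧
      ∀ u ∈ U, ∀ v ∈ U, u ≠ v → (pos u).1 ≤ (pos v).1 →
        ((pos u).1 = (pos v).1 → (pos u).2 ≤ (pos v).2) → E u v := by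
  classical
  let J : Finset β := I.filter fun q => (Q q).Nonempty
  have hXJ : X ≤ J.card := by
    have hsum : ∑ q ∈ I, (Q q).card * t = ∑ q ∈ J, (Q q).card * t := by
      rw [Finset.sum_filter]
      refine Finset.sum_congr rfl fun q' _ => ?_
      split_ifs with h
      · rfl
      · rw [Finset.not_nonempty_iff_eq_empty.1 h, Finset.card_empty, zero_mul]
    have hle : ∑ q ∈ J, (Q q).card * t ≤ J.card * (K * t) := by
      rw [← smul_eq_mul]
      exact Finset.sum_le_card_nsmul _ _ _ fun q hq =>
        Nat.mul_le_mul_right _ (hQK q (Finset.mem_filter.1 hq).1)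
    refine Nat.le_of_mul_le_mul_left ?_ (Nat.mul_pos hK ht)
    rw [mul_comm (K * t) J.card]
    omega
  obtain ⟨f⟩ : Nonempty (U ↪ J) := Function.Embedding.nonempty_of_card_le (by simp; omega)
  have hJ : ∀ q : J, ∃ c, c ∈ Q q := fun q => (Finset.mem_filter.1 q.2).2
  choose c hc using hJ
  obtain ⟨q₀, hq₀⟩ : J.Nonempty := Finset.card_pos.1 (by omega)
  have hI : ∀ q : J, (q : β) ∈ I := fun q => (Finset.mem_filter.1 q.2).1
  -- At most one vertex goes to each nonempty cluster. Different clusters are incomparable, so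
  -- nothing has to be checked.
  refine ⟨fun u => (if h : u ∈ U then c (f ⟨u, h⟩) else c ⟨q₀, hq₀⟩, ⟨0, ht⟩), ?_, ?_⟩
  · intro u hu
    refine ⟨f ⟨u, hu⟩, hI _, ?_⟩
    simp only [hu, dif_pos]
    exact hc _
  · intro u hu v hv huv hle
    simp only [hu, hv, dif_pos] at hle
    refine absurd hle (hinc _ (hI (f ⟨u, hu⟩)) _ (hI (f ⟨v, hv⟩)) (fun h => huv ?_)
      _ (hc _) _ (hc _))
    have := f.injective (Subtype.ext h)
    simpa using this

/-- Distribution of the vertices of a semicomplete digraph over pairwise incomparable clusters. -/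
theorem exists_position {V α β : Type*} [DecidableEq V] [DecidableEq α] [PartialOrder α]
    [DecidableEq β] (E : V → V → Prop) (t K X : ℕ) (ht : 0 < t) (hK : 0 < K) (hX : 0 < X)
    (Q : β → Finset α) (I : Finset β)
    (hinc : ∀ q ∈ I, ∀ q' ∈ I, q ≠ q' → ∀ c ∈ Q q, ∀ c' ∈ Q q', ¬ c ≤ c')
    (hQK : ∀ q ∈ I, (Q q).card ≤ K)
    (hplace : ∀ q ∈ I, ∀ U : Finset V, X ≤ U.card →
      ∃ A, IsPlacement E t (Q q) A ∧ ∀ c ∈ Q q, ∀ i, A c i ∈ U)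
    (U : Finset V) (hU : U.card + K * t * X ≤ ∑ q ∈ I, (Q q).card * t) :
    ∃ pos : V → α × Fin t, (∀ u ∈ U, ∃ q ∈ I, (pos u).1 ∈ Q q) ∧
      ∀ u ∈ U, ∀ v ∈ U, u ≠ v → (pos u).1 ≤ (pos v).1 →
        ((pos u).1 = (pos v).1 → (pos u).2 ≤ (pos v).2) → E u v := by
  have hKt : 0 < K * t := Nat.mul_pos hK ht
  have hKtX : 0 < K * t * X := Nat.mul_pos hKt hX
  induction I using Finset.induction generalizing U with
  | empty =>
    rw [Finset.sum_empty] at hU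
    omega
  | insert q I hq ih =>
    by_cases hUX : X ≤ U.card
    · obtain ⟨A, hA, hAU⟩ := hplace q (Finset.mem_insert_self _ _) U hUX
      let P : Finset V := (Q q ×ˢ (Finset.univ : Finset (Fin t))).image fun p => A p.1 p.2
      have hP : P.card = (Q q).card * t := by
        rw [Finset.card_image_of_injOn]
        · simp
        · rintro ⟨c, i⟩ hc ⟨c', j⟩ hc' hcc
          simp only [Finset.coe_product, Set.mem_prod, Finset.mem_coe] at hc hc'
          obtain ⟨rfl, rfl⟩ := hA.inj c hc.1 c' hc'.1 i j hcc
          rfl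
      have hPU : P ⊆ U := by
        intro v hv
        obtain ⟨p, hp, rfl⟩ := Finset.mem_image.1 hv
        exact hAU _ (Finset.mem_product.1 hp).1 _
      have hc := Finset.card_sdiff_add_card_eq_card hPU
      rw [Finset.sum_insert hq] at hU
      obtain ⟨pos, hpos, hposE⟩ := ih
        (fun q₁ h₁ q₂ h₂ => hinc q₁ (Finset.mem_insert_of_mem h₁) q₂ (Finset.mem_insert_of_mem h₂))
        (fun q₁ h₁ => hQK q₁ (Finset.mem_insert_of_mem h₁))
        (fun q₁ h₁ => hplace q₁ (Finset.mem_insert_of_mem h₁)) (U \ P) (by omega)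
      classical
      let pos' : V → α × Fin t := fun u =>
        if h : ∃ p : α × Fin t, p.1 ∈ Q q ∧ A p.1 p.2 = u then h.choose else pos u
      have h1 : ∀ u ∈ P, (pos' u).1 ∈ Q q ∧ A (pos' u).1 (pos' u).2 = u := by
        intro u hu
        obtain ⟨p, hp, hpu⟩ := Finset.mem_image.1 hu
        have h : ∃ p : α × Fin t, p.1 ∈ Q q ∧ A p.1 p.2 = u :=
          ⟨p, (Finset.mem_product.1 hp).1, hpu⟩
        simp only [pos', dif_pos h]
        exact h.choose_spec
      have h2 : ∀ u ∈ U, u ∉ P → u ∈ U \ P ∧ pos' u = pos u := by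
        intro u hu huP
        refine ⟨Finset.mem_sdiff.2 ⟨hu, huP⟩, dif_neg ?_⟩
        rintro ⟨p, hp, hpu⟩
        exact huP (Finset.mem_image.2 ⟨p, by simp [hp], hpu⟩)
      have hne : ∀ q' ∈ I, q ≠ q' := fun q' hq' h => hq (h ▸ hq')
      refine ⟨pos', ?_, ?_⟩
      · intro u hu
        by_cases huP : u ∈ P
        · exact ⟨q, Finset.mem_insert_self _ _, (h1 u huP).1⟩
        · obtain ⟨h3, h4⟩ := h2 u hu huP
          obtain ⟨q', hq', h5⟩ := hpos u h3
          exact ⟨q', Finset.mem_insert_of_mem hq', h4 ▸ h5⟩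
      · intro u hu v hv huv hle hlast
        by_cases huP : u ∈ P <;> by_cases hvP : v ∈ P
        · obtain ⟨h3, h4⟩ := h1 u huP
          obtain ⟨h5, h6⟩ := h1 v hvP
          rw [← h4, ← h6]
          rcases hle.lt_or_eq with hlt | heq
          · exact hA.lt _ h3 _ h5 hlt _ _
          · have h7 := hlast heq
            rw [heq] at h3 h4 ⊢
            refine hA.trans _ h3 _ _ (lt_of_le_of_ne h7 fun h8 =>
              huv (h4.symm.trans ((congrArg _ h8).trans h6)))
        · obtain ⟨h3, -⟩ := h1 u huP
          obtain ⟨h5, h6⟩ := h2 v hv hvP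
          obtain ⟨q', hq', h7⟩ := hpos v h5
          exact absurd hle (hinc q (Finset.mem_insert_self _ _) q' (Finset.mem_insert_of_mem hq')
            (hne q' hq') _ h3 _ (h6 ▸ h7))
        · obtain ⟨h3, -⟩ := h1 v hvP
          obtain ⟨h5, h6⟩ := h2 u hu huP
          obtain ⟨q', hq', h7⟩ := hpos u h5
          exact absurd hle (hinc q' (Finset.mem_insert_of_mem hq') q (Finset.mem_insert_self _ _)
            (hne q' hq').symm _ (h6 ▸ h7) _ h3)
        · obtain ⟨h3, h4⟩ := h2 u hu huP
          obtain ⟨h5, h6⟩ := h2 v hv hvP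
          rw [h4, h6] at hle hlast
          exact hposE u h3 v h5 huv hle hlast
    -- The slack `K * t * X` in the capacity is reserved for this end game, when fewer than `X`
    -- vertices remain.
    · exact exists_position_of_card_lt E t K X ht hK Q _ hinc hQK U (by omega) (by omega)

/-- Raising the sum by one adds nothing or one of `k` unit vectors. This bounds the number of cells
of a window that lie below a given one. -/
theorem exists_finset_sum_le (k r : ℕ) :
    ∃ Z : Finset (Fin k → ℕ), Z.card ≤ (k + 1) ^ r ∧ ∀ z : Fin k → ℕ, ∑ i, z i ≤ r → z ∈ Z := by
  induction r with
  | zero =>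
    refine ⟨{0}, by simp, fun z hz => ?_⟩
    rw [Finset.mem_singleton]
    ext i
    have := Finset.single_le_sum (fun i _ => Nat.zero_le (z i)) (Finset.mem_univ i)
    simp only [Pi.zero_apply]
    omega
  | succ r ih =>
    obtain ⟨Z, hZ, hmem⟩ := ih
    refine ⟨Z ∪ Finset.univ.biUnion fun i => Z.image (· + Pi.single i 1), ?_, ?_⟩
    · have h1 : (Finset.univ.biUnion fun i : Fin k => Z.image (· + Pi.single i 1)).card ≤
          k * Z.card := by
        refine (Finset.card_biUnion_le_card_mul _ _ _ fun i _ => Finset.card_image_le).trans ?_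
        simp
      have h2 := Finset.card_union_le Z
        (Finset.univ.biUnion fun i : Fin k => Z.image (· + Pi.single i 1))
      have h3 := Nat.mul_le_mul_left (k + 1) hZ
      rw [pow_succ, mul_comm ((k + 1) ^ r)]
      nlinarith
    · intro z hz
      rw [Finset.mem_union]
      by_cases h : ∑ i, z i ≤ r
      · exact Or.inl (hmem z h)
      · right
        obtain ⟨i, -, hi⟩ : ∃ i ∈ Finset.univ, z i ≠ 0 :=
          Finset.exists_ne_zero_of_sum_ne_zero (by omega)
        refine Finset.mem_biUnion.2 ⟨i, Finset.mem_univ _, Finset.mem_image.2 ⟨z - Pi.single i 1,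
          hmem _ ?_, ?_⟩⟩
        · have h1 : ∑ j, (z - Pi.single i 1 : Fin k → ℕ) j + ∑ j, (Pi.single i 1 : Fin k → ℕ) j
              = ∑ j, z j := by
            rw [← Finset.sum_add_distrib]
            refine Finset.sum_congr rfl fun j _ => ?_
            rcases eq_or_ne j i with rfl | hj
            · simp only [Pi.sub_apply, Pi.single_eq_same]
              omega
            · simp [hj]
          rw [Finset.sum_pi_single' i 1 Finset.univ |>.trans (if_pos (Finset.mem_univ _))] at h1
          omega
        · ext j
          rcases eq_or_ne j i with rfl | hj
          · simp only [Pi.add_apply, Pi.sub_apply, Pi.single_eq_same]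
            omega
          · simp [hj]

/-- Residues modulo `R` which leave a gap of length `r`. -/
def gapRange (m R r : ℕ) : Finset ℕ := (Finset.range m).filter fun x => x % R < R - r

/-- The cells of a `k`-dimensional grid in consecutive layers `L, …, L + r`, with gaps. -/
def gridCells (k m R r L : ℕ) : Finset (Fin k → ℕ) :=
  (Fintype.piFinset fun _ => gapRange m R r).filter fun c => L ≤ ∑ i, c i ∧ ∑ i, c i ≤ L + r

theorem sub_le_of_mem_gridCells {k m R r L : ℕ} {c c' : Fin k → ℕ} (hc : c ∈ gridCells k m R r L)
    (hc' : c' ∈ gridCells k m R r L) (hle : c ≤ c') : ∑ i, (c' - c) i ≤ r := by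
  have h1 : ∑ i, (c' - c) i + ∑ i, c i = ∑ i, c' i := by
    rw [← Finset.sum_add_distrib]
    refine Finset.sum_congr rfl fun i _ => ?_
    have : c i ≤ c' i := hle i
    simp only [Pi.sub_apply]
    omega
  have h2 := (Finset.mem_filter.1 hc).2
  have h3 := (Finset.mem_filter.1 hc').2
  omega

/-- Comparable cells of a window differ by at most `r` in each coordinate, and a residue below `R -
r` cannot be carried over a multiple of `R`. So comparable cells share a block. -/
theorem div_eq_of_mem_gridCells {k m R r L : ℕ} {c c' : Fin k → ℕ} (hc : c ∈ gridCells k m R r L)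
    (hc' : c' ∈ gridCells k m R r L) (hle : c ≤ c') (i : Fin k) : c i / R = c' i / R := by
  have h1 := sub_le_of_mem_gridCells hc hc' hle
  have h2 := Finset.single_le_sum (fun i _ => Nat.zero_le ((c' - c) i)) (Finset.mem_univ i)
  have h3 := (Finset.mem_filter.1 (Fintype.mem_piFinset.1 (Finset.mem_filter.1 hc).1 i)).2
  have h4 : c i ≤ c' i := hle i
  simp only [Pi.sub_apply] at h2 h1
  have hR : 0 < R := by omega
  have h5 := Nat.div_add_mod (c i) R
  refine (Nat.div_eq_of_lt_le ?_ ?_).symm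
  · rw [mul_comm]
    omega
  · rw [Nat.succ_mul, mul_comm]
    omega

/-- Base `s` expansion is a linear extension of the product order; it lists the points of a cell in
the order of the transitive set filling it. -/
theorem fin_le_of_digits_le {k s : ℕ} (a b : Fin (s ^ k))
    (h : ∀ i, finFunctionFinEquiv.symm a i ≤ finFunctionFinEquiv.symm b i) : a ≤ b := by
  rw [← finFunctionFinEquiv.apply_symm_apply a, ← finFunctionFinEquiv.apply_symm_apply b,
    Fin.le_def, finFunctionFinEquiv_apply, finFunctionFinEquiv_apply]
  exact Finset.sum_le_sum fun i _ => Nat.mul_le_mul_right _ (h i)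

/-- A tournament whose large subsets contain hosts can be placed in a grid if there are enough
cells. -/
theorem Digraph.IsTournament.exists_edgeColouring_of_card_le {V : Type*} [Fintype V]
    [DecidableEq V] {T : Digraph V} (hT : T.IsTournament) {k n s m r R L b X : ℕ} (hs : 0 < s)
    (hsm : s * m ≤ n) (hr : r < R) (hX : 0 < X) (hb : 2 ^ s ^ k + R ^ k * s ^ k ≤ b + s ^ k)
    (hhost : ∀ U : Finset V, X ≤ U.card →
      ∃ W, W 0 = U ∧ IsHost T.Adj W r ((k + 1) ^ r * s ^ k) b)
    (hcard : Fintype.card V + R ^ k * s ^ k * X ≤ (gridCells k m R r L).card * s ^ k) :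
    ∃ c : T.EdgeColouring k, ¬ c.HasMonoPath n := by
  classical
  have hE : ∀ u v, u ≠ v → T.Adj u v ∨ T.Adj v u := fun u v huv => (hT.2 u v huv).or
  let block : (Fin k → ℕ) → Fin k → ℕ := fun c i => c i / R
  let S := gridCells k m R r L
  let Q : (Fin k → ℕ) → Finset (Fin k → ℕ) := fun q => S.filter fun c => block c = q
  have hQS : ∀ q, ∀ c ∈ Q q, c ∈ S ∧ block c = q := fun q c hc => Finset.mem_filter.1 hc
  have hQK : ∀ q ∈ S.image block, (Q q).card ≤ R ^ k := by
    intro q _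
    have h1 : (Fintype.piFinset fun _ : Fin k => Finset.range R).card = R ^ k := by simp
    rw [← h1]
    refine Finset.card_le_card_of_injOn (fun c i => c i % R) ?_ ?_
    · intro c _
      exact Finset.mem_coe.2 (Fintype.mem_piFinset.2 fun i =>
        Finset.mem_range.2 (Nat.mod_lt _ (by omega)))
    · intro c hc c' hc' hcc
      ext i
      have h2 := congrFun ((hQS q c hc).2.trans (hQS q c' hc').2.symm) i
      have h3 := congrFun hcc i
      simp only [block] at h2 h3
      rw [← Nat.div_add_mod (c i) R, ← Nat.div_add_mod (c' i) R, h2, h3]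
  have hsum : ∑ q ∈ S.image block, (Q q).card * s ^ k = S.card * s ^ k := by
    rw [← Finset.sum_mul, ← Finset.card_eq_sum_card_image]
  obtain ⟨pos, hpos, hposE⟩ := exists_position T.Adj (s ^ k) (R ^ k) X (pow_pos hs k)
    (pow_pos (by omega) k) hX Q (S.image block)
    (fun q _ q' _ hqq c hc c' hc' hle => by
      refine hqq ?_
      rw [← (hQS q c hc).2, ← (hQS q' c' hc').2]
      ext i
      exact div_eq_of_mem_gridCells (hQS q c hc).1 (hQS q' c' hc').1 hle i)
    hQK (fun q hq U hU => by
      obtain ⟨W, hW, hWh⟩ := hhost U hU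
      rw [← hW]
      refine hWh.exists_isPlacement hE (fun c => ∑ i, c i - L) (Q q) ?_ ?_ ?_ ?_
      · intro c hc c' hc' hlt
        obtain ⟨i, hi⟩ := (Pi.lt_def.1 hlt).2
        have h1 : ∑ i, c i < ∑ i, c' i :=
          Finset.sum_lt_sum (fun i _ => hlt.le i) ⟨i, Finset.mem_univ i, hi⟩
        have h2 := (Finset.mem_filter.1 (hQS q c hc).1).2
        omega
      · intro c hc
        have h2 := (Finset.mem_filter.1 (hQS q c hc).1).2
        omega
      · intro c hc
        obtain ⟨Z, hZ, hmem⟩ := exists_finset_sum_le k r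
        refine Nat.mul_le_mul_right _ (le_trans ?_ hZ)
        -- The cells below `c` are encoded by their differences from `c`, whose coordinate sums are
        -- at most `r`.
        refine Finset.card_le_card_of_injOn (fun c' => c - c') ?_ ?_
        · intro c' hc'
          have h3 := Finset.mem_filter.1 hc'
          exact hmem _ (sub_le_of_mem_gridCells (hQS q c' h3.1).1 (hQS q c hc).1 h3.2.le)
        · intro c₁ h₁ c₂ h₂ h₁₂
          have h3 := (Finset.mem_filter.1 h₁).2.le
          have h4 := (Finset.mem_filter.1 h₂).2.le
          ext i
          have h5 := congrFun h₁₂ i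
          have h6 : c₁ i ≤ c i := h3 i
          have h7 : c₂ i ≤ c i := h4 i
          simp only [Pi.sub_apply] at h5
          omega
      · have := Nat.mul_le_mul_right (s ^ k) (hQK q hq)
        omega) Finset.univ (by rw [hsum, Finset.card_univ]; exact hcard)
  have hcell : ∀ v i, (pos v).1 i < m := by
    intro v i
    obtain ⟨q, -, hq⟩ := hpos v (Finset.mem_univ v)
    exact Finset.mem_range.1 (Finset.mem_filter.1
      (Fintype.mem_piFinset.1 (Finset.mem_filter.1 (hQS q _ hq).1).1 i)).1
  let dig : V → Fin k → Fin s := fun v => finFunctionFinEquiv.symm (pos v).2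
  refine hT.exists_edgeColouring (fun v i => s * (pos v).1 i + dig v i) ?_ ?_
  · intro v i
    have h1 := hcell v i
    have h2 := (dig v i).2
    have h3 : s * ((pos v).1 i + 1) ≤ s * m := Nat.mul_le_mul_left _ h1
    rw [mul_add, mul_one] at h3
    omega
  · intro u v huv hle
    refine hposE u (Finset.mem_univ u) v (Finset.mem_univ v) huv (fun i => ?_) fun heq => ?_
    · by_contra hlt
      have h1 : s * ((pos v).1 i + 1) ≤ s * (pos u).1 i := Nat.mul_le_mul_left _ (not_le.1 hlt)
      have h2 := (dig v i).2
      have h3 := hle i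
      rw [mul_add, mul_one] at h1
      omega
    · refine fin_le_of_digits_le _ _ fun i => ?_
      have h3 := hle i
      rw [heq] at h3
      exact Fin.le_def.2 (Nat.le_of_add_le_add_left h3)

/-! ### Counting cells by a second moment -/

theorem sum_pi_sum_eq_zero {ι : Type*} [Fintype ι] (f : ι → ℝ) (hf : ∑ x, f x = 0) (k : ℕ) :
    ∑ y : Fin k → ι, ∑ i, f (y i) = 0 := by
  rw [Finset.sum_comm]
  refine Finset.sum_eq_zero fun i _ => ?_
  have h := Fintype.sum_equiv (Equiv.funSplitAt i ι) (fun y => f (y i)) (fun p => f p.1)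
    (fun y => rfl)
  rw [h, Fintype.sum_prod_type]
  simp [← Finset.mul_sum, hf]

/-- The second moment of a sum of independent centred variables, as a count. -/
theorem card_mul_sum_pi_sq {ι : Type*} [Fintype ι] (f : ι → ℝ) (hf : ∑ x, f x = 0) (k : ℕ) :
    (Fintype.card ι : ℝ) * ∑ y : Fin k → ι, (∑ i, f (y i)) ^ 2 =
      k * (Fintype.card ι : ℝ) ^ k * ∑ x, f x ^ 2 := by
  induction k with
  | zero => simp
  | succ k ih =>
    have h := Fintype.sum_equiv (Fin.consEquiv fun _ : Fin (k + 1) => ι).symm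
      (fun y => (∑ i, f (y i)) ^ 2) (fun p => (f p.1 + ∑ i, f (p.2 i)) ^ 2)
      (fun y => by rw [Fin.sum_univ_succ]; rfl)
    have h2 : ∀ x : ι, ∑ y : Fin k → ι, (f x + ∑ i, f (y i)) ^ 2 =
        (Fintype.card ι : ℝ) ^ k * f x ^ 2 + ∑ y : Fin k → ι, (∑ i, f (y i)) ^ 2 := by
      intro x
      simp only [add_sq, Finset.sum_add_distrib]
      rw [← Finset.mul_sum, sum_pi_sum_eq_zero f hf]
      simp
    rw [h, Fintype.sum_prod_type]
    simp only [h2, Finset.sum_add_distrib, ← Finset.mul_sum, Finset.sum_const, Finset.card_univ,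
      nsmul_eq_mul]
    rw [mul_add, ih]
    push_cast
    ring

/-- The odd numbers sum to squares: this is the layer-cake formula for `x ^ 2`, truncated at `lam`.
-/
theorem sum_two_mul_add_one_ite_le_sq (x : ℝ) (lam : ℕ) :
    ∑ d ∈ Finset.range lam, (if (d + 1 : ℝ) ≤ x then (2 * d + 1 : ℝ) else 0) ≤ x ^ 2 := by
  induction lam with
  | zero => simpa using sq_nonneg x
  | succ lam ih =>
    by_cases h : (lam + 1 : ℝ) ≤ x
    · have h1 : ∀ l : ℕ, ∑ d ∈ Finset.range l, (2 * d + 1 : ℝ) = l ^ 2 := by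
        intro l
        induction l with
        | zero => simp
        | succ l ihl =>
          rw [Finset.sum_range_succ, ihl]
          push_cast
          ring
      calc _ ≤ ∑ d ∈ Finset.range (lam + 1), (2 * d + 1 : ℝ) := by
            refine Finset.sum_le_sum fun d _ => ?_
            split_ifs
            · exact le_rfl
            · positivity
        _ = (lam + 1 : ℝ) ^ 2 := by
            rw [h1]
            push_cast
            rfl
        _ ≤ x ^ 2 := by gcongr
    · rw [Finset.sum_range_succ, if_neg h, add_zero]
      exact ih

/-- If all windows contain few values of `F`, few values are close to `μ`. -/
theorem card_abs_sub_lt_le {A : Type*} [Fintype A] (F : A → ℕ) (μ : ℝ) (r w d : ℕ)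
    (hw : ∀ L, (Finset.univ.filter fun a => L ≤ F a ∧ F a ≤ L + r).card ≤ w) :
    ((Finset.univ.filter fun a => |(F a : ℝ) - μ| < d).card : ℝ) ≤
      w * (2 * d / (r + 1 : ℝ) + 1) := by
  obtain ⟨L, hL⟩ : ∃ L, L = ⌈μ - d⌉₊ := ⟨_, rfl⟩
  have h := Finset.card_le_mul_card_image_of_maps_to
    (s := Finset.univ.filter fun a => |(F a : ℝ) - μ| < d)
    (t := Finset.range (2 * d / (r + 1) + 1)) (f := fun a => (F a - L) / (r + 1))
    (fun a ha => by
      have h1 := abs_lt.1 (Finset.mem_filter.1 ha).2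
      have h2 : (F a : ℝ) < L + 2 * d := by
        have := Nat.le_ceil (μ - d)
        rw [← hL] at this
        linarith
      have h3 : F a < L + 2 * d := by exact_mod_cast h2
      exact Finset.mem_range.2 (Nat.lt_succ_of_le (Nat.div_le_div_right (by omega)))) w
    (fun j _ => by
      refine le_trans (Finset.card_le_card fun a ha => ?_) (hw (L + j * (r + 1)))
      rw [Finset.mem_filter, Finset.mem_filter] at ha
      have h1 := abs_lt.1 ha.1.2
      have h2 : L ≤ F a := by
        rw [hL, Nat.ceil_le]
        linarith
      have h3 := Nat.div_add_mod (F a - L) (r + 1)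
      have h4 := Nat.mod_lt (F a - L) (Nat.succ_pos r)
      rw [ha.2, mul_comm] at h3
      rw [Nat.succ_eq_add_one] at h4
      exact Finset.mem_filter.2 ⟨Finset.mem_univ _, by omega, by omega⟩)
  rw [Finset.card_range] at h
  have h5 : ((2 * d / (r + 1) : ℕ) : ℝ) ≤ 2 * d / (r + 1 : ℝ) := by
    refine Nat.cast_div_le.trans (le_of_eq ?_)
    push_cast
    rfl
  calc _ ≤ ((w * (2 * d / (r + 1) + 1) : ℕ) : ℝ) := by exact_mod_cast h
    _ ≤ _ := by
      push_cast at h5 ⊢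
      gcongr

/-- If all windows contain few values of `F`, the second moment is large. -/
theorem sq_mul_card_le {A : Type*} [Fintype A] (F : A → ℕ) (μ : ℝ) (r w : ℕ)
    (hw : ∀ L, (Finset.univ.filter fun a => L ≤ F a ∧ F a ≤ L + r).card ≤ w) (lam : ℕ) :
    (lam : ℝ) ^ 2 * Fintype.card A ≤ ∑ a, ((F a : ℝ) - μ) ^ 2 +
      w * ((4 / 3 * (lam : ℝ) ^ 3 + lam ^ 2) / (r + 1 : ℝ) + lam ^ 2) := by
  have h1 : ∑ d ∈ Finset.range lam, (2 * d + 1 : ℝ) *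
      ((Finset.univ.filter fun a => (d + 1 : ℝ) ≤ |(F a : ℝ) - μ|).card : ℝ) ≤
      ∑ a, ((F a : ℝ) - μ) ^ 2 := by
    calc _ = ∑ a, ∑ d ∈ Finset.range lam,
          (if (d + 1 : ℝ) ≤ |(F a : ℝ) - μ| then (2 * d + 1 : ℝ) else 0) := by
          rw [Finset.sum_comm]
          refine Finset.sum_congr rfl fun d _ => ?_
          rw [← Finset.sum_filter, Finset.sum_const, nsmul_eq_mul, mul_comm]
      _ ≤ ∑ a, |(F a : ℝ) - μ| ^ 2 :=
          Finset.sum_le_sum fun a _ => sum_two_mul_add_one_ite_le_sq _ lam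
      _ = _ := by simp only [sq_abs]
  have h2 : ∀ d : ℕ, (Fintype.card A : ℝ) ≤
      ((Finset.univ.filter fun a => (d + 1 : ℝ) ≤ |(F a : ℝ) - μ|).card : ℝ) +
      w * (2 * (d + 1) / (r + 1 : ℝ) + 1) := by
    intro d
    have h3 := card_abs_sub_lt_le F μ r w (d + 1) hw
    have h4 := Finset.card_filter_add_card_filter_not (s := (Finset.univ : Finset A))
      (fun a => (d + 1 : ℝ) ≤ |(F a : ℝ) - μ|)
    simp only [not_le] at h4
    rw [Finset.card_univ] at h4
    push_cast at h3
    have h5 : (Fintype.card A : ℝ) =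
      ((Finset.univ.filter fun a => (d + 1 : ℝ) ≤ |(F a : ℝ) - μ|).card : ℝ) +
      ((Finset.univ.filter fun a => |(F a : ℝ) - μ| < (d + 1 : ℝ)).card : ℝ) := by
      exact_mod_cast h4.symm
    linarith
  have h3 : ∀ l : ℕ, ∑ d ∈ Finset.range l, (2 * d + 1 : ℝ) * (Fintype.card A : ℝ)
      = (l : ℝ) ^ 2 * Fintype.card A := by
    intro l
    induction l with
    | zero => simp
    | succ l ihl =>
      rw [Finset.sum_range_succ, ihl]
      push_cast
      ring
  have h4 : ∀ l : ℕ, ∑ d ∈ Finset.range l,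
      (2 * d + 1 : ℝ) * (w * (2 * (d + 1) / (r + 1 : ℝ) + 1)) =
      w * ((4 / 3 * (l : ℝ) ^ 3 + l ^ 2 - l / 3) / (r + 1 : ℝ) + l ^ 2) := by
    intro l
    induction l with
    | zero => simp
    | succ l ihl =>
      rw [Finset.sum_range_succ, ihl]
      push_cast
      field_simp
      ring
  calc (lam : ℝ) ^ 2 * Fintype.card A
      = ∑ d ∈ Finset.range lam, (2 * d + 1 : ℝ) * (Fintype.card A : ℝ) := (h3 lam).symm
    _ ≤ ∑ d ∈ Finset.range lam, ((2 * d + 1 : ℝ) *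
        ((Finset.univ.filter fun a => (d + 1 : ℝ) ≤ |(F a : ℝ) - μ|).card : ℝ) +
        (2 * d + 1 : ℝ) * (w * (2 * (d + 1) / (r + 1 : ℝ) + 1))) := by
        refine Finset.sum_le_sum fun d _ => ?_
        rw [← mul_add]
        exact mul_le_mul_of_nonneg_left (h2 d) (by positivity)
    _ ≤ ∑ a, ((F a : ℝ) - μ) ^ 2 +
        w * ((4 / 3 * (lam : ℝ) ^ 3 + lam ^ 2 - lam / 3) / (r + 1 : ℝ) + lam ^ 2) := by
        rw [Finset.sum_add_distrib, h4]
        gcongr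
    _ ≤ _ := by
        gcongr
        linarith [show (0 : ℝ) ≤ lam / 3 by positivity]

theorem sum_range_sub_sq (m : ℕ) :
    ∑ x ∈ Finset.range m, ((x : ℝ) - (m - 1) / 2) ^ 2 = ((m : ℝ) ^ 3 - m) / 12 := by
  have h : ∀ (c : ℝ) (l : ℕ), ∑ x ∈ Finset.range l, ((x : ℝ) - c) ^ 2 =
      (2 * (l : ℝ) ^ 3 - 3 * l ^ 2 + l) / 6 - c * (l ^ 2 - l) + c ^ 2 * l := by
    intro c l
    induction l with
    | zero => simp
    | succ l ih =>
      rw [Finset.sum_range_succ, ih]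
      push_cast
      ring
  rw [h]
  ring

/-- The sum of squared deviations from the mean is minimal. -/
theorem exists_sum_sub_eq_zero (X : Finset ℕ) (c' : ℝ) :
    ∃ c : ℝ, ∑ x ∈ X, ((x : ℝ) - c) = 0 ∧
      ∑ x ∈ X, ((x : ℝ) - c) ^ 2 ≤ ∑ x ∈ X, ((x : ℝ) - c') ^ 2 := by
  rcases X.eq_empty_or_nonempty with rfl | hX
  · exact ⟨0, by simp⟩
  have hp : (0 : ℝ) < X.card := by exact_mod_cast Finset.card_pos.2 hX
  obtain ⟨c, hc⟩ : ∃ c, c = (∑ x ∈ X, (x : ℝ)) / X.card := ⟨_, rfl⟩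
  have h0 : ∑ x ∈ X, ((x : ℝ) - c) = 0 := by
    rw [Finset.sum_sub_distrib, Finset.sum_const, nsmul_eq_mul, hc]
    field_simp
    ring
  refine ⟨c, h0, ?_⟩
  have h1 : ∑ x ∈ X, ((x : ℝ) - c') ^ 2 = ∑ x ∈ X, ((x : ℝ) - c) ^ 2
      + 2 * (c - c') * ∑ x ∈ X, ((x : ℝ) - c) + X.card * (c - c') ^ 2 := by
    rw [Finset.mul_sum, ← nsmul_eq_mul, ← Finset.sum_const, ← Finset.sum_add_distrib,
      ← Finset.sum_add_distrib]
    exact Finset.sum_congr rfl fun x _ => by ring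
  rw [h1, h0]
  nlinarith [sq_nonneg (c - c')]

theorem div_mul_le_card_gapRange (m R r : ℕ) : m / R * (R - r) ≤ (gapRange m R r).card := by
  have h : (Finset.range (m / R) ×ˢ Finset.range (R - r)).card = m / R * (R - r) := by simp
  rw [← h]
  refine Finset.card_le_card_of_injOn (fun p => R * p.1 + p.2) ?_ ?_
  · rintro ⟨q, j⟩ hp
    simp only [Finset.coe_product, Finset.coe_range, Set.mem_prod, Set.mem_Iio] at hp
    have h1 : R * (q + 1) ≤ R * (m / R) := Nat.mul_le_mul_left _ hp.1
    have h2 := Nat.mul_div_le m R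
    refine Finset.mem_coe.2 (Finset.mem_filter.2 ⟨Finset.mem_range.2 ?_, ?_⟩)
    · dsimp only
      rw [mul_add, mul_one] at h1
      omega
    · dsimp only
      rw [Nat.mul_add_mod, Nat.mod_eq_of_lt (by omega)]
      exact hp.2
  · rintro ⟨q, j⟩ hp ⟨q', j'⟩ hp' h
    simp only [Finset.coe_product, Finset.coe_range, Set.mem_prod, Set.mem_Iio] at hp hp'
    dsimp only at h
    have hR : 0 < R := by omega
    have h1 := congrArg (· / R) h
    have h2 := congrArg (· % R) h
    simp only [Nat.mul_add_mod, Nat.mul_add_div hR, Nat.mod_eq_of_lt (show j < R by omega),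
      Nat.mod_eq_of_lt (show j' < R by omega), Nat.div_eq_of_lt (show j < R by omega),
      Nat.div_eq_of_lt (show j' < R by omega), add_zero] at h1 h2
    rw [h1, h2]

theorem exists_gridCells_max (k m R r : ℕ) :
    ∃ L, ∀ L', (gridCells k m R r L').card ≤ (gridCells k m R r L).card := by
  have hbdd : BddAbove (Set.range fun L => (gridCells k m R r L).card) := by
    refine ⟨(Fintype.piFinset fun _ : Fin k => gapRange m R r).card, ?_⟩
    rintro _ ⟨L, rfl⟩
    exact Finset.card_filter_le _ _
  obtain ⟨L, hL⟩ := Nat.sSup_mem (Set.range_nonempty _) hbdd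
  exact ⟨L, fun L' => (le_csSup hbdd ⟨L', rfl⟩).trans hL.ge⟩

/-- A lower bound for the number of cells in the best window of layers. -/
theorem exists_gridCells_card (k m R r : ℕ) : ∃ L, ∀ lam : ℕ,
    (lam : ℝ) ^ 2 * (gapRange m R r).card ^ k ≤ k * (m : ℝ) ^ (k + 2) / 12 +
      (gridCells k m R r L).card *
        ((4 / 3 * (lam : ℝ) ^ 3 + lam ^ 2) / (r + 1 : ℝ) + lam ^ 2) := by
  obtain ⟨L, hL⟩ := exists_gridCells_max k m R r
  refine ⟨L, fun lam => ?_⟩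
  obtain ⟨X, hX⟩ : ∃ X, X = gapRange m R r := ⟨_, rfl⟩
  have hXm : X ⊆ Finset.range m := hX ▸ Finset.filter_subset _ _
  -- The second moment identity needs centred summands, so the true mean of `X` is used. By
  -- minimality the deviation is at most that from the midpoint of the full range.
  obtain ⟨c, hc, hcle⟩ := exists_sum_sub_eq_zero X ((m - 1) / 2)
  have hQ : ∑ x ∈ X, ((x : ℝ) - c) ^ 2 ≤ (m : ℝ) ^ 3 / 12 := by
    refine hcle.trans ((Finset.sum_le_sum_of_subset_of_nonneg hXm
      fun _ _ _ => sq_nonneg _).trans ?_)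
    rw [sum_range_sub_sq]
    linarith [show (0 : ℝ) ≤ m by positivity]
  have hpm : (X.card : ℝ) ≤ m := by
    have := Finset.card_le_card hXm
    rw [Finset.card_range] at this
    exact_mod_cast this
  have hw : ∀ L', (Finset.univ.filter fun y : Fin k → X =>
      L' ≤ ∑ i, (y i : ℕ) ∧ ∑ i, (y i : ℕ) ≤ L' + r).card ≤ (gridCells k m R r L).card := by
    intro L'
    refine le_trans ?_ (hL L')
    refine Finset.card_le_card_of_injOn (fun y i => (y i : ℕ)) ?_ ?_
    · intro y hy
      refine Finset.mem_coe.2 (Finset.mem_filter.2 ⟨Fintype.mem_piFinset.2 fun i => ?_,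
        (Finset.mem_filter.1 hy).2⟩)
      rw [← hX]
      exact (y i).2
    · intro y _ y' _ h
      ext i
      exact congrFun h i
  have h1 := sq_mul_card_le (fun y : Fin k → X => ∑ i, (y i : ℕ)) (k * c) r _ hw lam
  have h2 := card_mul_sum_pi_sq (fun x : X => ((x : ℕ) : ℝ) - c)
    (by rw [← hc]; exact Finset.sum_coe_sort X fun x => ((x : ℝ) - c)) k
  rw [Finset.sum_coe_sort X fun x => ((x : ℝ) - c) ^ 2] at h2
  simp only [Finset.sum_sub_distrib, Finset.sum_const, Finset.card_univ, Fintype.card_fin,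
    nsmul_eq_mul, Fintype.card_coe] at h2
  simp only [Fintype.card_pi, Fintype.card_coe, Finset.prod_const, Finset.card_univ,
    Fintype.card_fin, Nat.cast_pow, Nat.cast_sum] at h1
  rw [← hX]
  refine h1.trans ?_
  gcongr
  rcases X.eq_empty_or_nonempty with hX0 | hX0
  · rcases Nat.eq_zero_or_pos k with rfl | hk
    · simp
    · have : IsEmpty (Fin k → X) := by
        rw [isEmpty_pi]
        exact ⟨⟨0, hk⟩, Finset.isEmpty_coe_sort.2 hX0⟩
      simp
      positivity
  · have hp : (0 : ℝ) < X.card := by exact_mod_cast Finset.card_pos.2 hX0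
    refine le_of_mul_le_mul_left ?_ hp
    rw [h2]
    rcases Nat.eq_zero_or_pos k with rfl | hk
    · simp
    obtain ⟨j, rfl⟩ := Nat.exists_eq_add_of_lt hk
    rw [zero_add]
    calc (((j + 1 : ℕ)) : ℝ) * (X.card : ℝ) ^ (j + 1) * ∑ x ∈ X, ((x : ℝ) - c) ^ 2
        ≤ ((j + 1 : ℕ) : ℝ) * (X.card : ℝ) ^ (j + 1) * ((m : ℝ) ^ 3 / 12) := by gcongr
      _ = X.card * (((j + 1 : ℕ) : ℝ) * ((X.card : ℝ) ^ j * (m : ℝ) ^ 3) / 12) := by ring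
      _ ≤ X.card * (((j + 1 : ℕ) : ℝ) * ((m : ℝ) ^ j * (m : ℝ) ^ 3) / 12) := by gcongr
      _ = _ := by ring

/-- The best window of layers in a large grid. -/
theorem eventually_exists_gridCells_card {k r R : ℕ} (hk : 0 < k) (hR : r < R) {η : ℝ}
    (hη : η < (r + 1) / Real.sqrt k * ((3 * (((R : ℝ) - r) / R) ^ k - 1) / 2)) :
    ∀ᶠ m : ℕ in atTop, ∃ L, η * (m : ℝ) ^ (k - 1) ≤ (gridCells k m R r L).card := by
  have hk' : (0 : ℝ) < k := by exact_mod_cast hk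
  have hR' : (0 : ℝ) < R := by exact_mod_cast (Nat.zero_le r).trans_lt hR
  have hrR : (r : ℝ) < R := by exact_mod_cast hR
  obtain ⟨q, hq⟩ : ∃ q, q = Real.sqrt k := ⟨_, rfl⟩
  have hq0 : 0 < q := hq ▸ Real.sqrt_pos.2 hk'
  have hqk : (k : ℝ) = q ^ 2 := by rw [hq, Real.sq_sqrt hk'.le]
  obtain ⟨ρ, hρ⟩ : ∃ ρ, ρ = ((R : ℝ) - r) / R := ⟨_, rfl⟩
  have hρ0 : 0 < ρ := hρ ▸ div_pos (by linarith) hR'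
  rw [← hq, ← hρ] at hη
  -- The choice `√k / 2 * m` is half the length of an interval whose uniform distribution has
  -- variance `k * m ^ 2 / 12`. Without gaps it is optimal and gives the constant `(r + 1) / √k`.
  let lam : ℕ → ℕ := fun m => ⌊q / 2 * (m : ℝ)⌋₊
  let x : ℕ → ℝ := fun m => (lam m : ℝ) / m
  let y : ℕ → ℝ := fun m => ρ - R / m
  let G : ℕ → ℝ := fun m => ((4 / 3 * x m ^ 3 + x m ^ 2 * (1 / m)) / (r + 1 : ℝ) +
    x m ^ 2 * (1 / m))
  have hx : Tendsto x atTop (𝓝 (q / 2)) :=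
    (tendsto_nat_floor_mul_div_atTop (by positivity)).comp tendsto_natCast_atTop_atTop
  have hinv : Tendsto (fun m : ℕ => (1 : ℝ) / m) atTop (𝓝 0) :=
    tendsto_one_div_atTop_nhds_zero_nat
  have hy : Tendsto y atTop (𝓝 ρ) := by
    have := (tendsto_const_nhds (x := ρ)).sub (hinv.const_mul (R : ℝ))
    simpa [y, div_eq_mul_inv] using this
  have hG : Tendsto G atTop (𝓝 ((4 / 3 * (q / 2) ^ 3 + (q / 2) ^ 2 * 0) / (r + 1 : ℝ) +
      (q / 2) ^ 2 * 0)) :=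
    ((((hx.pow 3).const_mul _).add ((hx.pow 2).mul hinv)).div_const _).add ((hx.pow 2).mul hinv)
  have heq : ∀ (a : ℝ) (j : ℕ), (r + 1) / q * ((3 * a ^ j - 1) / 2) =
      ((q / 2) ^ 2 * a ^ j - k / 12) /
      ((4 / 3 * (q / 2) ^ 3 + (q / 2) ^ 2 * 0) / (r + 1 : ℝ) + (q / 2) ^ 2 * 0) := by
    intro a j
    generalize a ^ j = b
    rw [hqk, mul_zero, add_zero, add_zero]
    field_simp
    ring
  have hlim : Tendsto (fun m => (x m ^ 2 * y m ^ k - k / 12) / G m) atTop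
      (𝓝 ((r + 1) / q * ((3 * ρ ^ k - 1) / 2))) := by
    have := (((hx.pow 2).mul (hy.pow k)).sub (tendsto_const_nhds (x := (k : ℝ) / 12))).div hG
      (by positivity)
    rw [heq ρ k]
    exact this
  filter_upwards [hlim.eventually_const_lt hη, hG.eventually_const_lt
    (show 0 < (4 / 3 * (q / 2) ^ 3 + (q / 2) ^ 2 * 0) / (r + 1 : ℝ) + (q / 2) ^ 2 * 0 by
      positivity),
    hy.eventually_const_lt hρ0, eventually_gt_atTop 0] with m h1 h2 h3 h4
  obtain ⟨L, hL⟩ := exists_gridCells_card k m R r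
  have hm : (0 : ℝ) < m := by exact_mod_cast h4
  refine ⟨L, ?_⟩
  have h5 := hL (lam m)
  have hlam : (lam m : ℝ) = x m * m := by
    simp only [x]
    field_simp
  have hp : y m * m ≤ (gapRange m R r).card := by
    have h6 := div_mul_le_card_gapRange m R r
    have h7 : (m : ℝ) / R - 1 ≤ ((m / R : ℕ) : ℝ) := by
      have h8 := Nat.lt_div_mul_add (a := m) (b := R) (by omega)
      have h9 : (m : ℝ) ≤ ((m / R : ℕ) : ℝ) * R + R := by exact_mod_cast h8.le
      rw [sub_le_iff_le_add, div_le_iff₀ hR']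
      linarith
    have h10 : (((m / R * (R - r) : ℕ)) : ℝ) ≤ (gapRange m R r).card := by exact_mod_cast h6
    rw [Nat.cast_mul, Nat.cast_sub hR.le] at h10
    refine le_trans ?_ h10
    calc y m * m = (m / R) * (R - r) - R := by
          simp only [y, hρ]
          field_simp
      _ ≤ (m / R - 1) * (R - r) := by
          have : (0 : ℝ) ≤ r := by positivity
          linarith
      _ ≤ _ := mul_le_mul_of_nonneg_right h7 (by linarith)
  have h6 : (x m * m) ^ 2 * (y m * m) ^ k ≤ (lam m : ℝ) ^ 2 * (gapRange m R r).card ^ k := by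
    rw [hlam]
    gcongr
  have h7 : (4 / 3 * (lam m : ℝ) ^ 3 + lam m ^ 2) / (r + 1 : ℝ) + lam m ^ 2 =
      (m : ℝ) ^ 3 * G m := by
    rw [hlam]
    simp only [G]
    field_simp
  have h8 := h6.trans h5
  rw [h7] at h8
  have hmk : (m : ℝ) ^ k = m ^ (k - 1) * m := by
    rw [← pow_succ, Nat.sub_add_cancel hk]
  have h9 : (m : ℝ) ^ 3 * ((m : ℝ) ^ (k - 1) * (x m ^ 2 * y m ^ k - k / 12)) ≤
      (m : ℝ) ^ 3 * ((gridCells k m R r L).card * G m) := by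
    rw [pow_add, mul_pow, mul_pow, hmk] at h8
    linarith
  have h10 := le_of_mul_le_mul_left h9 (by positivity)
  rw [lt_div_iff₀ h2] at h1
  have h11 : η * (m : ℝ) ^ (k - 1) * G m ≤ (gridCells k m R r L).card * G m :=
    calc η * (m : ℝ) ^ (k - 1) * G m = (m : ℝ) ^ (k - 1) * (η * G m) := by ring
      _ ≤ (m : ℝ) ^ (k - 1) * (x m ^ 2 * y m ^ k - k / 12) := by gcongr
      _ ≤ _ := h10
  exact le_of_mul_le_mul_right h11 h2

/-! ### Parameters and conclusion of the lower bound -/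

/-- Raising to the power `2 * k` removes both roots and leaves an inequality between natural
numbers. -/
theorem half_lt_of_pow_lt {k r D : ℕ} (hk : 2 ≤ k) (hD : 0 < D)
    (h : k ^ k * D ^ 2 < (2 * (r + 1)) ^ (2 * k) * (k - 1) ^ 2) :
    (1 : ℝ) / 2 < (r + 1) / Real.sqrt k * (((k : ℝ) - 1) / D) ^ (1 / (k : ℝ)) := by
  have hk' : (2 : ℝ) ≤ k := by exact_mod_cast hk
  have hD' : (0 : ℝ) < D := by exact_mod_cast hD
  have hA : 0 < ((k : ℝ) - 1) / D := div_pos (by linarith) hD'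
  refine lt_of_pow_lt_pow_left₀ (2 * k) (by positivity) ?_
  have h1 : (((((k : ℝ) - 1) / D) ^ (1 / (k : ℝ))) ^ (2 * k)) = (((k : ℝ) - 1) / D) ^ 2 := by
    rw [mul_comm, pow_mul, one_div, Real.rpow_inv_natCast_pow hA.le (by omega)]
  have h2 : Real.sqrt k ^ (2 * k) = (k : ℝ) ^ k := by
    rw [pow_mul, Real.sq_sqrt (by linarith)]
  have h3 : (k : ℝ) ^ k * D ^ 2 < (2 * (r + 1)) ^ (2 * k) * (k - 1) ^ 2 := by
    have : ((k ^ k * D ^ 2 : ℕ) : ℝ) < (((2 * (r + 1)) ^ (2 * k) * (k - 1) ^ 2 : ℕ) : ℝ) := by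
      exact_mod_cast h
    push_cast [Nat.cast_sub (show 1 ≤ k by omega)] at this
    exact this
  rw [mul_pow, div_pow, h1, div_pow, div_pow, h2, div_mul_div_comm, div_lt_div_iff₀ (by positivity)
    (by positivity), one_pow, one_mul]
  rw [mul_pow] at h3
  linarith

/-- The number of layers used in the construction. -/
theorem exists_layers {k : ℕ} (hk : 3 ≤ k) :
    ∃ r, 1 ≤ r ∧ k ^ k * (5 * r * (k + 1) ^ r) ^ 2 < (2 * (r + 1)) ^ (2 * k) * (k - 1) ^ 2 := by
  rcases le_or_gt k 11 with h11 | h11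
  · refine ⟨1, le_rfl, ?_⟩
    interval_cases k <;> norm_num
  rcases le_or_gt k 12 with h12 | h12
  · refine ⟨2, by norm_num, ?_⟩
    interval_cases k
    norm_num
  rcases le_or_gt k 16 with h16 | h16
  · refine ⟨3, by norm_num, ?_⟩
    interval_cases k <;> norm_num
  rcases le_or_gt k 25 with h25 | h25
  · refine ⟨4, by norm_num, ?_⟩
    interval_cases k <;> norm_num
  rcases le_or_gt k 36 with h36 | h36
  · refine ⟨5, by norm_num, ?_⟩
    interval_cases k <;> norm_num
  -- For `k ≥ 37` take `r = ⌊√(k - 1)⌋`. Then `(r + 1) ^ 2 ≥ k`, while `k + 1 ≤ 2 ^ r` and `r ^ 2 ≤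
  -- k - 1` give `(k + 1) ^ r ≤ 2 ^ (k - 1)`.
  obtain ⟨r, hr⟩ : ∃ r, r = Nat.sqrt (k - 1) := ⟨_, rfl⟩
  have hr6 : 6 ≤ r := hr ▸ Nat.le_sqrt.2 (by omega)
  have hr1 : r * r ≤ k - 1 := hr ▸ Nat.sqrt_le _
  have hr2 : k ≤ (r + 1) ^ 2 := by
    have := Nat.lt_succ_sqrt (k - 1)
    rw [← hr, Nat.succ_eq_add_one, ← sq] at this
    omega
  have h2r : k + 1 ≤ 2 ^ r := by
    have : ∀ r, 6 ≤ r → (r + 1) ^ 2 + 1 ≤ 2 ^ r := by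
      intro r hr
      induction r, hr using Nat.le_induction with
      | base => norm_num
      | succ r hr ih =>
        rw [pow_succ 2]
        nlinarith
    exact (Nat.add_le_add_right hr2 1).trans (this r hr6)
  have h3 : (k + 1) ^ r ≤ 2 ^ (k - 1) :=
    calc (k + 1) ^ r ≤ (2 ^ r) ^ r := Nat.pow_le_pow_left h2r r
      _ = 2 ^ (r * r) := (pow_mul 2 r r).symm
      _ ≤ 2 ^ (k - 1) := Nat.pow_le_pow_right (by norm_num) hr1
  have h4 : 5 * r * (k + 1) ^ r < 2 ^ k * (k - 1) := by
    have h5 : 5 * r ≤ k - 1 := le_trans (by nlinarith) hr1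
    have h6 : 2 ^ k = 2 ^ (k - 1) * 2 := by rw [← pow_succ, Nat.sub_add_cancel (by omega)]
    have h7 : 0 < 2 ^ (k - 1) * (k - 1) := Nat.mul_pos (Nat.two_pow_pos _) (by omega)
    calc 5 * r * (k + 1) ^ r ≤ (k - 1) * 2 ^ (k - 1) := Nat.mul_le_mul h5 h3
      _ < 2 ^ k * (k - 1) := by
        rw [h6]
        linarith
  refine ⟨r, by omega, ?_⟩
  calc k ^ k * (5 * r * (k + 1) ^ r) ^ 2 < ((r + 1) ^ 2) ^ k * (2 ^ k * (k - 1)) ^ 2 :=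
        Nat.mul_lt_mul_of_le_of_lt (Nat.pow_le_pow_left hr2 k)
          (Nat.pow_lt_pow_left h4 (by norm_num)) (by positivity)
    _ = (2 * (r + 1)) ^ (2 * k) * (k - 1) ^ 2 := by
        rw [mul_pow 2, ← pow_mul]
        ring

theorem tendsto_logb_natCast_atTop : Tendsto (fun n : ℕ => Real.logb 2 (n : ℝ)) atTop atTop :=
  (Real.tendsto_logb_atTop (by norm_num)).comp tendsto_natCast_atTop_atTop

theorem tendsto_logb_div_rpow {β : ℝ} (hβ : 0 < β) :
    Tendsto (fun n : ℕ => Real.logb 2 (n : ℝ) / (n : ℝ) ^ β) atTop (𝓝 0) := by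
  have h := ((isLittleO_log_rpow_atTop hβ).tendsto_div_nhds_zero.comp
    tendsto_natCast_atTop_atTop).div_const (Real.log 2)
  rw [zero_div] at h
  refine h.congr fun n => ?_
  simp only [Function.comp_apply, Real.logb]
  ring

/-- The lower bound, for parameters for which hosts exist. -/
theorem eventually_exists_edgeColouring {k r R a C : ℕ} (hk : 2 ≤ k) (hR : r < R) {κ : ℝ}
    (hκ : 0 < κ) (hC : 0 < C) (haκ : a * κ < k - 1) (b : ℕ → ℕ)
    (hb : ∀ᶠ t : ℕ in atTop, 2 ^ t + R ^ k * t ≤ b t + t)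
    (hhost : ∀ t, 0 < t → ∀ (N : ℕ) (T : Digraph (Fin N)), T.IsTournament →
      ∀ U : Finset (Fin N), C * 2 ^ (a * t) ≤ U.card →
        ∃ W, W 0 = U ∧ IsHost T.Adj W r ((k + 1) ^ r * t) (b t))
    (hθ : 1 / 2 < (r + 1) / Real.sqrt k * ((3 * (((R : ℝ) - r) / R) ^ k - 1) / 2) *
      κ ^ (1 / (k : ℝ))) :
    ∀ᶠ n : ℕ in atTop, ∀ N : ℕ,
      (N : ℝ) ≤ 1 / 2 * (n : ℝ) ^ (k - 1) * Real.logb 2 (n : ℝ) ^ (1 / (k : ℝ)) →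
      ∀ T : Digraph (Fin N), T.IsTournament →
        ∃ c : T.EdgeColouring k, ¬ c.HasMonoPath n := by
  have hk0 : (0 : ℝ) < k := by exact_mod_cast (by omega : 0 < k)
  obtain ⟨γ, hγ⟩ : ∃ γ, γ = κ ^ (1 / (k : ℝ)) := ⟨_, rfl⟩
  have hγ0 : 0 < γ := hγ ▸ Real.rpow_pos_of_pos hκ _
  have hγk : γ ^ k = κ := by
    rw [hγ, one_div, Real.rpow_inv_natCast_pow hκ.le (by omega)]
  rw [← hγ, ← div_lt_iff₀ hγ0] at hθ
  obtain ⟨η, hη1, hη2⟩ := exists_between hθ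
  have hη0 : 0 < η := lt_trans (by positivity) hη1
  rw [div_lt_iff₀ hγ0] at hη1
  obtain ⟨δ, hδ⟩ : ∃ δ, δ = (η * γ - 1 / 2) / 2 := ⟨_, rfl⟩
  have hδ0 : 0 < δ := by linarith
  let z : ℕ → ℝ := fun n => Real.logb 2 (n : ℝ) ^ (1 / (k : ℝ))
  -- The side of a cell, chosen so that `s n ^ k ≤ κ * log₂ n`.
  let s : ℕ → ℕ := fun n => ⌊γ * z n⌋₊
  have hz : Tendsto z atTop atTop :=
    (tendsto_rpow_atTop (by positivity)).comp tendsto_logb_natCast_atTop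
  have hs : Tendsto s atTop atTop := tendsto_nat_floor_atTop.comp (hz.const_mul_atTop hγ0)
  have hsz : Tendsto (fun n => (s n : ℝ) / z n) atTop (𝓝 γ) :=
    (tendsto_nat_floor_mul_div_atTop hγ0.le).comp hz
  have hL1 : ∀ᶠ n : ℕ in atTop, 1 ≤ Real.logb 2 (n : ℝ) :=
    tendsto_logb_natCast_atTop.eventually_ge_atTop 1
  have hsn : Tendsto (fun n : ℕ => (s n : ℝ) / n) atTop (𝓝 0) := by
    have h1 := (tendsto_logb_div_rpow one_pos).const_mul γ
    rw [mul_zero] at h1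
    refine squeeze_zero' (Eventually.of_forall fun n => by positivity) ?_ h1
    filter_upwards [hL1] with n hn
    rw [Real.rpow_one, ← mul_div_assoc]
    have h2 : (s n : ℝ) ≤ γ * z n := Nat.floor_le (by positivity)
    have h3 : z n ≤ Real.logb 2 n := by
      calc z n ≤ Real.logb 2 n ^ (1 : ℝ) :=
            Real.rpow_le_rpow_of_exponent_le hn ((div_le_one hk0).2 (by
              exact_mod_cast (by omega : 1 ≤ k)))
        _ = _ := Real.rpow_one _
    gcongr
    exact h2.trans (mul_le_mul_of_nonneg_left h3 hγ0.le)
  have hm : Tendsto (fun n : ℕ => n / s n) atTop atTop := by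
    refine tendsto_atTop.2 fun M => ?_
    filter_upwards [hsn.eventually_lt_const (show (0 : ℝ) < 1 / (M + 1) by positivity),
      hs.eventually_gt_atTop 0, eventually_gt_atTop 0] with n h1 h2 h3
    rw [Nat.le_div_iff_mul_le h2]
    have h4 : (0 : ℝ) < n := by exact_mod_cast h3
    rw [div_lt_div_iff₀ h4 (by positivity), one_mul] at h1
    have h5 : s n * (M + 1) < n := by exact_mod_cast h1
    nlinarith
  have hms : Tendsto (fun n : ℕ => ((n / s n : ℕ) : ℝ) * s n / n) atTop (𝓝 1) := by
    have h1 : Tendsto (fun n : ℕ => 1 - (s n : ℝ) / n) atTop (𝓝 1) := by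
      simpa using (tendsto_const_nhds (x := (1 : ℝ))).sub hsn
    refine tendsto_of_tendsto_of_tendsto_of_le_of_le' h1 tendsto_const_nhds ?_ ?_
    · filter_upwards [hs.eventually_gt_atTop 0, eventually_gt_atTop 0] with n h2 h3
      have h4 : (0 : ℝ) < n := by exact_mod_cast h3
      have h5 : (n : ℝ) ≤ ((n / s n : ℕ) : ℝ) * s n + s n := by
        exact_mod_cast (Nat.lt_div_mul_add (a := n) h2).le
      rw [le_div_iff₀ h4, sub_mul, div_mul_cancel₀ _ h4.ne']
      linarith
    · refine Eventually.of_forall fun n => div_le_one_of_le₀ ?_ (by positivity)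
      exact_mod_cast Nat.div_mul_le_self n (s n)
  have hmain : Tendsto (fun n : ℕ => η * (((n / s n : ℕ) : ℝ) * s n / n) ^ (k - 1) *
      ((s n : ℝ) / z n)) atTop (𝓝 (η * 1 ^ (k - 1) * γ)) :=
    ((hms.pow (k - 1)).const_mul η).mul hsz
  have herr := (tendsto_logb_div_rpow (show 0 < (k : ℝ) - 1 - a * κ by linarith)).const_mul
    ((R : ℝ) ^ k * κ * C)
  rw [mul_zero] at herr
  filter_upwards [hmain.eventually_const_lt
      (show 1 / 2 + δ < η * 1 ^ (k - 1) * γ by rw [one_pow]; linarith),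
    herr.eventually_lt_const hδ0, hL1, hz.eventually_ge_atTop 1, hs.eventually_gt_atTop 0,
    hm.eventually (eventually_exists_gridCells_card (by omega) hR hη2),
    ((tendsto_pow_atTop (by omega : k ≠ 0)).comp hs).eventually hb, eventually_gt_atTop 0]
    with n h1 h2 h3 h4 h5 h6 h7 h8 N hN T hT
  obtain ⟨L, hL⟩ := h6
  have hn0 : (0 : ℝ) < n := by exact_mod_cast h8
  have hs0 : (0 : ℝ) < s n := by exact_mod_cast h5
  have ht : 0 < s n ^ k := pow_pos h5 k
  refine hT.exists_edgeColouring_of_card_le (s := s n) (m := n / s n) (L := L)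
    (X := C * 2 ^ (a * s n ^ k)) h5 (Nat.mul_div_le n (s n)) hR (by positivity) h7
    (hhost _ ht N T hT) ?_
  rw [Fintype.card_fin]
  have hz0 : 0 < z n := by linarith
  have hzk : z n ^ k = Real.logb 2 n := by
    simp only [z]
    rw [one_div, Real.rpow_inv_natCast_pow (by linarith) (by omega)]
  have htL : (s n : ℝ) ^ k ≤ κ * Real.logb 2 n := by
    rw [← hzk, ← hγk, ← mul_pow]
    gcongr
    exact Nat.floor_le (by positivity)
  have hX : (2 : ℝ) ^ (a * s n ^ k) ≤ (n : ℝ) ^ (a * κ) := by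
    rw [← Real.rpow_natCast]
    calc (2 : ℝ) ^ ((a * s n ^ k : ℕ) : ℝ) ≤ 2 ^ (Real.logb 2 n * (a * κ)) := by
          refine Real.rpow_le_rpow_of_exponent_le (by norm_num) ?_
          push_cast
          calc (a : ℝ) * (s n : ℝ) ^ k ≤ a * (κ * Real.logb 2 n) := by gcongr
            _ = _ := by ring
      _ = _ := by
          rw [Real.rpow_mul (by norm_num), Real.rpow_logb (by norm_num) (by norm_num) hn0]
  have hB : 0 < (n : ℝ) ^ (k - 1) * z n := by positivity
  -- The reserved capacity is `O(n ^ (a * κ) * log n)`, which is negligible because `a * κ < k - 1`.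
  have hE : (R : ℝ) ^ k * (s n : ℝ) ^ k * (C * 2 ^ (a * s n ^ k)) ≤
      δ * ((n : ℝ) ^ (k - 1) * z n) := by
    have hpow : (n : ℝ) ^ (a * κ) * (n : ℝ) ^ ((k : ℝ) - 1 - a * κ) = (n : ℝ) ^ (k - 1) := by
      rw [← Real.rpow_add hn0, ← Real.rpow_natCast, Nat.cast_sub (by omega)]
      congr 1
      push_cast
      ring
    have hβ : 0 < (n : ℝ) ^ ((k : ℝ) - 1 - a * κ) := by positivity
    rw [← mul_div_assoc, div_lt_iff₀ hβ] at h2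
    calc (R : ℝ) ^ k * (s n : ℝ) ^ k * (C * 2 ^ (a * s n ^ k))
        ≤ (R : ℝ) ^ k * (κ * Real.logb 2 n) * (C * (n : ℝ) ^ (a * κ)) := by gcongr
      _ = (R : ℝ) ^ k * κ * C * Real.logb 2 n * (n : ℝ) ^ (a * κ) := by ring
      _ ≤ δ * (n : ℝ) ^ ((k : ℝ) - 1 - a * κ) * (n : ℝ) ^ (a * κ) := by gcongr
      _ = δ * ((n : ℝ) ^ (k - 1) * 1) := by
          rw [← hpow]
          ring
      _ ≤ _ := by gcongr
  have hcells : (1 / 2 + δ) * ((n : ℝ) ^ (k - 1) * z n) ≤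
      (gridCells k (n / s n) R r L).card * (s n : ℝ) ^ k := by
    have hsk : (s n : ℝ) ^ k = (s n : ℝ) ^ (k - 1) * s n := by
      rw [← pow_succ, Nat.sub_add_cancel (by omega)]
    calc _ ≤ η * (((n / s n : ℕ) : ℝ) * s n / n) ^ (k - 1) * ((s n : ℝ) / z n) *
          ((n : ℝ) ^ (k - 1) * z n) := by gcongr
      _ = η * ((n / s n : ℕ) : ℝ) ^ (k - 1) * (s n : ℝ) ^ k := by
          rw [div_pow, mul_pow, hsk]
          field_simp
      _ ≤ _ := by gcongr
  have hN' : (N : ℝ) ≤ 1 / 2 * ((n : ℝ) ^ (k - 1) * z n) := by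
    rw [← mul_assoc]
    exact hN
  have hfin : ((N + R ^ k * s n ^ k * (C * 2 ^ (a * s n ^ k)) : ℕ) : ℝ) ≤
      (((gridCells k (n / s n) R r L).card * s n ^ k : ℕ) : ℝ) := by
    push_cast
    linarith
  exact_mod_cast hfin

/-- For suitable `R` the loss from the gaps is negligible. -/
theorem exists_gap_ratio {x : ℝ} {y : ℝ} (hxy : y < x) (k r : ℕ) :
    ∃ R, r < R ∧ y < x * ((3 * (((R : ℝ) - r) / R) ^ k - 1) / 2) := by
  have h1 : Tendsto (fun R : ℕ => ((R : ℝ) - r) / R) atTop (𝓝 1) := by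
    have h2 := (tendsto_const_nhds (x := (1 : ℝ))).sub
      ((tendsto_one_div_atTop_nhds_zero_nat (𝕜 := ℝ)).const_mul (r : ℝ))
    rw [mul_zero, sub_zero] at h2
    refine h2.congr' ?_
    filter_upwards [eventually_gt_atTop 0] with R hR
    have : (0 : ℝ) < R := by exact_mod_cast hR
    field_simp
  have h3 : Tendsto (fun R : ℕ => x * ((3 * (((R : ℝ) - r) / R) ^ k - 1) / 2)) atTop
      (𝓝 (x * ((3 * 1 ^ k - 1) / 2))) :=
    ((((h1.pow k).const_mul 3).sub_const 1).div_const 2).const_mul x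
  obtain ⟨R, hR⟩ := ((h3.eventually_const_lt (show y < x * ((3 * 1 ^ k - 1) / 2) by
    rw [one_pow]
    linarith)).and (eventually_gt_atTop r)).exists
  exact ⟨R, hR.2, hR.1⟩

/-- A single layer is an antichain of cells, so neither gaps nor common neighbours are needed. The
choice `κ = 3 / 4 < 1` gives the constant `√(3 / 8) > 1 / 2`. -/
theorem eventually_exists_edgeColouring_two :
    ∀ᶠ n : ℕ in atTop, ∀ N : ℕ,
      (N : ℝ) ≤ 1 / 2 * (n : ℝ) ^ (2 - 1) * Real.logb 2 (n : ℝ) ^ (1 / ((2 : ℕ) : ℝ)) →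
      ∀ T : Digraph (Fin N), T.IsTournament →
        ∃ c : T.EdgeColouring 2, ¬ c.HasMonoPath n := by
  refine eventually_exists_edgeColouring (k := 2) (r := 0) (R := 1) (a := 1) (C := 1)
    (κ := 3 / 4) le_rfl one_pos (by norm_num) one_pos (by norm_num) (fun t => 2 ^ t)
    (Eventually.of_forall fun t => by simp) ?_ ?_
  · intro t _ N T _ U hU
    exact ⟨fun _ => U, rfl, by simp, by simp, by simpa using hU⟩
  · have h1 : (((0 : ℕ) : ℝ) + 1) / Real.sqrt ((2 : ℕ) : ℝ) *
        ((3 * ((((1 : ℕ) : ℝ) - (0 : ℕ)) / (1 : ℕ)) ^ 2 - 1) / 2) =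
        1 / Real.sqrt ((2 : ℕ) : ℝ) := by
      norm_num
    rw [h1]
    refine lt_of_pow_lt_pow_left₀ 2 (by positivity) ?_
    rw [mul_pow, one_div ((2 : ℕ) : ℝ), Real.rpow_inv_natCast_pow (by norm_num) (by norm_num),
      div_pow (1 : ℝ) (Real.sqrt _), Real.sq_sqrt (by positivity)]
    norm_num

theorem eventually_exists_edgeColouring_of_three_le {k : ℕ} (hk : 3 ≤ k) :
    ∀ᶠ n : ℕ in atTop, ∀ N : ℕ,
      (N : ℝ) ≤ 1 / 2 * (n : ℝ) ^ (k - 1) * Real.logb 2 (n : ℝ) ^ (1 / (k : ℝ)) →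
      ∀ T : Digraph (Fin N), T.IsTournament →
        ∃ c : T.EdgeColouring k, ¬ c.HasMonoPath n := by
  obtain ⟨r, hr, hcrit⟩ := exists_layers hk
  have hk' : (3 : ℝ) ≤ k := by exact_mod_cast hk
  have hr' : (1 : ℝ) ≤ r := by exact_mod_cast hr
  obtain ⟨Δ, hΔ⟩ : ∃ Δ, Δ = (k + 1) ^ r := ⟨_, rfl⟩
  have hΔ1 : 2 ≤ Δ := by
    rw [hΔ]
    exact le_trans (by omega : 2 ≤ k + 1) (Nat.le_self_pow (by omega) _)
  rw [← hΔ] at hcrit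
  have hΔ0 : (0 : ℝ) < Δ := by exact_mod_cast (by omega : 0 < Δ)
  have hhalf := half_lt_of_pow_lt (by omega) (by positivity) hcrit
  have hκ : 0 < ((k : ℝ) - 1) / ((5 * r * Δ : ℕ) : ℝ) := by
    refine div_pos (by linarith) ?_
    push_cast
    positivity
  have hγ := Real.rpow_pos_of_pos hκ (1 / (k : ℝ))
  rw [← div_lt_iff₀ hγ] at hhalf
  obtain ⟨R, hR, hRθ⟩ := exists_gap_ratio hhalf k r
  rw [div_lt_iff₀ hγ] at hRθ
  -- A host for `D = Δ * t` and this `b` needs `2 ^ (4 * r * (Δ * t + 1))` vertices, which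
  -- determines `a` and `C`. With `κ = (k - 1) / (5 * r * Δ)` one has `a * κ = 4 / 5 * (k - 1)`.
  refine eventually_exists_edgeColouring (k := k) (r := r) (R := R) (a := 4 * r * Δ)
    (C := 2 ^ (4 * r)) (by omega) hR hκ (by positivity) ?_ (fun t => 2 ^ (r * (Δ * t + 1)))
    ?_ ?_ hRθ
  · push_cast
    have h1 : (4 * r * Δ : ℝ) * ((k - 1) / (5 * r * Δ)) = 4 / 5 * (k - 1) := by
      field_simp
    rw [h1]
    linarith
  · filter_upwards [eventually_ge_atTop (R ^ k)] with t ht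
    have h1 : R ^ k * t ≤ 2 ^ t * 2 ^ t :=
      Nat.mul_le_mul (ht.trans Nat.lt_two_pow_self.le) Nat.lt_two_pow_self.le
    have h2 : 2 ^ (2 * t + 1) ≤ 2 ^ (r * (Δ * t + 1)) := by
      refine Nat.pow_le_pow_right (by norm_num) ?_
      calc 2 * t + 1 ≤ Δ * t + 1 := by gcongr
        _ ≤ r * (Δ * t + 1) := Nat.le_mul_of_pos_left _ (by omega)
    have h3 : 2 ^ (2 * t + 1) = 2 * (2 ^ t * 2 ^ t) := by ring
    have h4 : 2 ^ t ≤ 2 ^ t * 2 ^ t := Nat.le_mul_of_pos_left _ (Nat.two_pow_pos t)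
    omega
  · intro t ht N T hT U hU
    rw [← hΔ]
    refine exists_isHost T.Adj (fun u v huv => (hT.2 u v huv).or) (Δ * t) _
      (2 * (r * (Δ * t + 1))) (Nat.mul_pos (by omega) ht) ?_ r U (le_trans (le_of_eq ?_) hU)
    · rw [← pow_mul, mul_comm]
    · rw [← pow_add]
      congr 1
      ring

theorem mainTheorem6 (k : ℕ) (hk : 2 ≤ k) :
    (∃ C : ℝ, 0 < C ∧ ∀ N : ℕ → ℕ,
      (∀ᶠ n : ℕ in atTop,
        C * ((n : ℝ) ^ (k - 1) * Real.sqrt (Real.logb 2 (n : ℝ))) ≤ (N n : ℝ)) →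
      Tendsto (fun n : ℕ => coinMeasure (N n)
          {ω | ∀ c : (orientComplete ω).EdgeColouring k, c.HasMonoPath n})
        atTop (𝓝 1)) ∧
    (∀ᶠ n : ℕ in atTop, ∀ N : ℕ,
      (N : ℝ) ≤ 1 / 2 * (n : ℝ) ^ (k - 1) * Real.logb 2 (n : ℝ) ^ (1 / (k : ℝ)) →
      ∀ T : Digraph (Fin N), T.IsTournament →
        ∃ c : T.EdgeColouring k, ¬ c.HasMonoPath n) := by
  refine ⟨⟨2000 * k, by positivity, tendsto_coinMeasure_hasMonoPath k hk⟩, ?_⟩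
  rcases hk.eq_or_lt with rfl | hk
  · exact eventually_exists_edgeColouring_two
  · exact eventually_exists_edgeColouring_of_three_le hk
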